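/- Model. The machine is a deterministic word RAM: each of its words holds an integer in $[0,2^{b})$; it has finitely many registers and arrays with indirect addressing, all initially $0$ outside the input; each access, addition, truncated subtraction, multiplication, integer division (all modulo $2^b$), comparison, assignment and branch takes one step. Sizes are measured in words. Let $G$ be a directed graph on $V(G)=\{0,\dots,n-1\}$ with $m$ edges and integer edge weights $w(e)\in[1,W]$, $W\ge 1$. Let $s\in V(G)$ and let $P=\langle v_0,\dots,v_{p-1}\rangle$, $v_0=s$, be a shortest path in $G$ from $s$ to some vertex $z$ (for example the path $P_T$ from $s$ to a centroid $z$ in a shortest path tree $T$ of $G$ rooted at $s$). All paths are simple. For $0\le f<p$ and $t\in V(G)$, a path $R$ from $s$ to $t$ in $G-v_f$ is a departing path avoiding $v_f$ if $V(R)\cap\{v_0,\dots,v_{f-1}\}$ is the vertex set of a prefix of $R$ and $(V(R)\setminus\{t\})\cap\{v_{f+1},\dots,v_{p-1}\}=\emptyset$. Let $\mathsf{ddist}_{G-v_f}(s,t)\in\mathbb N\cup\{\infty\}$ be the smallest length of a departing path from $s$ to $t$ avoiding $v_f$ ($\infty$ if there is none). For $\varepsilon_1>0$, a $P$-faulty $(1+\varepsilon_1)$-approximate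 departing-path oracle is a data structure that answers each query $(x,t)$, $x\in V(P)$, $t\in V(G)$, by a value $q(x,t)$ with $$\mathsf{ddist}_{G-x}(s,t)\le q(x,t)\le(1+\varepsilon_1)\,\mathsf{ddist}_{G-x}(s,t).$$ Lemma. There are a construction program, a query program and constants $C$ and $c$ such that for all $G$, $n$, $m$, $W$, $s$, $P$ as above, every real $\varepsilon_1\in(0,1]$ and every word length $b$ with $2^b\ge (nW\lceil\varepsilon_1^{-1}\rceil+1)^c$, the following holds. Given $G$ as a list of its edges with their weights in any order, $P$, and $\lceil\varepsilon_1^{-1}\rceil$, the construction program halts and outputs an array of words from which the query program, given also $(x,t)$, answers every query as a $P$-faulty $(1+\varepsilon_1)$-approximate departing-path oracle. If moreover $n\ge 3$, then - the size of the array is at most $C\,\varepsilon_1^{-1}\,n\log^2 n\,\log(nW)$ words, - the construction takes at most $C\,\varepsilon_1^{-1}\log^2 n\,\log(nW)\,(m+n\log n)$ steps, - each query takes at most $C\,\log n\cdot\log(\varepsilon_1^{-1}\log(nW))$ steps, where $\log$ is the natural logarithm. -/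

import Mathlib

/-! ### A word RAM with a step count

Finitely many registers and finitely many arrays are mentioned by a program; every cell holds one
machine word, a natural number below `B` (`B = 2 ^ w` for words of `w` bits). All results are taken
modulo `B`. Each register access, array access, arithmetic operation, comparison, assignment and
branch costs one step. -/

namespace WordRAM

/-- The machine operations on words: sum, truncated difference, product, quotient, and the two
comparisons (with value `1` for true and `0` for false). -/
inductive Op where
  | add | sub | mul | div | lt | eq

def Op.apply : Op → ℕ → ℕ → ℕ
  | .add, a, b => a + b
  | .sub, a, b => a - b
  | .mul, a, b => a * b
  | .div, a, b => a / b
  | .lt, a, b => if a < b then 1 else 0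
  | .eq, a, b => if a = b then 1 else 0

/-- Expressions: constants, registers, indirect reads `a[e]`, and machine operations. -/
inductive Expr where
  | const (k : ℕ)
  | reg (r : ℕ)
  | load (a : ℕ) (i : Expr)
  | op (o : Op) (e₁ e₂ : Expr)

/-- Programs: `store a i e` is `a[i] := e`; a guard holds when its value is not `0`. -/
inductive Cmd where
  | skip
  | assign (r : ℕ) (e : Expr)
  | store (a : ℕ) (i e : Expr)
  | seq (c₁ c₂ : Cmd)
  | ite (g : Expr) (c₁ c₂ : Cmd)
  | loop (g : Expr) (c : Cmd)

/-- A memory content: `reg r` is register `r` and `arr a i` is cell `i` of array `a`. -/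
structure State where
  reg : ℕ → ℕ
  arr : ℕ → ℕ → ℕ

def State.setReg (σ : State) (r v : ℕ) : State :=
  { σ with reg := Function.update σ.reg r v }

def State.setArr (σ : State) (a i v : ℕ) : State :=
  { σ with arr := Function.update σ.arr a (Function.update (σ.arr a) i v) }

def Expr.eval (B : ℕ) (σ : State) : Expr → ℕ
  | .const k => k % B
  | .reg r => σ.reg r
  | .load a i => σ.arr a (i.eval B σ)
  | .op o e₁ e₂ => o.apply (e₁.eval B σ) (e₂.eval B σ) % B

/-- The number of steps taken by the evaluation of an expression. -/
def Expr.cost : Expr → ℕ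
  | .const _ => 1
  | .reg _ => 1
  | .load _ i => i.cost + 1
  | .op _ e₁ e₂ => e₁.cost + e₂.cost + 1

/-- `Exec B c σ τ T`: with word capacity `B`, the program `c` started in `σ` halts in `τ` after
exactly `T` steps. -/
inductive Exec (B : ℕ) : Cmd → State → State → ℕ → Prop where
  | skip (σ : State) : Exec B .skip σ σ 1
  | assign (r : ℕ) (e : Expr) (σ : State) :
      Exec B (.assign r e) σ (σ.setReg r (e.eval B σ)) (e.cost + 1)
  | store (a : ℕ) (i e : Expr) (σ : State) :
      Exec B (.store a i e) σ (σ.setArr a (i.eval B σ) (e.eval B σ)) (i.cost + e.cost + 1)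
  | seq {c₁ c₂ : Cmd} {σ τ ρ : State} {T₁ T₂ : ℕ} :
      Exec B c₁ σ τ T₁ → Exec B c₂ τ ρ T₂ → Exec B (.seq c₁ c₂) σ ρ (T₁ + T₂)
  | ite_true {g : Expr} {c₁ c₂ : Cmd} {σ τ : State} {T : ℕ} :
      g.eval B σ ≠ 0 → Exec B c₁ σ τ T → Exec B (.ite g c₁ c₂) σ τ (g.cost + 1 + T)
  | ite_false {g : Expr} {c₁ c₂ : Cmd} {σ τ : State} {T : ℕ} :
      g.eval B σ = 0 → Exec B c₂ σ τ T → Exec B (.ite g c₁ c₂) σ τ (g.cost + 1 + T)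
  | loop_true {g : Expr} {c : Cmd} {σ τ ρ : State} {T₁ T₂ : ℕ} :
      g.eval B σ ≠ 0 → Exec B c σ τ T₁ → Exec B (.loop g c) τ ρ T₂ →
      Exec B (.loop g c) σ ρ (g.cost + 1 + T₁ + T₂)
  | loop_false {g : Expr} {c : Cmd} {σ : State} :
      g.eval B σ = 0 → Exec B (.loop g c) σ σ (g.cost + 1)

/-- The machine is deterministic: final memory and step count are determined by the start. -/
theorem Exec.deterministic {B : ℕ} {c : Cmd} {σ τ : State} {T : ℕ} (h : Exec B c σ τ T) :
    ∀ {τ' : State} {T' : ℕ}, Exec B c σ τ' T' → τ = τ' ∧ T = T' := by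
  induction h with
  | skip σ => intro τ' T' h'; cases h'; exact ⟨rfl, rfl⟩
  | assign r e σ => intro τ' T' h'; cases h'; exact ⟨rfl, rfl⟩
  | store a i e σ => intro τ' T' h'; cases h'; exact ⟨rfl, rfl⟩
  | seq _ _ ih₁ ih₂ =>
    intro τ' T' h'
    cases h' with
    | seq k₁ k₂ =>
      obtain ⟨rfl, rfl⟩ := ih₁ k₁
      obtain ⟨rfl, rfl⟩ := ih₂ k₂
      exact ⟨rfl, rfl⟩
  | ite_true hg _ ih =>
    intro τ' T' h'
    cases h' with
    | ite_true _ k => obtain ⟨rfl, rfl⟩ := ih k; exact ⟨rfl, rfl⟩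
    | ite_false hg' _ => exact absurd hg' hg
  | ite_false hg _ ih =>
    intro τ' T' h'
    cases h' with
    | ite_true hg' _ => exact absurd hg hg'
    | ite_false _ k => obtain ⟨rfl, rfl⟩ := ih k; exact ⟨rfl, rfl⟩
  | loop_true hg _ _ ih₁ ih₂ =>
    intro τ' T' h'
    cases h' with
    | loop_true _ k₁ k₂ =>
      obtain ⟨rfl, rfl⟩ := ih₁ k₁
      obtain ⟨rfl, rfl⟩ := ih₂ k₂
      exact ⟨rfl, rfl⟩
    | loop_false hg' => exact absurd hg' hg
  | loop_false hg =>
    intro τ' T' h'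
    cases h' with
    | loop_true hg' _ _ => exact absurd hg hg'
    | loop_false _ => exact ⟨rfl, rfl⟩

end WordRAM

/-! ### Paths, departing paths and departing-path oracles -/

namespace DepartingPath

/-- `R` is a (simple) path from `u` to `v` in the directed graph `G`, as its vertex sequence. -/
def IsPath {V : Type*} (G : Digraph V) (R : List V) (u v : V) : Prop :=
  R.head? = some u ∧ R.getLast? = some v ∧ R.IsChain G.Adj ∧ R.Nodup

/-- The weighted length of a path. -/
def pathWeight {V : Type*} (wt : V → V → ℕ) : List V → ℕ
  | a :: b :: l => wt a b + pathWeight wt (b :: l)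
  | _ => 0

/-- `P` is a shortest path from `u` to `v` in `G`. -/
def IsShortestPath {V : Type*} (G : Digraph V) (wt : V → V → ℕ) (P : List V) (u v : V) : Prop :=
  IsPath G P u v ∧ ∀ R : List V, IsPath G R u v → pathWeight wt P ≤ pathWeight wt R

/-- Let `P = ⟨v₀, …, v_{p-1}⟩` and `f < p`. `R` is a departing path from `s` to `t` avoiding `v_f`:
a path from `s` to `t` in `G - v_f` such that `V(R) ∩ {v₀, …, v_{f-1}}` is the vertex set of a
prefix of `R`, and no vertex of `R` other than `t` lies in `{v_{f+1}, …, v_{p-1}}`. -/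
def IsDeparting {V : Type*} (G : Digraph V) (P : List V) (f : ℕ) (hf : f < P.length) (s t : V)
    (R : List V) : Prop :=
  IsPath G R s t ∧ P[f] ∉ R ∧
    (∃ A : List V, A <+: R ∧ ∀ v : V, v ∈ A ↔ v ∈ R ∧ v ∈ P.take f) ∧
    (∀ v ∈ R, v ≠ t → v ∉ P.drop (f + 1))

/-- The length of a shortest departing path from `s` to `t` avoiding `v_f` (`⊤` if there is
none). -/
noncomputable def ddist {V : Type*} (G : Digraph V) (wt : V → V → ℕ) (P : List V) (f : ℕ)
    (hf : f < P.length) (s t : V) : ℕ∞ :=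
  ⨅ (R : List V) (_ : IsDeparting G P f hf s t R), (pathWeight wt R : ℕ∞)

/-- `q` answers the queries `(x, t)`, for `x` on `P` and any vertex `t`, as a `P`-faulty
`(1 + ε)`-approximate departing-path oracle has to. -/
def IsDPO {V : Type*} (G : Digraph V) (wt : V → V → ℕ) (s : V) (P : List V) (ε : ℝ)
    (q : V → V → ℕ∞) : Prop :=
  ∀ (f : ℕ) (hf : f < P.length) (t : V),
    ddist G wt P f hf s t ≤ q P[f] t ∧
    (q P[f] t : ENNReal) ≤ ENNReal.ofReal (1 + ε) * (ddist G wt P f hf s t : ENNReal)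

open WordRAM in
/-- Input of the construction: registers `0, 1, 2, 3` hold the numbers of vertices, of edges and of
vertices of `P`, and the accuracy parameter `K`; arrays `0, 1, 2` hold the tails, the heads and the
weights of the edges, in the order of the list `E`, and array `3` holds `P`. The rest is `0`. -/
def buildInput {n : ℕ} (wt : Fin n → Fin n → ℕ) (E : List (Fin n × Fin n)) (P : List (Fin n))
    (K : ℕ) : State where
  reg := fun r => [n, E.length, P.length, K].getD r 0
  arr := fun a i =>
    ([E.map (fun e => (e.1 : ℕ)), E.map (fun e => (e.2 : ℕ)), E.map (fun e => wt e.1 e.2),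
      P.map (fun v => (v : ℕ))].getD a []).getD i 0

open WordRAM in
/-- The data structure left by the construction: the first `reg 0` words of array `0`. -/
def builtOracle (σ : State) : List ℕ :=
  (List.range (σ.reg 0)).map (σ.arr 0)

open WordRAM in
/-- Input of a query: array `0` holds the data structure, registers `0` and `1` hold the query
`(x, t)`. The rest is `0`. -/
def queryInput {n : ℕ} (D : List ℕ) (x t : Fin n) : State where
  reg := fun r => [(x : ℕ), (t : ℕ)].getD r 0
  arr := fun a i => if a = 0 then D.getD i 0 else 0

open WordRAM in
/-- The answer to a query: infinite if register `0` holds `0`, else the content of register `1`. -/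
def queryAnswer (σ : State) : ℕ∞ :=
  if σ.reg 0 = 0 then ⊤ else (σ.reg 1 : ℕ∞)

end DepartingPath

namespace WordRAM

/-! ### Program logic -/

/-! Read the index `f` of the failed vertex as time. Let `t` be `v_f`'s successor on the path, a
later vertex of it, or a vertex off it. A departing path to `t` is a prefix of `P`, one edge leaving
it, and then vertices off `P`; because `P` is shortest, its own prefix is the best beginning, and
because cycles can be cut, simple paths may be replaced by walks (`Net.Dep`, `isDeparting_of_dep`,
`dep_of_isDeparting`). As `f` grows, more points of departure are allowed, so the least value of
such a walk only falls. Hence it suffices to store, for each `t` and each of a few rounded lengths,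
the first time at which a walk of that length exists; a query is then a binary search. If `t` comes
before `v_f` on `P`, the answer is the length of the prefix, and for `t = v_f` it is infinite.

The rounded lengths are `2 ^ i * (L + r) / L` with `r < L`, for scales `i` up to about `log (n W)`.
At one scale all weights are multiplied by `n L / 2 ^ i` and rounded up, and entry `ℓ` of a row
stands for values up to `ℓ n`, `ℓ < R = 2 L`.

All entries of a table are found by a simultaneous bisection over time (`Net.Table.step`). Known
times are multiples of `2 h`; an entry with time `a` has to be tested against `a - h`. For an edge
`u → t` and an entry `ℓ` of `t`, take the first entry `ℓ'` of `u` whose time is at most that of `ℓ`.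
If the time of `ℓ'` is strictly smaller, it is at most `a - 2 h`, so the walk to `u` is already
decided and `ℓ' n` plus the weight is an initial label. If the times agree, both entries are tested
against the same time, and the edge becomes an arc between them. Together with the edges leaving `P`
by time `a - h` this is one shortest path problem with at most `m R` arcs, and `a` becomes `a - h`
exactly where the distance is at most `ℓ n`. Along a walk, rounding to a multiple of `n` is paid
only where decided entries are left for good, hence once per halving: error `n` per step and `D n`
after `D = ⌈log₂ n⌉` steps.

Rounding of weights costs another `n`, since a simple path has fewer than `n` edges. The total `(D +
1) n` is compared with values of at least `L n`, and `L = 2 K (D + 2)` with `K = ⌈1/ε⌉` makes the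
relative error at most `1 / K` (`Tables.isAnswer`).

Distances are integers below `n R` and arc weights are positive, so Dial's bucket algorithm solves
one halving in `O((m + n) R)` steps (`Swept`, `sweep_spec`); the pointers `ℓ'` of an edge are found
by one scan because rows are monotone (`seedRow_spec`). With `O(log n)` halvings, `O(log (n W))`
scales and `R = O(ε⁻¹ log n)` this gives the time bound. The remaining work is a Hoare-style logic
for the word RAM whose loop rule carries a time budget (`wp_loop`), together with the check that no
word overflows (`word_size`). -/

instance : Add Expr := ⟨Expr.op .add⟩
instance : Sub Expr := ⟨Expr.op .sub⟩
instance : Mul Expr := ⟨Expr.op .mul⟩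
instance : Div Expr := ⟨Expr.op .div⟩

/-- The guards `e₁ < e₂` and `e₁ = e₂`. -/
def Expr.lt (e₁ e₂ : Expr) : Expr := .op .lt e₁ e₂
def Expr.eq (e₁ e₂ : Expr) : Expr := .op .eq e₁ e₂

section eval
variable {B : ℕ} {σ : State} {e₁ e₂ : Expr}

theorem Expr.eval_const {k : ℕ} (h : k < B) : (Expr.const k).eval B σ = k := Nat.mod_eq_of_lt h
theorem Expr.eval_reg {r : ℕ} : (Expr.reg r).eval B σ = σ.reg r := rfl
theorem Expr.eval_add (h : e₁.eval B σ + e₂.eval B σ < B) :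
    (e₁ + e₂).eval B σ = e₁.eval B σ + e₂.eval B σ := Nat.mod_eq_of_lt h
theorem Expr.eval_lt (h : 1 < B) :
    (e₁.lt e₂).eval B σ = if e₁.eval B σ < e₂.eval B σ then 1 else 0 := by
  apply Nat.mod_eq_of_lt
  unfold Op.apply
  dsimp only
  split_ifs <;> omega
theorem Expr.eval_eq (h : 1 < B) :
    (e₁.eq e₂).eval B σ = if e₁.eval B σ = e₂.eval B σ then 1 else 0 := by
  apply Nat.mod_eq_of_lt
  unfold Op.apply
  dsimp only
  split_ifs <;> omega

end eval

theorem Expr.cost_const {k : ℕ} : (Expr.const k).cost = 1 := rfl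
theorem Expr.cost_reg {r : ℕ} : (Expr.reg r).cost = 1 := rfl
theorem Expr.cost_add {e₁ e₂ : Expr} : (e₁ + e₂).cost = e₁.cost + e₂.cost + 1 := rfl
theorem Expr.cost_lt {e₁ e₂ : Expr} : (e₁.lt e₂).cost = e₁.cost + e₂.cost + 1 := rfl

theorem State.reg_setReg (σ : State) (r v r' : ℕ) :
    (σ.setReg r v).reg r' = if r' = r then v else σ.reg r' := by
  simp [State.setReg, Function.update_apply]
theorem State.arr_setReg (σ : State) (r v : ℕ) : (σ.setReg r v).arr = σ.arr := rfl
theorem State.reg_setArr (σ : State) (a i v : ℕ) : (σ.setArr a i v).reg = σ.reg := rfl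
theorem State.arr_setArr (σ : State) (a i v a' : ℕ) :
    (σ.setArr a i v).arr a' = if a' = a then Function.update (σ.arr a) i v else σ.arr a' := by
  by_cases h : a' = a
  · subst h; simp [State.setArr]
  · simp [State.setArr, h]

/-- The program `c` halts from `σ`, in a memory and after a number of steps that satisfy `Q`. -/
def Wp (B : ℕ) (c : Cmd) (σ : State) (Q : State → ℕ → Prop) : Prop :=
  ∃ τ T, Exec B c σ τ T ∧ Q τ T

/-- The registers written by a program. -/
def Cmd.regs : Cmd → List ℕ
  | .skip => []
  | .assign r _ => [r]
  | .store _ _ _ => []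
  | .seq c₁ c₂ => c₁.regs ++ c₂.regs
  | .ite _ c₁ c₂ => c₁.regs ++ c₂.regs
  | .loop _ c => c.regs

/-- The arrays written by a program. -/
def Cmd.arrs : Cmd → List ℕ
  | .skip => []
  | .assign _ _ => []
  | .store a _ _ => [a]
  | .seq c₁ c₂ => c₁.arrs ++ c₂.arrs
  | .ite _ c₁ c₂ => c₁.arrs ++ c₂.arrs
  | .loop _ c => c.arrs

/-- `τ` agrees with `σ` on all registers and arrays that `c` does not write. -/
structure Frame (c : Cmd) (σ τ : State) : Prop where
  reg : ∀ r, r ∉ c.regs → τ.reg r = σ.reg r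
  arr : ∀ a, a ∉ c.arrs → τ.arr a = σ.arr a

/-- The lists of written registers and arrays are computable, so for a concrete program each
unchanged cell is later certified by `decide`. -/
theorem Exec.frame {B : ℕ} {c : Cmd} {σ τ : State} {T : ℕ} (h : Exec B c σ τ T) :
    Frame c σ τ := by
  induction h with
  | skip σ => exact ⟨fun _ _ => rfl, fun _ _ => rfl⟩
  | assign r e σ =>
    refine ⟨fun r' h => ?_, fun _ _ => rfl⟩
    simp only [Cmd.regs, List.mem_singleton] at h
    simp [State.reg_setReg, h]
  | store a i e σ =>
    refine ⟨fun _ _ => rfl, fun a' h => ?_⟩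
    simp only [Cmd.arrs, List.mem_singleton] at h
    simp [State.arr_setArr, h]
  | seq _ _ ih₁ ih₂ =>
    constructor
    · intro r h
      simp only [Cmd.regs, List.mem_append, not_or] at h
      rw [ih₂.reg r h.2, ih₁.reg r h.1]
    · intro r h
      simp only [Cmd.arrs, List.mem_append, not_or] at h
      rw [ih₂.arr r h.2, ih₁.arr r h.1]
  | ite_true _ _ ih =>
    constructor
    · intro r h
      simp only [Cmd.regs, List.mem_append, not_or] at h
      exact ih.reg r h.1
    · intro r h
      simp only [Cmd.arrs, List.mem_append, not_or] at h
      exact ih.arr r h.1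
  | ite_false _ _ ih =>
    constructor
    · intro r h
      simp only [Cmd.regs, List.mem_append, not_or] at h
      exact ih.reg r h.2
    · intro r h
      simp only [Cmd.arrs, List.mem_append, not_or] at h
      exact ih.arr r h.2
  | loop_true _ _ _ ih₁ ih₂ =>
    exact ⟨fun r h => (ih₂.reg r h).trans (ih₁.reg r h),
      fun r h => (ih₂.arr r h).trans (ih₁.arr r h)⟩
  | loop_false _ => exact ⟨fun _ _ => rfl, fun _ _ => rfl⟩

/-! ### Total-correctness rules with step counts -/

section wp
variable {B : ℕ} {σ : State} {Q : State → ℕ → Prop}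

/-- Besides weakening the postcondition, this hands over the frame of the execution, so
specifications need to mention only the cells that change. -/
theorem Wp.mono {c : Cmd} {Q' : State → ℕ → Prop} (h : Wp B c σ Q)
    (hQ : ∀ τ T, Frame c σ τ → Q τ T → Q' τ T) : Wp B c σ Q' := by
  obtain ⟨τ, T, hE, hq⟩ := h
  exact ⟨τ, T, hE, hQ τ T hE.frame hq⟩

theorem wp_skip (h : Q σ 1) : Wp B .skip σ Q := ⟨_, _, .skip σ, h⟩

theorem wp_assign {r : ℕ} {e : Expr} (h : Q (σ.setReg r (e.eval B σ)) (e.cost + 1)) :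
    Wp B (.assign r e) σ Q := ⟨_, _, .assign r e σ, h⟩

theorem wp_store {a : ℕ} {i e : Expr}
    (h : Q (σ.setArr a (i.eval B σ) (e.eval B σ)) (i.cost + e.cost + 1)) :
    Wp B (.store a i e) σ Q := ⟨_, _, .store a i e σ, h⟩

theorem wp_assign_eq {r : ℕ} {e : Expr} {v : ℕ} (hv : e.eval B σ = v)
    (h : Q (σ.setReg r v) (e.cost + 1)) : Wp B (.assign r e) σ Q := wp_assign (hv ▸ h)

theorem wp_seq {c₁ c₂ : Cmd}
    (h : Wp B c₁ σ fun τ T₁ => Wp B c₂ τ fun ρ T₂ => Q ρ (T₁ + T₂)) :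
    Wp B (.seq c₁ c₂) σ Q := by
  obtain ⟨τ, T₁, h₁, ρ, T₂, h₂, hq⟩ := h
  exact ⟨ρ, _, .seq h₁ h₂, hq⟩

theorem wp_ite {g : Expr} {c₁ c₂ : Cmd}
    (h₁ : g.eval B σ ≠ 0 → Wp B c₁ σ fun τ T => Q τ (g.cost + 1 + T))
    (h₂ : g.eval B σ = 0 → Wp B c₂ σ fun τ T => Q τ (g.cost + 1 + T)) :
    Wp B (.ite g c₁ c₂) σ Q := by
  by_cases hg : g.eval B σ = 0
  · obtain ⟨τ, T, h, hq⟩ := h₂ hg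
    exact ⟨τ, _, .ite_false hg h, hq⟩
  · obtain ⟨τ, T, h, hq⟩ := h₁ hg
    exact ⟨τ, _, .ite_true hg h, hq⟩

/-- Total correctness of a loop: every round pays from the budget carried by the invariant. -/
theorem wp_loop {g : Expr} {c : Cmd} (I : State → ℕ → Prop) {b : ℕ} (h0 : I σ b)
    (hstep : ∀ τ b, Frame (.loop g c) σ τ → I τ b → g.eval B τ ≠ 0 →
      Wp B c τ fun ρ T => ∃ b', I ρ b' ∧ g.cost + 1 + T + b' ≤ b) :
    Wp B (.loop g c) σ fun τ T =>
      g.eval B τ = 0 ∧ ∃ b', I τ b' ∧ T + b' ≤ b + (g.cost + 1) := by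
  suffices H : ∀ b τ, Frame (.loop g c) σ τ → I τ b →
      Wp B (.loop g c) τ fun τ T =>
        g.eval B τ = 0 ∧ ∃ b', I τ b' ∧ T + b' ≤ b + (g.cost + 1) from
    H b σ ⟨fun _ _ => rfl, fun _ _ => rfl⟩ h0
  intro b
  -- The budget is the termination measure: every round consumes at least the cost of its guard,
  -- which is positive.
  induction b using Nat.strong_induction_on with
  | _ b ih =>
    intro τ hF hI
    by_cases hg : g.eval B τ = 0
    · exact ⟨τ, _, .loop_false hg, hg, b, hI, by omega⟩
    · obtain ⟨ρ, T, hE, b', hI', hb⟩ := hstep τ b hF hI hg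
      have hF' : Frame (.loop g c) σ ρ :=
        ⟨fun r h => (hE.frame.reg r h).trans (hF.reg r h),
          fun a h => (hE.frame.arr a h).trans (hF.arr a h)⟩
      obtain ⟨π, T', hE', hg', b'', hI'', hT'⟩ := ih b' (by omega) ρ hF' hI'
      exact ⟨π, _, .loop_true hg hE hE', hg', b'', hI'', by omega⟩

end wp

/-- `for r < N do c`. -/
def Cmd.for (r : ℕ) (N : Expr) (c : Cmd) : Cmd :=
  .seq (.assign r (.const 0))
    (.loop (Expr.lt (.reg r) N) (.seq c (.assign r (.reg r + .const 1))))

/-- A counting loop. Each round costs at most `C` beyond what it takes from the potential `b`. -/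
theorem wp_for {B : ℕ} {σ : State} {r : ℕ} {N : Expr} {c : Cmd} (I : ℕ → State → ℕ → Prop)
    (k C : ℕ) {b : ℕ} (hk : k < B) (hB : 1 < B) (hr : r ∉ c.regs)
    (hN : ∀ i τ b, i ≤ k → Frame (.for r N c) σ τ → τ.reg r = i → I i τ b → N.eval B τ = k)
    (h0 : I 0 (σ.setReg r 0) b)
    (hstep : ∀ i τ b, i < k → Frame (.for r N c) σ τ → τ.reg r = i → I i τ b →
      Wp B c τ fun ρ T => ∃ b', I (i + 1) (ρ.setReg r (i + 1)) b' ∧ T + b' ≤ b + C) :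
    Wp B (.for r N c) σ fun τ T =>
      ∃ b', I k τ b' ∧ τ.reg r = k ∧ T + b' ≤ b + k * (C + N.cost + 8) + (N.cost + 5) := by
  have hF0 : Frame (.for r N c) σ (σ.setReg r 0) := by
    refine ⟨fun r' h => ?_, fun _ _ => rfl⟩
    simp only [Cmd.for, Cmd.regs, List.mem_append, List.mem_singleton, not_or] at h
    simp [State.reg_setReg, h.1]
  have hFr : ∀ τ, Frame (.loop (Expr.lt (.reg r) N) (.seq c (.assign r (.reg r + .const 1))))
      (σ.setReg r 0) τ → Frame (.for r N c) σ τ := fun τ hF =>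
    ⟨fun r' h => (hF.reg r' fun h' => h (by simpa [Cmd.for, Cmd.regs] using Or.inr h')).trans
        (hF0.reg r' h),
      fun a h => (hF.arr a fun h' => h (by simpa [Cmd.for, Cmd.arrs] using h')).trans
        (hF0.arr a h)⟩
  refine wp_seq (wp_assign ?_)
  rw [Expr.eval_const (by omega)]
  have := wp_loop (B := B) (g := Expr.lt (.reg r) N) (c := .seq c (.assign r (.reg r + .const 1)))
    (σ := σ.setReg r 0)
    -- Each outstanding round keeps `C + N.cost + 8` in reserve: `C` for the body, the rest for the
    -- guard and the increment of the counter.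
    (fun τ b' => ∃ i b₀, i ≤ k ∧ τ.reg r = i ∧ I i τ b₀ ∧ b' = b₀ + (k - i) * (C + N.cost + 8))
    ⟨0, b, by omega, by simp [State.reg_setReg], h0, rfl⟩ ?_
  · refine this.mono ?_
    rintro τ T hF ⟨hg, b', ⟨i, b₀, hi, hri, hI, rfl⟩, hT⟩
    rw [Expr.eval_lt hB, hN i τ b₀ hi (hFr τ hF) hri hI, Expr.eval_reg, hri] at hg
    have hik : i = k := by
      by_contra hne
      rw [if_pos (by omega)] at hg
      omega
    subst hik
    refine ⟨b₀, hI, hri, ?_⟩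
    simp only [Expr.cost_lt, Expr.cost_const, Expr.cost_reg, Nat.sub_self, Nat.sub_zero] at *
    omega
  · rintro τ _ hF ⟨i, b₀, hi, hri, hI, rfl⟩ hg
    rw [Expr.eval_lt hB, hN i τ b₀ hi (hFr τ hF) hri hI, Expr.eval_reg, hri] at hg
    have hik : i < k := by
      by_contra hne
      rw [if_neg hne] at hg
      exact hg rfl
    refine wp_seq ((hstep i τ b₀ hik (hFr τ hF) hri hI).mono ?_)
    rintro ρ T hFρ ⟨b', hI', hT⟩
    have hρr : ρ.reg r = i := (hFρ.reg r hr).trans hri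
    refine wp_assign ?_
    have he : (Expr.reg r + Expr.const 1).eval B ρ = i + 1 := by
      rw [Expr.eval_add, Expr.eval_reg, Expr.eval_const hB, hρr]
      rw [Expr.eval_reg, Expr.eval_const hB, hρr]
      omega
    rw [he]
    refine ⟨_, ⟨i + 1, b', hik, by simp [State.reg_setReg], hI', rfl⟩, ?_⟩
    obtain ⟨j, rfl⟩ : ∃ j, k = i + 1 + j := ⟨k - (i + 1), by omega⟩
    have e1 : i + 1 + j - i = j + 1 := by omega
    have e2 : i + 1 + j - (i + 1) = j := by omega
    simp only [Expr.cost_lt, Expr.cost_add, Expr.cost_const, Expr.cost_reg, e1, e2, add_mul]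
    omega

/-- A counting loop whose rounds cost at most `C` each. -/
theorem wp_for_const {B : ℕ} {σ : State} {r : ℕ} {N : Expr} {c : Cmd} (I : ℕ → State → Prop)
    (k C : ℕ) (hk : k < B) (hB : 1 < B) (hr : r ∉ c.regs)
    (hN : ∀ i τ, i ≤ k → Frame (.for r N c) σ τ → τ.reg r = i → I i τ → N.eval B τ = k)
    (h0 : I 0 (σ.setReg r 0))
    (hstep : ∀ i τ, i < k → Frame (.for r N c) σ τ → τ.reg r = i → I i τ →
      Wp B c τ fun ρ T => I (i + 1) (ρ.setReg r (i + 1)) ∧ T ≤ C) :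
    Wp B (.for r N c) σ fun τ T =>
      I k τ ∧ τ.reg r = k ∧ T ≤ k * (C + N.cost + 8) + (N.cost + 5) := by
  refine (wp_for (fun i τ _ => I i τ) k C (b := 0) hk hB hr
    (fun i τ _ => hN i τ) h0 fun i τ b hi hF hri hI => ?_).mono ?_
  · exact (hstep i τ hi hF hri hI).mono fun ρ T _ h => ⟨b, h.1, by omega⟩
  · rintro τ T _ ⟨b', hI, hri, hT⟩
    exact ⟨hI, hri, by omega⟩

/-- Simplification rules for the evaluation of expressions, their costs, and memory updates. -/
theorem evalRules :
    (∀ B σ k, (Expr.const k).eval B σ = k % B) ∧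
    (∀ B σ r, (Expr.reg r).eval B σ = σ.reg r) ∧
    (∀ B σ a i, (Expr.load a i).eval B σ = σ.arr a (i.eval B σ)) ∧
    (∀ B σ (e₁ e₂ : Expr), (e₁ + e₂).eval B σ = (e₁.eval B σ + e₂.eval B σ) % B) ∧
    (∀ B σ (e₁ e₂ : Expr), (e₁ - e₂).eval B σ = (e₁.eval B σ - e₂.eval B σ) % B) ∧
    (∀ B σ (e₁ e₂ : Expr), (e₁ * e₂).eval B σ = (e₁.eval B σ * e₂.eval B σ) % B) ∧
    (∀ B σ (e₁ e₂ : Expr), (e₁ / e₂).eval B σ = (e₁.eval B σ / e₂.eval B σ) % B) ∧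
    (∀ (σ : State) (r v r' : ℕ), (σ.setReg r v).reg r' = if r' = r then v else σ.reg r') ∧
    (∀ (σ : State) (r v : ℕ), (σ.setReg r v).arr = σ.arr) ∧
    (∀ (σ : State) (a i v : ℕ), (σ.setArr a i v).reg = σ.reg) ∧
    (∀ (σ : State) (a i v a' : ℕ), (σ.setArr a i v).arr a' =
      if a' = a then Function.update (σ.arr a) i v else σ.arr a') ∧
    (∀ k, (Expr.const k).cost = 1) ∧ (∀ r, (Expr.reg r).cost = 1) ∧
    (∀ a i, (Expr.load a i).cost = i.cost + 1) ∧
    (∀ e₁ e₂ : Expr, (e₁ + e₂).cost = e₁.cost + e₂.cost + 1) ∧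
    (∀ e₁ e₂ : Expr, (e₁ - e₂).cost = e₁.cost + e₂.cost + 1) ∧
    (∀ e₁ e₂ : Expr, (e₁ * e₂).cost = e₁.cost + e₂.cost + 1) ∧
    (∀ e₁ e₂ : Expr, (e₁ / e₂).cost = e₁.cost + e₂.cost + 1) ∧
    (∀ e₁ e₂ : Expr, (e₁.lt e₂).cost = e₁.cost + e₂.cost + 1) ∧
    (∀ e₁ e₂ : Expr, (e₁.eq e₂).cost = e₁.cost + e₂.cost + 1) :=
  ⟨fun _ _ _ => rfl, fun _ _ _ => rfl, fun _ _ _ _ => rfl, fun _ _ _ _ => rfl,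
    fun _ _ _ _ => rfl, fun _ _ _ _ => rfl, fun _ _ _ _ => rfl, State.reg_setReg,
    State.arr_setReg, State.reg_setArr, State.arr_setArr, fun _ => rfl, fun _ => rfl,
    fun _ _ => rfl, fun _ _ => rfl, fun _ _ => rfl, fun _ _ => rfl, fun _ _ => rfl,
    fun _ _ => rfl, fun _ _ => rfl⟩

/-- The value of a comparison as a guard. -/
theorem guardRules {B : ℕ} (h : 1 < B) :
    (∀ (σ : State) (e₁ e₂ : Expr),
      (e₁.lt e₂).eval B σ = 0 ↔ e₂.eval B σ ≤ e₁.eval B σ) ∧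
    (∀ (σ : State) (e₁ e₂ : Expr), (e₁.eq e₂).eval B σ = 0 ↔ e₁.eval B σ ≠ e₂.eval B σ) := by
  constructor
  · intro σ e₁ e₂
    rw [Expr.eval_lt h]
    split_ifs <;> simp <;> omega
  · intro σ e₁ e₂
    rw [Expr.eval_eq h]
    split_ifs <;> simp [*]

end WordRAM

namespace DepartingPath

/-! ### Departing walks and one refinement of the time grid -/

/-- A weighted edge list on the vertices `0, …, n - 1`, with a path given by the positions of its
vertices (counted from `1`, and `0` off the path) and by a value for each of its vertices. -/
structure Net where
  n : ℕ
  m : ℕ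
  tail : ℕ → ℕ
  head : ℕ → ℕ
  wt : ℕ → ℕ
  pos : ℕ → ℕ
  dist : ℕ → ℕ

/-- There is a walk of value `v` to `t` that leaves the path at one of its first `f` vertices and
stays off the path until it ends. -/
inductive Net.Dep (N : Net) (f : ℕ) : ℕ → ℕ → Prop
  | leave (e : ℕ) : e < N.m → N.pos (N.tail e) ≠ 0 → N.pos (N.tail e) ≤ f →
      N.Dep f (N.head e) (N.dist (N.tail e) + N.wt e)
  | extend (e v : ℕ) : e < N.m → N.pos (N.tail e) = 0 → N.Dep f (N.tail e) v →
      N.Dep f (N.head e) (v + N.wt e)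

theorem Net.Dep.mono {N : Net} {f f' t v : ℕ} (h : N.Dep f t v) (hf : f ≤ f') : N.Dep f' t v := by
  induction h with
  | leave e he hp hpf => exact .leave e he hp (hpf.trans hf)
  | extend e v he hp _ ih => exact .extend e v he hp ih

theorem Net.Dep.pos {N : Net} {f t v : ℕ} (h : N.Dep f t v) : 0 < f := by
  induction h with
  | leave e he hp hpf => omega
  | extend e v he hp _ ih => exact ih

/-- `ℓ'` is the least index whose entry for the tail of `e` is at most entry `ℓ` for its head. -/
def Net.IsPtr (N : Net) (R : ℕ) (J : ℕ → ℕ) (e ℓ ℓ' : ℕ) : Prop :=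
  ℓ' < R ∧ J (N.tail e * R + ℓ') ≤ J (N.head e * R + ℓ) ∧
    ∀ k < ℓ', J (N.head e * R + ℓ) < J (N.tail e * R + k)

/-- The initial labels of a refinement step. -/
inductive Net.Init (N : Net) (R h : ℕ) (J : ℕ → ℕ) : ℕ → ℕ → Prop
  | source (e ℓ : ℕ) : e < N.m → ℓ < R → N.pos (N.tail e) ≠ 0 →
      N.pos (N.tail e) + h ≤ J (N.head e * R + ℓ) →
      N.Init R h J (N.head e * R + ℓ) (N.dist (N.tail e) + N.wt e)
  | done (e ℓ ℓ' : ℕ) : e < N.m → ℓ < R → N.pos (N.tail e) = 0 → N.IsPtr R J e ℓ ℓ' →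
      J (N.tail e * R + ℓ') ≠ J (N.head e * R + ℓ) →
      N.Init R h J (N.head e * R + ℓ) (ℓ' * N.n + N.wt e)

/-- The arcs between undecided entries in a refinement step. -/
inductive Net.Arc (N : Net) (R : ℕ) (J : ℕ → ℕ) : ℕ → ℕ → ℕ → Prop
  | mk (e ℓ ℓ' : ℕ) : e < N.m → ℓ < R → N.pos (N.tail e) = 0 → N.IsPtr R J e ℓ ℓ' →
      J (N.tail e * R + ℓ') = J (N.head e * R + ℓ) →
      N.Arc R J (N.tail e * R + ℓ') (N.head e * R + ℓ) (N.wt e)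

/-- `st` holds the distances, increased by one, from the initial labels along the arcs, as far as
they are below `n * R`; the value `0` stands for no distance. -/
structure Net.Settled (N : Net) (R h : ℕ) (J st : ℕ → ℕ) : Prop where
  init : ∀ y d, N.Init R h J y d → d < N.n * R → st y ≠ 0 ∧ st y ≤ d + 1
  arc : ∀ x y w, N.Arc R J x y w → st x ≠ 0 → st x + w ≤ N.n * R →
    st y ≠ 0 ∧ st y ≤ st x + w
  sound : ∀ G : ℕ → ℕ → Prop, (∀ y d, N.Init R h J y d → G y d) →
    (∀ x y w d, N.Arc R J x y w → G x d → G y (d + w)) →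
    ∀ y < N.n * R, st y ≠ 0 → G y (st y - 1)

/-- Entry `ℓ` for `t` is the first multiple `f` of `H` for which a walk of value at most `ℓ * n` is
available, up to an additive error `E` in the value; `T` stands for no such `f`. -/
structure Net.Table (N : Net) (R T H E : ℕ) (J : ℕ → ℕ) : Prop where
  mono : ∀ t < N.n, ∀ ℓ ℓ', ℓ ≤ ℓ' → ℓ' < R → J (t * R + ℓ') ≤ J (t * R + ℓ)
  dvd : ∀ t < N.n, ∀ ℓ < R, H ∣ J (t * R + ℓ)
  le : ∀ t < N.n, ∀ ℓ < R, J (t * R + ℓ) ≤ T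
  sound : ∀ t < N.n, ∀ ℓ < R, J (t * R + ℓ) ≠ T → ∃ v ≤ ℓ * N.n, N.Dep (J (t * R + ℓ)) t v
  compl : ∀ t < N.n, ∀ ℓ < R, ∀ f, H ∣ f → ∀ v, N.Dep f t v → v + E ≤ ℓ * N.n →
    J (t * R + ℓ) ≤ f

/-- At grid width `T` the only positive time up to `T` is `T` itself, the sentinel. Completeness
holds because a walk needs a positive time, and a positive multiple of `T` is at least `T`. -/
theorem Net.table_init (N : Net) (R T : ℕ) (J : ℕ → ℕ) (hJ : ∀ x < N.n * R, J x = T) :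
    N.Table R T T 0 J := by
  have hJ' : ∀ t < N.n, ∀ ℓ < R, J (t * R + ℓ) = T := fun t ht ℓ hℓ => hJ _ (by
    calc t * R + ℓ < t * R + R := by omega
      _ = (t + 1) * R := by ring
      _ ≤ _ := Nat.mul_le_mul_right _ ht)
  refine ⟨fun t ht ℓ ℓ' h h' => ?_, fun t ht ℓ hℓ => ?_, fun t ht ℓ hℓ => ?_,
    fun t ht ℓ hℓ h => ?_, fun t ht ℓ hℓ f hf v hv _ => ?_⟩
  · rw [hJ' t ht ℓ' h', hJ' t ht ℓ (by omega)]
  · rw [hJ' t ht ℓ hℓ]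
  · rw [hJ' t ht ℓ hℓ]
  · exact absurd (hJ' t ht ℓ hℓ) h
  · rw [hJ' t ht ℓ hℓ]
    exact Nat.le_of_dvd hv.pos hf

theorem flat_lt {n R t ℓ : ℕ} (ht : t < n) (hℓ : ℓ < R) : t * R + ℓ < n * R :=
  calc t * R + ℓ < t * R + R := by omega
    _ = (t + 1) * R := by ring
    _ ≤ _ := Nat.mul_le_mul_right _ ht

theorem flat_inj {R t ℓ t' ℓ' : ℕ} (hℓ : ℓ < R) (hℓ' : ℓ' < R) (h : t * R + ℓ = t' * R + ℓ') :
    t = t' ∧ ℓ = ℓ' := by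
  have h1 : (t * R + ℓ) / R = t := by
    rw [mul_comm, Nat.mul_add_div (by omega), Nat.div_eq_of_lt hℓ, add_zero]
  have h2 : (t' * R + ℓ') / R = t' := by
    rw [mul_comm, Nat.mul_add_div (by omega), Nat.div_eq_of_lt hℓ', add_zero]
  have : t = t' := by rw [← h1, ← h2, h]
  subst this
  exact ⟨rfl, by omega⟩

theorem add_le_of_dvd_of_lt {H a b : ℕ} (ha : H ∣ a) (hb : H ∣ b) (h : a < b) : a + H ≤ b := by
  have := Nat.le_of_dvd (by omega) (Nat.dvd_sub hb ha)
  omega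

/-! ### Correctness of one halving of the time grid -/

section step
variable {N : Net} {R T h E : ℕ} {J st : ℕ → ℕ}

/-- Every label comes from a walk that departs by time `J - h`: a source label by its definition,
and a decided tail because its time is strictly smaller and divisible by `2 * h`, hence at most `J -
2 * h`. Arcs join entries of equal time, so the bound travels along them unchanged. -/
theorem Net.Settled.sound_dep (hN : ∀ e < N.m, N.tail e < N.n ∧ N.head e < N.n)
    (hJ : N.Table R T (2 * h) E J) (hst : N.Settled R h J st) {t ℓ : ℕ} (ht : t < N.n)
    (hℓ : ℓ < R) (h0 : st (t * R + ℓ) ≠ 0) :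
    ∃ v ≤ st (t * R + ℓ) - 1, N.Dep (J (t * R + ℓ) - h) t v := by
  refine hst.sound (fun y d => ∀ t ℓ, ℓ < R → y = t * R + ℓ →
    ∃ v ≤ d, N.Dep (J y - h) t v) ?_ ?_ _ (flat_lt ht hℓ) h0 t ℓ hℓ rfl
  · intro y d hi t ℓ hℓ hy
    cases hi with
    | source e ℓ₁ he hℓ₁ hp hle =>
      obtain ⟨rfl, rfl⟩ := flat_inj hℓ₁ hℓ hy
      exact ⟨_, le_rfl, .leave e he hp (by omega)⟩
    | done e ℓ₁ ℓ' he hℓ₁ hp hptr hne =>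
      obtain ⟨rfl, rfl⟩ := flat_inj hℓ₁ hℓ hy
      obtain ⟨hu, ht⟩ := hN e he
      have hle := hJ.le _ ht ℓ₁ hℓ₁
      obtain ⟨v, hv, hd⟩ := hJ.sound _ hu ℓ' hptr.1 (by have := hptr.2.1; omega)
      have := add_le_of_dvd_of_lt (hJ.dvd _ hu ℓ' hptr.1) (hJ.dvd _ ht ℓ₁ hℓ₁)
        (lt_of_le_of_ne hptr.2.1 hne)
      exact ⟨v + N.wt e, by omega, .extend e v he hp (hd.mono (by omega))⟩
  · intro x y w d ha hG t ℓ hℓ hy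
    cases ha with
    | mk e ℓ₁ ℓ' he hℓ₁ hp hptr heq =>
      obtain ⟨rfl, rfl⟩ := flat_inj hℓ₁ hℓ hy
      obtain ⟨v, hv, hd⟩ := hG _ ℓ' hptr.1 rfl
      rw [heq] at hd
      exact ⟨v + N.wt e, by omega, .extend e v he hp hd⟩

/-- Induction along the walk. If the pointer of the last edge leads to a decided entry, completeness
of the old table applies to the tail, and rounding `v + E` up to a multiple of `N.n` costs less than
`N.n`. Otherwise the label of the tail is passed on along an arc with no new rounding. A decided
entry restarts the estimate from the error `E`, so the extra `N.n` never accumulates within one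
step. -/
theorem Net.Settled.compl_dep (hN : ∀ e < N.m, N.tail e < N.n ∧ N.head e < N.n)
    (hJ : N.Table R T (2 * h) E J) (hst : N.Settled R h J st) {f t v : ℕ}
    (hf : 2 * h ∣ f + h) (hd : N.Dep f t v) :
    ∀ ℓ < R, J (t * R + ℓ) = f + h → v + E + N.n < N.n * R →
      st (t * R + ℓ) ≠ 0 ∧ st (t * R + ℓ) ≤ v + E + N.n + 1 := by
  induction hd with
  | leave e he hp hpf =>
    intro ℓ hℓ hJℓ hv
    have := hst.init _ _ (.source e ℓ he hℓ hp (by omega)) (by omega)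
    omega
  | extend e v he hp hd ih =>
    intro ℓ hℓ hJℓ hv
    obtain ⟨hu, ht⟩ := hN e he
    have hn : 0 < N.n := by omega
    -- the entry for the tail that is known to be small
    obtain ⟨ℓ₀, hℓ₀⟩ : ∃ k, k = (v + E + N.n - 1) / N.n := ⟨_, rfl⟩
    have h1 : v + E ≤ ℓ₀ * N.n := by
      have := Nat.lt_div_mul_add (a := v + E + N.n - 1) hn
      rw [← hℓ₀] at this
      omega
    have h2 : ℓ₀ * N.n < v + E + N.n := by
      have := Nat.div_mul_le_self (v + E + N.n - 1) N.n
      rw [← hℓ₀] at this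
      omega
    have h3 : ℓ₀ < R := by
      by_contra hc
      have := Nat.mul_le_mul_left N.n (not_lt.1 hc)
      rw [mul_comm N.n ℓ₀] at this
      omega
    have h4 : J (N.tail e * R + ℓ₀) ≤ J (N.head e * R + ℓ) := by
      rw [hJℓ]
      exact hJ.compl _ hu ℓ₀ h3 (f + h) hf v (hd.mono (by omega)) h1
    classical
    have hex : ∃ k, J (N.tail e * R + k) ≤ J (N.head e * R + ℓ) := ⟨ℓ₀, h4⟩
    have hle := Nat.find_min' hex h4
    have hptr : N.IsPtr R J e ℓ (Nat.find hex) :=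
      ⟨by omega, Nat.find_spec hex, fun k hk => not_le.1 (Nat.find_min hex hk)⟩
    have hmul := Nat.mul_le_mul_right N.n hle
    by_cases heq : J (N.tail e * R + Nat.find hex) = J (N.head e * R + ℓ)
    · obtain ⟨h5, h6⟩ := ih _ hptr.1 (heq.trans hJℓ) (by omega)
      have := hst.arc _ _ _ (.mk e ℓ _ he hℓ hp hptr heq) h5 (by omega)
      omega
    · have := hst.init _ _ (.done e ℓ _ he hℓ hp hptr heq) (by omega)
      omega

/-- Initial labels and arcs into an entry depend on `ℓ` only through the time stored there, so a
derivation of a label for one entry can be repeated for any entry of the same row with the same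
time. This keeps the rows monotone after the refinement. -/
theorem Net.Settled.congr (hst : N.Settled R h J st) {t ℓ ℓ₂ : ℕ} (ht : t < N.n)
    (hℓ : ℓ < R) (hℓ₂ : ℓ₂ < R) (hJ : J (t * R + ℓ₂) = J (t * R + ℓ))
    (h0 : st (t * R + ℓ) ≠ 0) (hle : st (t * R + ℓ) ≤ N.n * R) :
    st (t * R + ℓ₂) ≠ 0 ∧ st (t * R + ℓ₂) ≤ st (t * R + ℓ) := by
  have := hst.sound (fun y d => ∀ t ℓ ℓ₂, ℓ < R → ℓ₂ < R → y = t * R + ℓ →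
    J (t * R + ℓ₂) = J (t * R + ℓ) → d < N.n * R →
    st (t * R + ℓ₂) ≠ 0 ∧ st (t * R + ℓ₂) ≤ d + 1) ?_ ?_ _ (flat_lt ht hℓ) h0 t ℓ ℓ₂ hℓ hℓ₂
    rfl hJ (by omega)
  · omega
  · intro y d hi t ℓ ℓ₂ hℓ hℓ₂ hy hJ hd
    cases hi with
    | source e ℓ₁ he hℓ₁ hp hle =>
      obtain ⟨rfl, rfl⟩ := flat_inj hℓ₁ hℓ hy
      exact hst.init _ _ (.source e ℓ₂ he hℓ₂ hp (by omega)) hd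
    | done e ℓ₁ ℓ' he hℓ₁ hp hptr hne =>
      obtain ⟨rfl, rfl⟩ := flat_inj hℓ₁ hℓ hy
      refine hst.init _ _ (.done e ℓ₂ ℓ' he hℓ₂ hp ?_ (by rwa [hJ])) hd
      simpa only [Net.IsPtr, hJ] using hptr
  · intro x y w d ha hG t ℓ ℓ₂ hℓ hℓ₂ hy hJ hd
    cases ha with
    | mk e ℓ₁ ℓ' he hℓ₁ hp hptr heq =>
      obtain ⟨rfl, rfl⟩ := flat_inj hℓ₁ hℓ hy
      obtain ⟨h1, h2⟩ := hG _ ℓ' ℓ' hptr.1 hptr.1 rfl rfl (by omega)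
      have := hst.arc _ _ _ (.mk e ℓ₂ ℓ' he hℓ₂ hp
        (by simpa only [Net.IsPtr, hJ] using hptr) (by rwa [hJ])) h1 (by omega)
      omega

/-- A refinement step halves the grid width and adds `n` to the error. -/
theorem Net.Table.step (hN : ∀ e < N.m, N.tail e < N.n ∧ N.head e < N.n)
    (hT0 : 0 < T) (hJ : N.Table R T (2 * h) E J) (hst : N.Settled R h J st)
    {J' : ℕ → ℕ} (hJ' : ∀ t < N.n, ∀ ℓ < R, J' (t * R + ℓ) =
      if st (t * R + ℓ) ≠ 0 ∧ st (t * R + ℓ) ≤ ℓ * N.n + 1 then J (t * R + ℓ) - h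
      else J (t * R + ℓ)) :
    N.Table R T h (E + N.n) J' := by
  have hh : h ∣ 2 * h := ⟨2, by ring⟩
  have hpos : ∀ t < N.n, ∀ ℓ < R, 0 < J (t * R + ℓ) := by
    intro t ht ℓ hℓ
    by_cases hc : J (t * R + ℓ) = T
    · omega
    · obtain ⟨v, _, hd⟩ := hJ.sound t ht ℓ hℓ hc
      exact hd.pos
  -- Times are at least `2 * h`, so the truncated subtraction `J - h` is exact.
  have hlow : ∀ t < N.n, ∀ ℓ < R, 2 * h ≤ J (t * R + ℓ) := fun t ht ℓ hℓ =>
    Nat.le_of_dvd (hpos t ht ℓ hℓ) (hJ.dvd t ht ℓ hℓ)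
  have hlR : ∀ ℓ < R, 0 < N.n → ℓ * N.n + 1 ≤ N.n * R := fun ℓ hℓ hn => by
    have : (ℓ + 1) * N.n ≤ R * N.n := Nat.mul_le_mul_right _ hℓ
    rw [mul_comm N.n R]
    rw [add_mul, one_mul] at this
    omega
  refine ⟨fun t ht ℓ ℓ' hle hℓ' => ?_, fun t ht ℓ hℓ => ?_, fun t ht ℓ hℓ => ?_,
    fun t ht ℓ hℓ hne => ?_, fun t ht ℓ hℓ f hf v hd hv => ?_⟩
  · have hℓ : ℓ < R := by omega
    have hm := hJ.mono t ht ℓ ℓ' hle hℓ'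
    rw [hJ' t ht ℓ hℓ, hJ' t ht ℓ' hℓ']
    -- Equal times are lowered consistently by `Net.Settled.congr`; distinct times differ by at
    -- least `2 * h`, so lowering one of them by `h` cannot reverse their order.
    by_cases heq : J (t * R + ℓ') = J (t * R + ℓ)
    · by_cases hc : st (t * R + ℓ) ≠ 0 ∧ st (t * R + ℓ) ≤ ℓ * N.n + 1
      · obtain ⟨h1, h2⟩ := hst.congr ht hℓ hℓ' heq hc.1 (hc.2.trans (hlR ℓ hℓ (by omega)))
        have := Nat.mul_le_mul_right N.n hle
        rw [if_pos hc, if_pos ⟨h1, by omega⟩, heq]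
      · rw [if_neg hc]
        split_ifs <;> omega
    · have := add_le_of_dvd_of_lt (hJ.dvd t ht ℓ' hℓ') (hJ.dvd t ht ℓ hℓ)
        (lt_of_le_of_ne hm heq)
      split_ifs <;> omega
  · rw [hJ' t ht ℓ hℓ]
    have := hh.trans (hJ.dvd t ht ℓ hℓ)
    split_ifs
    · exact Nat.dvd_sub this dvd_rfl
    · exact this
  · rw [hJ' t ht ℓ hℓ]
    have := hJ.le t ht ℓ hℓ
    split_ifs <;> omega
  · rw [hJ' t ht ℓ hℓ] at hne ⊢
    split_ifs at hne ⊢ with hc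
    · obtain ⟨v, hv, hd⟩ := hst.sound_dep hN hJ ht hℓ hc.1
      exact ⟨v, by omega, hd⟩
    · exact hJ.sound t ht ℓ hℓ hne
  · rw [hJ' t ht ℓ hℓ]
    -- Multiples of `2 * h` are covered by the old table. For an odd multiple of `h` the next old
    -- grid point is `f + h`: the entry is either at most `f - h` already, or equal to `f + h`, and
    -- then the test with the new label succeeds.
    by_cases hf2 : 2 * h ∣ f
    · have := hJ.compl t ht ℓ hℓ f hf2 v hd (by omega)
      split_ifs <;> omega
    · have hfh : 2 * h ∣ f + h := by
        obtain ⟨k, rfl⟩ := hf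
        rcases Nat.even_or_odd' k with ⟨j, rfl | rfl⟩
        · exact absurd ⟨j, by ring⟩ hf2
        · exact ⟨j + 1, by ring⟩
      have h1 := hJ.compl t ht ℓ hℓ (f + h) hfh v (hd.mono (by omega)) (by omega)
      by_cases heq : J (t * R + ℓ) = f + h
      · have := hlR ℓ hℓ (by omega)
        obtain ⟨h2, h3⟩ := hst.compl_dep hN hJ hfh hd ℓ hℓ heq (by omega)
        rw [if_pos ⟨h2, by omega⟩, heq]
        omega
      · have := add_le_of_dvd_of_lt (hJ.dvd t ht ℓ hℓ) hfh (lt_of_le_of_ne h1 heq)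
        split_ifs <;> omega

end step

/-! ### Departing paths as departing walks -/

section paths
variable {V : Type*} {G : Digraph V} {wt : V → V → ℕ}

theorem pathWeight_append (wt : V → V → ℕ) (l r : List V) (a : V) :
    pathWeight wt (l ++ a :: r) = pathWeight wt (l ++ [a]) + pathWeight wt (a :: r) := by
  induction l with
  | nil => simp [pathWeight]
  | cons b l ih =>
    cases l with
    | nil => simp [pathWeight]
    | cons c l =>
      simp only [List.cons_append, pathWeight] at ih ⊢
      omega

theorem pathWeight_snoc (wt : V → V → ℕ) (l : List V) (a b : V) :
    pathWeight wt (l ++ [a] ++ [b]) = pathWeight wt (l ++ [a]) + wt a b := by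
  rw [List.append_assoc, List.singleton_append, pathWeight_append]
  simp [pathWeight]

theorem exists_snoc_of_getLast? {l : List V} {a : V} (h : l.getLast? = some a) :
    ∃ l', l = l' ++ [a] := by
  rw [List.getLast?_eq_some_iff] at h
  exact h

theorem IsPath.snoc {R : List V} {s u t : V} (h : IsPath G R s u) (hadj : G.Adj u t)
    (ht : t ∉ R) : IsPath G (R ++ [t]) s t := by
  obtain ⟨h1, h2, h3, h4⟩ := h
  refine ⟨?_, by simp, ?_, ?_⟩
  · cases R <;> simp_all
  · rw [List.isChain_append]
    refine ⟨h3, by simp, ?_⟩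
    intro x hx y hy
    simp only [h2, Option.mem_def, Option.some.injEq, List.head?_cons] at hx hy
    subst hx hy
    exact hadj
  · rw [List.nodup_append]
    refine ⟨h4, by simp, ?_⟩
    intro a ha b hb
    simp only [List.mem_singleton] at hb
    subst hb
    exact fun h => ht (h ▸ ha)

theorem IsPath.left {R₁ R₂ : List V} {s u t : V} (h : IsPath G (R₁ ++ t :: R₂) s u) :
    IsPath G (R₁ ++ [t]) s t := by
  obtain ⟨h1, h2, h3, h4⟩ := h
  refine ⟨?_, by simp, ?_, ?_⟩
  · cases R₁ <;> simp_all
  · have : R₁ ++ t :: R₂ = (R₁ ++ [t]) ++ R₂ := by simp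
    rw [this] at h3
    exact h3.left_of_append
  · have : R₁ ++ t :: R₂ = (R₁ ++ [t]) ++ R₂ := by simp
    rw [this] at h4
    exact h4.of_append_left

theorem pathWeight_left (wt : V → V → ℕ) (R₁ R₂ : List V) (t : V) :
    pathWeight wt (R₁ ++ [t]) ≤ pathWeight wt (R₁ ++ t :: R₂) := by
  rw [pathWeight_append wt R₁ R₂]
  omega

/-- A path can be prolonged by an edge, up to cutting off a cycle. -/
theorem IsPath.extend {R : List V} {s u t : V} (h : IsPath G R s u) (hadj : G.Adj u t) :
    ∃ R', IsPath G R' s t ∧ pathWeight wt R' ≤ pathWeight wt R + wt u t := by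
  by_cases ht : t ∈ R
  · obtain ⟨R₁, R₂, rfl⟩ := List.append_of_mem ht
    exact ⟨_, h.left, (pathWeight_left wt R₁ R₂ t).trans (by omega)⟩
  · refine ⟨_, h.snoc hadj ht, ?_⟩
    obtain ⟨R', rfl⟩ := exists_snoc_of_getLast? h.2.1
    rw [pathWeight_snoc]

theorem take_succ_append_drop {P : List V} {j : ℕ} (hj : j < P.length) :
    P = P.take j ++ P[j] :: P.drop (j + 1) := by
  rw [List.getElem_cons_drop, List.take_append_drop]

theorem pathWeight_take_succ (wt : V → V → ℕ) {P : List V} {j : ℕ} (hj : j + 1 < P.length) :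
    pathWeight wt (P.take (j + 1 + 1)) = pathWeight wt (P.take (j + 1)) + wt P[j] P[j + 1] := by
  rw [← List.take_append_getElem hj, ← List.take_append_getElem (i := j) (by omega),
    pathWeight_snoc]

theorem IsPath.take {P : List V} {s z : V} (h : IsPath G P s z) {j : ℕ} (hj : j < P.length) :
    IsPath G (P.take (j + 1)) s P[j] := by
  rw [← List.take_append_getElem hj]
  rw [take_succ_append_drop hj] at h
  exact h.left

theorem IsPath.adj_getElem {P : List V} {s z : V} (h : IsPath G P s z) {j : ℕ}
    (hj : j + 1 < P.length) : G.Adj P[j] P[j + 1] :=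
  List.isChain_iff_getElem.1 h.2.2.1 j hj

/-- A shorter path to `P[j]` could be prolonged edge by edge along `P` up to `z`, cutting cycles
where they arise, and would contradict the minimality of `P`. -/
theorem IsShortestPath.take_le {P A : List V} {s z : V} (h : IsShortestPath G wt P s z) {j : ℕ}
    (hj : j < P.length) (hA : IsPath G A s P[j]) :
    pathWeight wt (P.take (j + 1)) ≤ pathWeight wt A := by
  have key : ∀ k, j ≤ k → (hk : k < P.length) → ∃ A', IsPath G A' s P[k] ∧
      pathWeight wt A' + pathWeight wt (P.take (j + 1)) ≤
        pathWeight wt A + pathWeight wt (P.take (k + 1)) := by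
    intro k hjk
    induction k, hjk using Nat.le_induction with
    | base => exact fun _ => ⟨A, hA, le_rfl⟩
    | succ k hjk ih =>
      intro hk
      obtain ⟨A', hA', hle⟩ := ih (by omega)
      obtain ⟨A'', hA'', hle'⟩ := hA'.extend (wt := wt) (h.1.adj_getElem hk)
      exact ⟨A'', hA'', by rw [pathWeight_take_succ wt hk]; omega⟩
  -- At the last index the prefix of `P` is `P` itself and the end is `z`.
  obtain ⟨A', hA', hle⟩ := key (P.length - 1) (by omega) (by omega)
  have hz : P[P.length - 1] = z := by
    have := h.1.2.1
    rw [List.getLast?_eq_getElem?, List.getElem?_eq_getElem (by omega)] at this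
    exact Option.some.inj this
  rw [hz] at hA'
  have := h.2 A' hA'
  rw [Nat.sub_add_cancel (by omega), List.take_length] at hle
  omega

variable {P : List V} {s z : V} {f : ℕ} {hf : f < P.length}

theorem isDeparting_leave (hP : IsPath G P s z) {j : ℕ} (hj : j < f) {t : V}
    (hadj : G.Adj P[j] t) (ht : t ∉ P.take (f + 1)) :
    IsDeparting G P f hf s t (P.take (j + 1) ++ [t]) := by
  have hnd := hP.2.2.2
  have hsub : P.take (j + 1) ⊆ P.take f := (List.take_prefix_take_left (by omega)).subset
  have hsub' : P.take f ⊆ P.take (f + 1) := (List.take_prefix_take_left (by omega)).subset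
  have hsplit := hnd
  rw [take_succ_append_drop hf, List.nodup_append, List.nodup_cons] at hsplit
  obtain ⟨_, ⟨hf1, _⟩, hf2⟩ := hsplit
  have hfm : P[f] ∈ P.take (f + 1) := by
    rw [List.mem_take_iff_getElem]
    exact ⟨f, by omega, rfl⟩
  refine ⟨(hP.take (by omega)).snoc hadj fun h => ht (hsub' (hsub h)), ?_,
    ⟨P.take (j + 1), List.prefix_append _ _, fun v => ?_⟩, ?_⟩
  · simp only [List.mem_append, List.mem_singleton, not_or]
    exact ⟨fun h => hf2 _ (hsub h) _ List.mem_cons_self rfl, fun h => ht (h ▸ hfm)⟩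
  · simp only [List.mem_append, List.mem_singleton]
    constructor
    · exact fun h => ⟨.inl h, hsub h⟩
    · rintro ⟨h | rfl, h'⟩
      · exact h
      · exact absurd (hsub' h') ht
  · intro v hv hvt hd
    simp only [List.mem_append, List.mem_singleton] at hv
    exact hf2 _ (hsub (hv.resolve_right hvt)) _ (List.mem_cons_of_mem _ hd) rfl

/-- If `t` already lies on `R`, then `R` is cut at `t`. The cut keeps the whole prefix `A`, because
`t` is outside the first `f + 1` vertices of `P` and hence not in `A`. Since `u` is off `P`, no
vertex of `R` lies on the later part of `P`, so `u` may become an interior vertex. -/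
theorem IsDeparting.extend {R : List V} {u t : V} (h : IsDeparting G P f hf s u R) (hu : u ∉ P)
    (hadj : G.Adj u t) (ht : t ∉ P.take (f + 1)) :
    ∃ R', IsDeparting G P f hf s t R' ∧ pathWeight wt R' ≤ pathWeight wt R + wt u t := by
  obtain ⟨hR, hx, ⟨A, hA, hAm⟩, hd⟩ := h
  have hsub' : P.take f ⊆ P.take (f + 1) := (List.take_prefix_take_left (by omega)).subset
  have hfm : P[f] ∈ P.take (f + 1) := by
    rw [List.mem_take_iff_getElem]
    exact ⟨f, by omega, rfl⟩
  have hd' : ∀ v ∈ R, v ∉ P.drop (f + 1) := by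
    intro v hv h
    by_cases hvu : v = u
    · exact hu (hvu ▸ List.mem_of_mem_drop h)
    · exact hd v hv hvu h
  by_cases htR : t ∈ R
  · obtain ⟨R₁, R₂, rfl⟩ := List.append_of_mem htR
    have htA : t ∉ A := fun h => ht (hsub' ((hAm t).1 h).2)
    have hnd := hR.2.2.2
    have hsub : ∀ v ∈ R₁ ++ [t], v ∈ R₁ ++ t :: R₂ := by
      intro v hv
      simp only [List.mem_append, List.mem_cons] at hv ⊢
      tauto
    refine ⟨R₁ ++ [t], ⟨hR.left, fun h => hx (hsub _ h), ⟨A, ?_, fun v => ?_⟩,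
      fun v hv _ => hd' v (hsub v hv)⟩, (pathWeight_left wt R₁ R₂ t).trans (by omega)⟩
    · have h1 : R₁ ++ [t] <+: R₁ ++ t :: R₂ := ⟨R₂, by simp⟩
      rcases List.prefix_or_prefix_of_prefix hA h1 with h | h
      · exact h
      · exact absurd (h.subset (by simp)) htA
    · rw [hAm]
      refine ⟨fun h => ⟨?_, h.2⟩, fun h => ⟨hsub _ h.1, h.2⟩⟩
      have hvA := (hAm v).2 h
      have h1 : R₁ ++ [t] <+: R₁ ++ t :: R₂ := ⟨R₂, by simp⟩
      rcases List.prefix_or_prefix_of_prefix hA h1 with h | h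
      · exact h.subset hvA
      · exact absurd (h.subset (by simp)) htA
  · refine ⟨R ++ [t], ⟨hR.snoc hadj htR, ?_, ⟨A, hA.trans (List.prefix_append _ _), fun v => ?_⟩,
      ?_⟩, ?_⟩
    · simp only [List.mem_append, List.mem_singleton, not_or]
      exact ⟨hx, fun h => ht (h ▸ hfm)⟩
    · rw [hAm]
      simp only [List.mem_append, List.mem_singleton]
      constructor
      · exact fun h => ⟨.inl h.1, h.2⟩
      · rintro ⟨h | rfl, h'⟩
        · exact ⟨h, h'⟩
        · exact absurd (hsub' h') ht
    · intro v hv hvt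
      simp only [List.mem_append, List.mem_singleton] at hv
      exact hd' v (hv.resolve_right hvt)
    · obtain ⟨R', rfl⟩ := exists_snoc_of_getLast? hR.2.1
      rw [pathWeight_snoc]

/-- A departing path is an initial piece of the path followed by vertices off the path. -/
theorem IsDeparting.split {R : List V} {t : V} (hP : IsPath G P s z)
    (h : IsDeparting G P f hf s t R) (ht : t ∉ P.take (f + 1)) :
    ∃ A C : List V, ∃ j, ∃ hj : j < P.length, j < f ∧ R = A ++ [P[j]] ++ C ++ [t] ∧
      ∀ v ∈ C, v ∉ P := by
  obtain ⟨hR, hx, ⟨A, ⟨B, rfl⟩, hAm⟩, hd⟩ := h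
  have hsub' : P.take f ⊆ P.take (f + 1) := (List.take_prefix_take_left (by omega)).subset
  have hs0 : P[0] = s := by
    have := hP.1
    rw [List.head?_eq_getElem?, List.getElem?_eq_getElem (by omega)] at this
    exact Option.some.inj this
  have hsR : s ∈ A ++ B := List.mem_of_mem_head? hR.1
  have hf0 : 0 < f := by
    by_contra hc
    obtain rfl : f = 0 := by omega
    exact hx (hs0 ▸ hsR)
  have hsA : s ∈ A := (hAm s).2 ⟨hsR, by
    rw [← hs0, List.mem_take_iff_getElem]
    exact ⟨0, by omega, rfl⟩⟩
  -- The prefix `A` contains `s`, so it has a last vertex; this is the point of departure. `A` uses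
  -- only vertices of `P` but need not follow the edges of `P`.
  obtain ⟨A', a, rfl⟩ : ∃ A' a, A = A' ++ [a] :=
    ⟨A.dropLast, A.getLast (List.ne_nil_of_mem hsA),
      (List.dropLast_append_getLast _).symm⟩
  have ha := ((hAm a).1 (by simp)).2
  rw [List.mem_take_iff_getElem] at ha
  obtain ⟨j, hj, rfl⟩ := ha
  have htA : t ∉ A' ++ [P[j]] := fun h => ht (hsub' ((hAm t).1 h).2)
  have hB : B ≠ [] := by
    rintro rfl
    obtain ⟨l, hl⟩ := exists_snoc_of_getLast? hR.2.1
    rw [List.append_nil] at hl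
    exact htA (hl ▸ by simp)
  obtain ⟨C, b, rfl⟩ : ∃ C b, B = C ++ [b] :=
    ⟨B.dropLast, B.getLast hB, (List.dropLast_append_getLast _).symm⟩
  obtain rfl : b = t := by
    have := hR.2.1
    rw [← List.append_assoc, List.getLast?_concat] at this
    exact Option.some.inj this
  refine ⟨A', C, j, by omega, by omega, by simp, fun v hv hvP => ?_⟩
  have hnd := hR.2.2.2
  have hvb : v ≠ b := by
    rintro rfl
    rw [← List.append_assoc, List.nodup_append] at hnd
    exact hnd.2.2 v (by simp [hv]) v (by simp) rfl
  have hvR : v ∈ A' ++ [P[j]] ++ (C ++ [b]) := by simp [hv]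
  rw [take_succ_append_drop hf, List.mem_append, List.mem_cons] at hvP
  rcases hvP with h | rfl | h
  · have := (hAm v).2 ⟨hvR, h⟩
    rw [List.nodup_append] at hnd
    exact hnd.2.2 v this v (by simp [hv]) rfl
  · exact hx hvR
  · exact hd v hvR hvb h

theorem ddist_le {R : List V} {t : V} (h : IsDeparting G P f hf s t R) :
    ddist G wt P f hf s t ≤ pathWeight wt R := iInf₂_le R h

/-- Lengths are natural numbers, so the infimum is attained as soon as one departing path exists. -/
theorem ddist_eq_top_or (t : V) : ddist G wt P f hf s t = ⊤ ∨
    ∃ R, IsDeparting G P f hf s t R ∧ ddist G wt P f hf s t = pathWeight wt R := by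
  by_cases h : ∃ R, IsDeparting G P f hf s t R
  · right
    have hne : (pathWeight wt '' {R | IsDeparting G P f hf s t R}).Nonempty :=
      Set.Nonempty.image _ h
    obtain ⟨R, hR, hRe⟩ : ∃ R, IsDeparting G P f hf s t R ∧ pathWeight wt R =
        sInf (pathWeight wt '' {R | IsDeparting G P f hf s t R}) := Nat.sInf_mem hne
    refine ⟨R, hR, le_antisymm (ddist_le hR) (le_iInf₂ fun R' hR' => ?_)⟩
    rw [hRe]
    exact_mod_cast Nat.sInf_le (Set.mem_image_of_mem (pathWeight wt) hR')
  · left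
    push Not at h
    simp [ddist, h]

theorem ddist_self (t : V) (ht : t = P[f]) : ddist G wt P f hf s t = ⊤ := by
  rcases ddist_eq_top_or (G := G) (wt := wt) (P := P) (s := s) (hf := hf) t with h | ⟨R, hR, _⟩
  · exact h
  · exact absurd (List.mem_of_getLast? hR.1.2.1) (ht ▸ hR.2.1)

theorem ddist_of_lt (hP : IsShortestPath G wt P s z) {i : ℕ} (hi : i < f) :
    ddist G wt P f hf s P[i] = pathWeight wt (P.take (i + 1)) := by
  have hnd := hP.1.2.2.2
  rw [take_succ_append_drop hf, List.nodup_append, List.nodup_cons] at hnd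
  have hsub : P.take (i + 1) ⊆ P.take f := (List.take_prefix_take_left (by omega)).subset
  refine le_antisymm (ddist_le ⟨hP.1.take (by omega), ?_, ⟨_, List.prefix_rfl, fun v => ?_⟩, ?_⟩)
    (le_iInf₂ fun R hR => ?_)
  · exact fun h => hnd.2.2 _ (hsub h) _ List.mem_cons_self rfl
  · exact ⟨fun h => ⟨h, hsub h⟩, fun h => h.1⟩
  · exact fun v hv _ hd => hnd.2.2 _ (hsub hv) _ (List.mem_cons_of_mem _ hd) rfl
  · exact_mod_cast hP.take_le (by omega) hR.1

end paths

/-! ### Scaled networks and the answers they give -/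

/-- The network of a graph on `Fin n`, given by the list of its edges, and of a path. -/
def netOf {n : ℕ} (wt : Fin n → Fin n → ℕ) (E : List (Fin n × Fin n)) (P : List (Fin n)) : Net where
  n := n
  m := E.length
  tail e := (E.map fun e => (e.1 : ℕ)).getD e 0
  head e := (E.map fun e => (e.2 : ℕ)).getD e 0
  wt e := (E.map fun e => wt e.1 e.2).getD e 0
  pos v := if v ∈ P.map Fin.val then (P.map Fin.val).idxOf v + 1 else 0
  dist v := pathWeight wt (P.take
    (if v ∈ P.map Fin.val then (P.map Fin.val).idxOf v + 1 else 0))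

/-- The network with all values multiplied by `Λ / g` and rounded up. -/
def Net.scale (N : Net) (Λ g : ℕ) : Net :=
  { N with wt := fun e => Λ * N.wt e / g + 1, dist := fun v => Λ * N.dist v / g + 1 }

theorem mul_le_scale {Λ g : ℕ} (hg : 0 < g) (a : ℕ) : Λ * a ≤ g * (Λ * a / g + 1) :=
  (Nat.lt_mul_div_succ _ hg).le

theorem scale_le {Λ g : ℕ} (a : ℕ) : g * (Λ * a / g + 1) ≤ Λ * a + g := by
  have := Nat.mul_div_le (Λ * a) g
  rw [mul_add, mul_one]
  omega

/-- Rounding goes upwards, so a scaled value never underestimates the true length. -/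
theorem Net.Dep.of_scale {N : Net} {Λ g f t v : ℕ} (hg : 0 < g) (h : (N.scale Λ g).Dep f t v) :
    ∃ v', N.Dep f t v' ∧ Λ * v' ≤ g * v := by
  induction h with
  | leave e he hp hpf =>
    refine ⟨_, .leave e he hp hpf, ?_⟩
    have h1 := mul_le_scale (Λ := Λ) hg (N.dist (N.tail e))
    have h2 := mul_le_scale (Λ := Λ) hg (N.wt e)
    simp only [Net.scale, mul_add] at *
    omega
  | extend e v he hp _ ih =>
    obtain ⟨v', hd, hle⟩ := ih
    refine ⟨_, .extend e v' he hp hd, ?_⟩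
    have h2 := mul_le_scale (Λ := Λ) hg (N.wt e)
    simp only [Net.scale, mul_add] at *
    omega

/-! ### Departing paths of the graph versus departing walks of its scaled network -/

section graph
variable {n : ℕ} {G : Digraph (Fin n)} {wt : Fin n → Fin n → ℕ} {E : List (Fin n × Fin n)}
  {P : List (Fin n)} {s z : Fin n}

theorem netOf_edge {e : ℕ} (he : e < E.length) :
    (netOf wt E P).tail e = (E[e].1 : ℕ) ∧ (netOf wt E P).head e = (E[e].2 : ℕ) ∧
      (netOf wt E P).wt e = wt E[e].1 E[e].2 := by
  simp [netOf, he]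

theorem netOf_lt {e : ℕ} (he : e < (netOf wt E P).m) :
    (netOf wt E P).tail e < n ∧ (netOf wt E P).head e < n := by
  obtain ⟨h1, h2, _⟩ := netOf_edge (wt := wt) (P := P) he
  rw [h1, h2]
  exact ⟨Fin.is_lt _, Fin.is_lt _⟩

theorem netOf_pos_eq_zero {v : Fin n} : (netOf wt E P).pos v = 0 ↔ v ∉ P := by
  simp [netOf, Fin.val_inj]

theorem netOf_pos_getElem (hP : P.Nodup) {j : ℕ} (hj : j < P.length) :
    (netOf wt E P).pos (P[j] : Fin n) = j + 1 := by
  have hnd : (P.map Fin.val).Nodup := hP.map Fin.val_injective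
  have := hnd.idxOf_getElem j (by simpa using hj)
  rw [List.getElem_map] at this
  simp only [netOf, this]
  rw [if_pos (List.mem_map_of_mem (List.getElem_mem hj))]

theorem netOf_dist_getElem (hP : P.Nodup) {j : ℕ} (hj : j < P.length) :
    (netOf wt E P).dist (P[j] : Fin n) = pathWeight wt (P.take (j + 1)) := by
  have := netOf_pos_getElem (wt := wt) (E := E) hP hj
  simp only [netOf] at this ⊢
  rw [this]

theorem netOf_pos_ne_zero {v : Fin n} (h : (netOf wt E P).pos v ≠ 0) (hP : P.Nodup) :
    ∃ j, ∃ hj : j < P.length, v = P[j] ∧ (netOf wt E P).pos v = j + 1 := by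
  have hv : v ∈ P := by
    by_contra hc
    exact h (netOf_pos_eq_zero.2 hc)
  obtain ⟨j, hj, rfl⟩ := List.getElem_of_mem hv
  exact ⟨j, hj, rfl, netOf_pos_getElem hP hj⟩

/-- Induction along the walk, cutting cycles on the way. The intermediate vertices are off `P`, so
the condition on the end vertex holds for them automatically; it has to be assumed only for `t`. -/
theorem isDeparting_of_dep (hE : ∀ u v : Fin n, (u, v) ∈ E ↔ G.Adj u v) (hP : IsPath G P s z)
    {f : ℕ} (hf : f < P.length) {t' v : ℕ} (h : (netOf wt E P).Dep f t' v) :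
    ∀ t : Fin n, t' = t → t ∉ P.take (f + 1) →
      ∃ R, IsDeparting G P f hf s t R ∧ pathWeight wt R ≤ v := by
  induction h with
  | leave e he hp hpf =>
    intro t htt ht
    obtain ⟨h1, h2, h3⟩ := netOf_edge (wt := wt) (P := P) he
    rw [h2, Fin.val_inj] at htt
    have hadj : G.Adj E[e].1 E[e].2 := (hE _ _).1 (List.getElem_mem _)
    rw [h1] at hp hpf
    obtain ⟨j, hj, hv, hpos⟩ := netOf_pos_ne_zero hp hP.2.2.2
    rw [htt, hv] at hadj
    refine ⟨_, isDeparting_leave hP (by omega) hadj ht, ?_⟩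
    rw [h1, h3, hv, netOf_dist_getElem hP.2.2.2 hj, ← List.take_append_getElem hj, pathWeight_snoc,
      htt]
  | extend e v he hp _ ih =>
    intro t htt ht
    obtain ⟨h1, h2, h3⟩ := netOf_edge (wt := wt) (P := P) he
    rw [h2, Fin.val_inj] at htt
    have hadj : G.Adj E[e].1 E[e].2 := (hE _ _).1 (List.getElem_mem _)
    rw [h1, netOf_pos_eq_zero] at hp
    obtain ⟨R, hR, hle⟩ := ih _ h1 fun h => hp (List.mem_of_mem_take h)
    rw [htt] at hadj
    obtain ⟨R', hR', hle'⟩ := hR.extend (wt := wt) hp hadj ht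
    refine ⟨R', hR', ?_⟩
    rw [h3, htt]
    omega

theorem exists_edge (hE : ∀ u v : Fin n, (u, v) ∈ E ↔ G.Adj u v) {u v : Fin n}
    (h : G.Adj u v) : ∃ e < (netOf wt E P).m, (netOf wt E P).tail e = u ∧
      (netOf wt E P).head e = v ∧ (netOf wt E P).wt e = wt u v := by
  obtain ⟨e, he, heq⟩ := List.getElem_of_mem ((hE u v).2 h)
  refine ⟨e, he, ?_⟩
  have := netOf_edge (wt := wt) (P := P) he
  rwa [heq] at this

/-- The part `A` before the departure is replaced by the prefix of `P`, which is no longer by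
`IsShortestPath.take_le`. Each rounding costs at most `g`: one for the distance of `P[j]` and one
for each of the `C.length + 1` edges after it. -/
theorem dep_of_walk (hE : ∀ u v : Fin n, (u, v) ∈ E ↔ G.Adj u v)
    (hP : IsShortestPath G wt P s z) {Λ g : ℕ} {j f : ℕ} (hj : j < P.length)
    (hjf : j < f) {A : List (Fin n)} (C : List (Fin n)) :
    ∀ t, IsPath G (A ++ [P[j]] ++ C ++ [t]) s t → (∀ v ∈ C, v ∉ P) →
      ∃ v, ((netOf wt E P).scale Λ g).Dep f t v ∧
        g * v ≤ Λ * pathWeight wt (A ++ [P[j]] ++ C ++ [t]) + g * (C.length + 2) := by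
  induction C using List.reverseRecOn with
  | nil =>
    intro t h _
    have hch := h.2.2.1
    rw [List.append_nil] at h ⊢
    have hA : IsPath G (A ++ [P[j]]) s P[j] := by
      rw [List.append_assoc] at h
      exact h.left
    have hadj : G.Adj P[j] t := by
      rw [List.append_nil, List.isChain_append] at hch
      exact hch.2.2 _ (by simp) _ (by simp)
    obtain ⟨e, he, h1, h2, h3⟩ := exists_edge (wt := wt) (P := P) hE hadj
    have hpos := netOf_pos_getElem (wt := wt) (E := E) hP.1.2.2.2 hj
    have := Net.Dep.leave (N := (netOf wt E P).scale Λ g) (f := f) e he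
      (by simp only [Net.scale, h1]; omega) (by simp only [Net.scale, h1]; omega)
    simp only [Net.scale, h1, h2, h3] at this
    refine ⟨_, this, ?_⟩
    have hle := Nat.mul_le_mul_left Λ (hP.take_le hj hA)
    have e1 := scale_le (Λ := Λ) (g := g) ((netOf wt E P).dist P[j])
    have e2 := scale_le (Λ := Λ) (g := g) (wt P[j] t)
    rw [netOf_dist_getElem hP.1.2.2.2 hj] at *
    rw [pathWeight_snoc, List.length_nil, mul_add g, mul_add Λ]
    omega
  | append_singleton C y ih =>
    intro t h hC
    have hch := h.2.2.1
    have hA : IsPath G (A ++ [P[j]] ++ C ++ [y]) s y := by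
      have e : A ++ [P[j]] ++ (C ++ [y]) ++ [t] = (A ++ [P[j]] ++ C) ++ y :: [t] := by simp
      rw [e] at h
      exact h.left
    have hadj : G.Adj y t := by
      rw [List.isChain_append] at hch
      exact hch.2.2 _ (by simp [← List.append_assoc]) _ (by simp)
    obtain ⟨v, hv, hle⟩ := ih y hA fun v hv => hC v (by simp [hv])
    obtain ⟨e, he, h1, h2, h3⟩ := exists_edge (wt := wt) (P := P) hE hadj
    have hpos := netOf_pos_eq_zero (wt := wt) (E := E).2 (hC y (by simp))
    have := Net.Dep.extend (N := (netOf wt E P).scale Λ g) (f := f) e v he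
      (by simp only [Net.scale, h1]; omega) (by simp only [Net.scale, h1]; exact hv)
    simp only [Net.scale, h2, h3] at this
    refine ⟨_, this, ?_⟩
    have e2 := scale_le (Λ := Λ) (g := g) (wt y t)
    rw [← List.append_assoc, pathWeight_snoc, mul_add g, mul_add Λ]
    simp only [List.length_append, List.length_singleton, mul_add] at *
    omega

/-- A simple path has at most `n` vertices, so there are at most `n` roundings. -/
theorem dep_of_isDeparting (hE : ∀ u v : Fin n, (u, v) ∈ E ↔ G.Adj u v)
    (hP : IsShortestPath G wt P s z) {Λ g : ℕ} {f : ℕ} {hf : f < P.length} {t : Fin n}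
    (ht : t ∉ P.take (f + 1)) {R : List (Fin n)} (hR : IsDeparting G P f hf s t R) :
    ∃ v, ((netOf wt E P).scale Λ g).Dep f t v ∧ g * v ≤ Λ * pathWeight wt R + g * n := by
  obtain ⟨A, C, j, hj, hjf, rfl, hC⟩ := hR.split hP.1 ht
  obtain ⟨v, hv, hle⟩ := dep_of_walk (Λ := Λ) (g := g) hE hP hj hjf C t hR.1 hC
  refine ⟨v, hv, hle.trans ?_⟩
  have := hR.1.2.2.2.length_le_card
  simp only [List.length_append, List.length_singleton, Fintype.card_fin] at this
  have := Nat.mul_le_mul_left g (show C.length + 2 ≤ n by omega)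
  omega

theorem pathWeight_le (W : ℕ) (hW : ∀ u v : Fin n, G.Adj u v → wt u v ≤ W) :
    ∀ R : List (Fin n), R.IsChain G.Adj → pathWeight wt R ≤ (R.length - 1) * W
  | [], _ => by simp [pathWeight]
  | [a], _ => by simp [pathWeight]
  | a :: b :: l, h => by
    rw [List.isChain_cons_cons] at h
    have := pathWeight_le W hW (b :: l) h.2
    have := hW a b h.1
    simp only [pathWeight, List.length_cons, Nat.add_sub_cancel, add_mul, one_mul] at *
    omega

theorem IsPath.pathWeight_le {W : ℕ} (hW : ∀ u v : Fin n, G.Adj u v → wt u v ≤ W)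
    {R : List (Fin n)} {s t : Fin n} (h : IsPath G R s t) : pathWeight wt R ≤ n * W := by
  refine (DepartingPath.pathWeight_le W hW R h.2.2.1).trans (Nat.mul_le_mul_right _ ?_)
  have := h.2.2.2.length_le_card
  rw [Fintype.card_fin] at this
  omega

end graph

/-! ### From the tables of all scales to admissible answers -/

section answers
variable {n : ℕ} {G : Digraph (Fin n)} {wt : Fin n → Fin n → ℕ} {E : List (Fin n × Fin n)}
  {P : List (Fin n)} {s z : Fin n} {K D L I T : ℕ} {J : ℕ → ℕ → ℕ} {f : ℕ} {hf : f < P.length}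
  {t : Fin n} {ε : ℝ}

/-- `q` is an admissible answer to the query `(v_f, t)`. -/
def IsAnswer (G : Digraph (Fin n)) (wt : Fin n → Fin n → ℕ) (P : List (Fin n)) (f : ℕ)
    (hf : f < P.length) (s t : Fin n) (ε : ℝ) (q : ℕ∞) : Prop :=
  ddist G wt P f hf s t ≤ q ∧
    (q : ENNReal) ≤ ENNReal.ofReal (1 + ε) * (ddist G wt P f hf s t : ENNReal)

theorem IsAnswer.of_eq (hε : 0 < ε) : IsAnswer G wt P f hf s t ε (ddist G wt P f hf s t) := by
  refine ⟨le_rfl, le_mul_of_one_le_left zero_le ?_⟩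
  rw [ENNReal.one_le_ofReal]
  linarith

/-- The relative error is tested in integers as `1 + 1 / K`, which is at most `1 + ε`. -/
theorem IsAnswer.of_le {q w : ℕ} (hK : 0 < K) (hKε : (K : ℝ)⁻¹ ≤ ε)
    (h : ddist G wt P f hf s t = w) (h1 : w ≤ q) (h2 : K * q ≤ (K + 1) * w) :
    IsAnswer G wt P f hf s t ε q := by
  refine ⟨by rw [h]; exact_mod_cast h1, ?_⟩
  rw [h]
  have hε : 0 ≤ 1 + ε := by
    have : (0 : ℝ) ≤ (K : ℝ)⁻¹ := by positivity
    linarith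
  have : (q : ℝ) ≤ (1 + ε) * w := by
    have hK' : (0 : ℝ) < K := by exact_mod_cast hK
    have h3 : (K : ℝ) * q ≤ (K + 1) * w := by exact_mod_cast h2
    have h4 : (q : ℝ) ≤ (1 + (K : ℝ)⁻¹) * w := by
      rw [← mul_le_mul_iff_right₀ hK']
      calc (K : ℝ) * q ≤ (K + 1) * w := h3
        _ = K * ((1 + (K : ℝ)⁻¹) * w) := by field_simp
    exact h4.trans (by gcongr)
  have h5 := ENNReal.ofReal_le_ofReal this
  rw [ENNReal.ofReal_mul hε, ENNReal.ofReal_natCast, ENNReal.ofReal_natCast] at h5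
  simpa using h5

/-- The tables of all scales `2 ^ i`, `i < I`. -/
def Tables (wt : Fin n → Fin n → ℕ) (E : List (Fin n × Fin n)) (P : List (Fin n))
    (D L I T : ℕ) (J : ℕ → ℕ → ℕ) : Prop :=
  ∀ i < I, ((netOf wt E P).scale (n * L) (2 ^ i)).Table (2 * L) T 1 (D * n) (J i)

/-- The scaling factor `n * L / 2 ^ i` is chosen so that a scaled value of at most `(L + r) * n`
means a true length of at most `2 ^ i * (L + r) / L`; the factor `n` cancels. -/
theorem Tables.ddist_le (hE : ∀ u v : Fin n, (u, v) ∈ E ↔ G.Adj u v)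
    (hP : IsShortestPath G wt P s z) (hJ : Tables wt E P D L I T J) (hfT : f < T)
    (ht : t ∉ P.take (f + 1)) {i r : ℕ} (hi : i < I) (hr : r < L)
    (h : J i (t * (2 * L) + (L + r)) ≤ f) :
    ddist G wt P f hf s t ≤ (2 ^ i * (L + r) / L : ℕ) := by
  obtain ⟨v, hv, hd⟩ := (hJ i hi).sound t t.is_lt (L + r) (by omega) (by omega)
  obtain ⟨v', hd', hle⟩ := (hd.mono h).of_scale (by positivity)
  obtain ⟨R, hR, hw⟩ := isDeparting_of_dep hE hP.1 hf hd' t rfl ht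
  refine (DepartingPath.ddist_le hR).trans ?_
  norm_cast
  rw [Nat.le_div_iff_mul_le (by omega)]
  have hn : 0 < n := t.pos
  have h1 : n * (v' * L) ≤ n * (2 ^ i * (L + r)) := by
    calc n * (v' * L) = n * L * v' := by ring
      _ ≤ 2 ^ i * v := hle
      _ ≤ 2 ^ i * ((L + r) * n) := Nat.mul_le_mul_left _ hv
      _ = _ := by ring
  exact (Nat.mul_le_mul_right L hw).trans (Nat.le_of_mul_le_mul_left h1 hn)

/-- A late entry excludes all walks of scaled value up to `(L + r) * n - D * n`. Passing from walks
to paths loses another `n` for the rounding of the weights, hence `D + 1`. -/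
theorem Tables.lt_of_lt (hE : ∀ u v : Fin n, (u, v) ∈ E ↔ G.Adj u v)
    (hP : IsShortestPath G wt P s z) (hJ : Tables wt E P D L I T J)
    (ht : t ∉ P.take (f + 1)) {i r : ℕ} (hi : i < I) (hr : r < L)
    (h : f < J i (t * (2 * L) + (L + r))) {R : List (Fin n)} (hR : IsDeparting G P f hf s t R) :
    2 ^ i * (L + r) < L * pathWeight wt R + 2 ^ i * (D + 1) := by
  obtain ⟨v, hd, hle⟩ := dep_of_isDeparting (Λ := n * L) (g := 2 ^ i) hE hP ht hR
  have hv : (L + r) * n < v + D * n := by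
    by_contra hc
    have := (hJ i hi).compl t t.is_lt (L + r) (by omega) f (one_dvd f) v hd (not_lt.1 hc)
    omega
  have hn : 0 < n := t.pos
  refine Nat.lt_of_mul_lt_mul_left (a := n) ?_
  calc n * (2 ^ i * (L + r)) = 2 ^ i * ((L + r) * n) := by ring
    _ < 2 ^ i * (v + D * n) := Nat.mul_lt_mul_of_pos_left hv (by positivity)
    _ = 2 ^ i * v + 2 ^ i * (D * n) := by ring
    _ ≤ n * L * pathWeight wt R + 2 ^ i * n + 2 ^ i * (D * n) := Nat.add_le_add_right hle _
    _ = _ := by ring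

theorem IsDeparting.pathWeight_pos (hP : IsPath G P s z) (hw : ∀ u v, G.Adj u v → 1 ≤ wt u v)
    (ht : t ∉ P.take (f + 1)) {R : List (Fin n)} (hR : IsDeparting G P f hf s t R) :
    1 ≤ pathWeight wt R := by
  obtain ⟨A, C, j, hj, hjf, rfl, hC⟩ := hR.split hP ht
  have hch := hR.1.2.2.1
  obtain ⟨l, a, hl⟩ : ∃ l a, A ++ [P[j]] ++ C = l ++ [a] :=
    ⟨_, _, (List.dropLast_append_getLast (l := A ++ [P[j]] ++ C) (by simp)).symm⟩
  rw [hl] at hch ⊢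
  rw [pathWeight_snoc]
  rw [List.isChain_append] at hch
  have := hw a t (hch.2.2 a (by simp) t (by simp))
  omega

/-- The step from an entry after time `f` to an entry up to time `f` gives an admissible answer. -/
theorem Tables.isAnswer (hE : ∀ u v : Fin n, (u, v) ∈ E ↔ G.Adj u v)
    (hw : ∀ u v, G.Adj u v → 1 ≤ wt u v)
    (hP : IsShortestPath G wt P s z) (hK : 0 < K) (hKε : (K : ℝ)⁻¹ ≤ ε) (hL : L = 2 * K * (D + 2))
    (hJ : Tables wt E P D L I T J) (hfT : f < T) (ht : t ∉ P.take (f + 1)) {o V : ℕ → ℕ}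
    (ho : ∀ i < I, ∀ r < L, o (i * L + r) = J i (t * (2 * L) + (L + r)))
    (hV : ∀ i < I, ∀ r < L, V (i * L + r) = 2 ^ i * (L + r) / L) {y : ℕ} (hy : y < I * L)
    (h1 : o y ≤ f) (h2 : y ≠ 0 → f < o (y - 1)) :
    IsAnswer G wt P f hf s t ε (V y) := by
  have hL0 : 0 < L := by rw [hL]; positivity
  have hε : 0 < ε := lt_of_lt_of_le (by positivity) hKε
  obtain ⟨i, r, hi, hr, rfl⟩ : ∃ i r, i < I ∧ r < L ∧ y = i * L + r :=
    ⟨y / L, y % L, (Nat.div_lt_iff_lt_mul hL0).2 hy, Nat.mod_lt _ hL0,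
      (Nat.div_add_mod' y L).symm⟩
  rw [ho i hi r hr] at h1
  have hup := hJ.ddist_le (hf := hf) hE hP hfT ht hi hr h1
  rcases ddist_eq_top_or (G := G) (wt := wt) (P := P) (s := s) (hf := hf) t with h | ⟨R, hR, h⟩
  · rw [h] at hup
    exact absurd hup (by simp)
  rw [hV i hi r hr]
  rw [h] at hup
  norm_cast at hup
  refine IsAnswer.of_le hK hKε h hup ?_
  -- The very first entry stands for the value `1`, and no departing path to `t` is shorter because
  -- its last edge has weight at least `1`.
  by_cases hy0 : i * L + r = 0
  · have hr0 : r = 0 := by omega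
    have hi0 : i = 0 := by
      rcases Nat.mul_eq_zero.1 (by omega : i * L = 0) with h | h <;> omega
    have := hR.pathWeight_pos hP.1 hw ht
    subst hr0 hi0
    rw [pow_zero, one_mul, add_zero, Nat.div_self hL0]
    calc K * 1 ≤ (K + 1) * 1 := by omega
      _ ≤ _ := Nat.mul_le_mul_left _ this
  · obtain ⟨i', r', hi', hr', hyy, hval⟩ : ∃ i' r', i' < I ∧ r' < L ∧ i * L + r - 1 = i' * L + r' ∧
        2 ^ i * (L + r) = 2 ^ i' * (L + r' + 1) := by
      by_cases hr0 : r = 0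
      · subst hr0
        have hi0 : i ≠ 0 := by rintro rfl; simp at hy0
        obtain ⟨i', rfl⟩ := Nat.exists_eq_succ_of_ne_zero hi0
        refine ⟨i', L - 1, by omega, by omega, ?_, ?_⟩
        · rw [Nat.succ_mul]; omega
        · rw [show L + (L - 1) + 1 = 2 * L by omega, pow_succ]; ring
      · exact ⟨i, r - 1, hi, by omega, by omega, by congr 1; omega⟩
    have h3 := h2 hy0
    rw [hyy, ho i' hi' r' hr'] at h3
    have h4 := hJ.lt_of_lt hE hP ht hi' hr' h3 hR
    set w := pathWeight wt R
    have h5 := Nat.div_mul_le_self (2 ^ i * (L + r)) L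
    rw [hval] at h5 ⊢
    set q := 2 ^ i' * (L + r' + 1) / L
    suffices L * (K * q) ≤ L * ((K + 1) * w) from Nat.le_of_mul_le_mul_left this hL0
    -- The choice of `L` enters here: it leaves room for one unit between neighbouring entries and
    -- for `D + 1` units of rounding within the factor `1 + 1 / K`.
    have h6 : K * (L + r' + 1) + (K + 1) * (D + 1) ≤ (K + 1) * (L + r') := by
      have : K * (D + 2) + K * (D + 2) = L := by rw [hL]; ring
      have h7 : D + 2 ≤ K * (D + 2) := Nat.le_mul_of_pos_left _ hK
      nlinarith
    have h7 := Nat.mul_le_mul_left (2 ^ i') h6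
    have h8 := Nat.mul_le_mul_left (K + 1) h4.le
    have h9 := Nat.mul_le_mul_left K h5
    nlinarith

/-- The last entry of the top scale stands for almost `2 * 2 ^ I`, while a simple path has length at
most `n * W ≤ 2 ^ I`. The gap exceeds the rounding error because `L - 1 ≥ D + 1`. -/
theorem Tables.ddist_eq_top (hE : ∀ u v : Fin n, (u, v) ∈ E ↔ G.Adj u v) {W : ℕ}
    (hw : ∀ u v, G.Adj u v → wt u v ≤ W)
    (hP : IsShortestPath G wt P s z) (hK : 0 < K) (hL : L = 2 * K * (D + 2))
    (hJ : Tables wt E P D L (I + 1) T J) (ht : t ∉ P.take (f + 1)) (hI : n * W ≤ 2 ^ I)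
    (h : f < J I (t * (2 * L) + (L + (L - 1)))) :
    ddist G wt P f hf s t = ⊤ := by
  have h7 : D + 2 ≤ K * (D + 2) := Nat.le_mul_of_pos_left _ hK
  have hL2 : K * (D + 2) + K * (D + 2) = L := by rw [hL]; ring
  rcases ddist_eq_top_or (G := G) (wt := wt) (P := P) (s := s) (hf := hf) t with h0 | ⟨R, hR, -⟩
  · exact h0
  have h4 := hJ.lt_of_lt hE hP ht (Nat.lt_succ_self I) (by omega) h hR
  have h5 := Nat.mul_le_mul_left L ((hR.1.pathWeight_le hw).trans hI)
  have h6 : 2 ^ I * (L + (L - 1)) < 2 ^ I * (L + (D + 1)) := by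
    rw [mul_add (2 ^ I) L (D + 1)]
    rw [mul_comm L (2 ^ I)] at h5
    omega
  have := Nat.lt_of_mul_lt_mul_left h6
  omega

end answers

end DepartingPath

namespace WordRAM
open DepartingPath

local infixr:60 " ;; " => Cmd.seq
local notation "𝐫" => Expr.reg
local notation "𝐜" => Expr.const
local notation "𝐥" => Expr.load

/-! ### Buckets -/

theorem sum_update_add {N : ℕ} (f : ℕ → ℕ) {i : ℕ} (hi : i < N) (v : ℕ) :
    ∑ x ∈ Finset.range N, Function.update f i v x + f i = ∑ x ∈ Finset.range N, f x + v := by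
  have hi' := Finset.mem_range.2 hi
  have h : ∑ x ∈ (Finset.range N).erase i, Function.update f i v x =
      ∑ x ∈ (Finset.range N).erase i, f x :=
    Finset.sum_congr rfl fun x hx => Function.update_of_ne (Finset.ne_of_mem_erase hx) v f
  rw [← Finset.add_sum_erase _ _ hi', ← Finset.add_sum_erase _ f hi', Function.update_self, h]
  omega

theorem update_push {α : Type*} {S d d' i c : ℕ} (cell : ℕ → α) (a : α) (hi : i < S) (hc : c < S)
    (h : d' = d → i ≠ c) :
    Function.update cell (d * S + c) a (d' * S + i) = cell (d' * S + i) := by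
  refine Function.update_of_ne (fun heq => ?_) _ _
  obtain ⟨h1, h2⟩ := flat_inj hi hc heq
  exact h h1 h2

/-- Membership in a bag after an insertion. -/
theorem exists_update_push {α : Type*} {S d d' : ℕ} {cnt : ℕ → ℕ} {cell : ℕ → α} {a : α}
    (hd : cnt d < S) (hd' : cnt d' < S) (Q : α → Prop) :
    (∃ i < Function.update cnt d (cnt d + 1) d',
      Q (Function.update cell (d * S + cnt d) a (d' * S + i))) ↔
    (∃ i < cnt d', Q (cell (d' * S + i))) ∨ d' = d ∧ Q a := by
  by_cases hdd : d' = d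
  · subst hdd
    rw [Function.update_self]
    constructor
    · rintro ⟨i, hi, hQ⟩
      rcases Nat.lt_succ_iff_lt_or_eq.1 hi with h | rfl
      · rw [update_push cell a (by omega) hd (by omega)] at hQ
        exact .inl ⟨i, h, hQ⟩
      · rw [Function.update_self] at hQ
        exact .inr ⟨rfl, hQ⟩
    · rintro (⟨i, hi, hQ⟩ | ⟨_, hQ⟩)
      · exact ⟨i, by omega, by rwa [update_push cell a (by omega) hd (by omega)]⟩
      · exact ⟨_, Nat.lt_succ_self _, by rwa [Function.update_self]⟩
  · rw [Function.update_of_ne hdd]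
    constructor
    · rintro ⟨i, hi, hQ⟩
      rw [update_push cell a (by omega) hd (by omega)] at hQ
      exact .inl ⟨i, hi, hQ⟩
    · rintro (⟨i, hi, hQ⟩ | ⟨h, _⟩)
      · exact ⟨i, hi, by rwa [update_push cell a (by omega) hd (by omega)]⟩
      · exact absurd h hdd

/-- Puts the word in register `38` into the bucket with the number in register `41`, provided
that this number is below register `11`. -/
def pushBucket : Cmd :=
  .ite (Expr.lt (𝐫 41) (𝐫 11))
    (.store 13 (𝐫 41 * 𝐫 10 + 𝐥 12 (𝐫 41)) (𝐫 38) ;; .store 12 (𝐫 41) (𝐥 12 (𝐫 41) + 𝐜 1))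
    .skip

theorem pushBucket_spec {B : ℕ} {σ : State} {N S d y : ℕ} (hB : N * S + S + 1 < B)
    (h10 : σ.reg 10 = S) (h11 : σ.reg 11 = N) (h38 : σ.reg 38 = y) (h41 : σ.reg 41 = d)
    (hc : d < N → σ.arr 12 d < S) :
    Wp B pushBucket σ fun τ T => T ≤ 30 ∧
      τ.arr 12 = (if d < N then Function.update (σ.arr 12) d (σ.arr 12 d + 1) else σ.arr 12) ∧
      τ.arr 13 = (if d < N then Function.update (σ.arr 13) (d * S + σ.arr 12 d) y
        else σ.arr 13) := by
  have hB1 : 1 < B := by omega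
  refine wp_ite (fun hg => ?_) (fun hg => ?_) <;>
    simp only [guardRules hB1, ne_eq, evalRules, h41, h11, not_le] at hg
  · have h1 := hc hg
    have h2 := flat_lt hg h1
    have h3 : d * S < B := by omega
    have h4 : d * S + σ.arr 12 d < B := by omega
    refine wp_seq (wp_store (wp_store ?_))
    simp only [evalRules, h10, h38, h41, Nat.mod_eq_of_lt h3, Nat.mod_eq_of_lt h4, hg, if_true,
      Nat.reduceEqDiff, if_false, Nat.mod_eq_of_lt hB1,
      Nat.mod_eq_of_lt (show σ.arr 12 d + 1 < B by omega)]
    exact ⟨by norm_num, trivial, trivial⟩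
  · refine wp_skip ?_
    simp only [evalRules, Nat.not_lt.2 hg, if_false]
    exact ⟨by norm_num, trivial, trivial⟩

/-! ### The memory of a refinement step -/

/-- The size bounds under which no operation overflows. -/
structure Caps (B : ℕ) (N : Net) (Λ R T S M : ℕ) : Prop where
  edge : ∀ e < N.m, N.tail e < N.n ∧ N.head e < N.n
  wt : ∀ e < N.m, Λ * N.wt e ≤ M
  dist : ∀ v < N.n, Λ * N.dist v ≤ M
  pos : ∀ v < N.n, N.pos v ≤ N.n
  stride : S = N.m * R + 1
  big : N.n * R * S + S + 4 * M + T + N.n + N.n * R + N.m + R + 10 < B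

/-- The constants and the input data in the memory. -/
structure Holds (N : Net) (Λ R S : ℕ) (σ : State) : Prop where
  r0 : σ.reg 0 = N.n
  r1 : σ.reg 1 = N.m
  r9 : σ.reg 9 = R
  r10 : σ.reg 10 = S
  r11 : σ.reg 11 = N.n * R
  r12 : σ.reg 12 = Λ
  head : ∀ e < N.m, σ.arr 1 e = N.head e
  wt : ∀ e < N.m, σ.arr 2 e = N.wt e
  tail : ∀ e < N.m, σ.arr 4 e = N.tail e
  pos : ∀ v < N.n, σ.arr 5 v = N.pos v
  dist : ∀ v < N.n, σ.arr 7 v = N.dist v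

theorem Holds.frame {N : Net} {Λ R S : ℕ} {σ τ : State} {c : Cmd} (h : Holds N Λ R S σ)
    (hF : Frame c σ τ) (hr : ∀ r ∈ [0, 1, 9, 10, 11, 12], r ∉ c.regs)
    (ha : ∀ a ∈ [1, 2, 4, 5, 7], a ∉ c.arrs) : Holds N Λ R S τ := by
  constructor
  · rw [hF.reg 0 (hr 0 (by simp)), h.r0]
  · rw [hF.reg 1 (hr 1 (by simp)), h.r1]
  · rw [hF.reg 9 (hr 9 (by simp)), h.r9]
  · rw [hF.reg 10 (hr 10 (by simp)), h.r10]
  · rw [hF.reg 11 (hr 11 (by simp)), h.r11]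
  · rw [hF.reg 12 (hr 12 (by simp)), h.r12]
  · rw [hF.arr 1 (ha 1 (by simp))]; exact h.head
  · rw [hF.arr 2 (ha 2 (by simp))]; exact h.wt
  · rw [hF.arr 4 (ha 4 (by simp))]; exact h.tail
  · rw [hF.arr 5 (ha 5 (by simp))]; exact h.pos
  · rw [hF.arr 7 (ha 7 (by simp))]; exact h.dist

/-- Clears the labels and the counters. -/
def resetStep : Cmd :=
  .for 30 (𝐫 11) (.store 14 (𝐫 30) (𝐜 0) ;; .store 9 (𝐫 30) (𝐜 0) ;; .store 12 (𝐫 30) (𝐜 0))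

theorem resetStep_spec {B : ℕ} {σ : State} {N : ℕ} (hB : N + 1 < B) (h11 : σ.reg 11 = N) :
    Wp B resetStep σ fun τ T => T ≤ 30 * (N + 1) ∧
      ∀ x < N, τ.arr 14 x = 0 ∧ τ.arr 9 x = 0 ∧ τ.arr 12 x = 0 := by
  refine (wp_for_const (fun i τ => ∀ x < i, τ.arr 14 x = 0 ∧ τ.arr 9 x = 0 ∧ τ.arr 12 x = 0)
    N 9 (by omega) (by omega) (by decide) ?_ ?_ ?_).mono ?_
  · intro i τ _ hF _ _
    exact (hF.reg 11 (by decide)).trans h11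
  · simp
  · intro i τ hi hF hr h
    refine wp_seq (wp_store (wp_seq (wp_store (wp_store ?_))))
    simp only [evalRules, hr, Nat.zero_mod, Nat.reduceEqDiff, if_true, if_false]
    refine ⟨fun x hx => ?_, by norm_num⟩
    by_cases hxi : x = i
    · simp [hxi]
    · simp [Function.update_of_ne hxi, h x (by omega)]
  · rintro τ T _ ⟨h, _, hT⟩
    simp only [evalRules] at hT
    exact ⟨by omega, h⟩

/-! ### Initial labels and arcs -/

/-- Advances the pointer in register `39` to the first entry for the tail that is at most the
word in register `40`. -/
def advance : Cmd :=
  .loop (Expr.lt (𝐫 39) (𝐫 9) * Expr.lt (𝐫 40) (𝐥 8 (𝐫 31 + 𝐫 39))) (.assign 39 (𝐫 39 + 𝐜 1))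

/-- Handles entry number register `37` for the head of an edge, if the tail is on the path. -/
def seedSource : Cmd :=
  .assign 38 (𝐫 36 + 𝐫 37) ;;
  .ite (Expr.lt (𝐥 8 (𝐫 38)) (𝐫 34 + 𝐫 22)) .skip (.assign 41 (𝐫 35) ;; pushBucket)

/-- Handles entry number register `37` for the head of an edge, if the tail is off the path. -/
def seedOther : Cmd :=
  .assign 38 (𝐫 36 + 𝐫 37) ;; .assign 40 (𝐥 8 (𝐫 38)) ;; advance ;;
  .ite (Expr.lt (𝐫 39) (𝐫 9))
    (.assign 46 (𝐫 31 + 𝐫 39) ;;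
     .ite (Expr.eq (𝐥 8 (𝐫 46)) (𝐫 40))
      (.assign 47 (𝐫 46 * 𝐫 10 + 𝐥 9 (𝐫 46)) ;; .store 10 (𝐫 47) (𝐫 38) ;;
       .store 11 (𝐫 47) (𝐫 33) ;; .store 9 (𝐫 46) (𝐥 9 (𝐫 46) + 𝐜 1))
      (.assign 41 (𝐫 39 * 𝐫 0 + 𝐫 33) ;; pushBucket))
    .skip

/-- Puts all initial labels into buckets and stores all arcs. -/
def seed : Cmd :=
  .for 30 (𝐫 1)
    (.assign 31 (𝐥 4 (𝐫 30)) ;; .assign 33 (𝐫 12 * 𝐥 2 (𝐫 30) / 𝐫 21 + 𝐜 1) ;;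
     .assign 34 (𝐥 5 (𝐫 31)) ;; .assign 35 (𝐫 12 * 𝐥 7 (𝐫 31) / 𝐫 21 + 𝐜 1 + 𝐫 33) ;;
     .assign 31 (𝐫 31 * 𝐫 9) ;; .assign 36 (𝐥 1 (𝐫 30) * 𝐫 9) ;; .assign 39 (𝐜 0) ;;
     .ite (𝐫 34) (.for 37 (𝐫 9) seedSource) (.for 37 (𝐫 9) seedOther))

section
variable {B : ℕ} {N : Net} {Λ g R T S M h : ℕ} {J : ℕ → ℕ}

/-- Entry `ℓ` for the head of `e` gets the initial label `d`. -/
def LabelAt (N : Net) (R h : ℕ) (J : ℕ → ℕ) (e ℓ d : ℕ) : Prop :=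
  N.pos (N.tail e) ≠ 0 ∧ N.pos (N.tail e) + h ≤ J (N.head e * R + ℓ) ∧
      d = N.dist (N.tail e) + N.wt e ∨
    N.pos (N.tail e) = 0 ∧ ∃ ℓ', N.IsPtr R J e ℓ ℓ' ∧
      J (N.tail e * R + ℓ') ≠ J (N.head e * R + ℓ) ∧ d = ℓ' * N.n + N.wt e

/-- There is an arc from `x` to entry `ℓ` for the head of `e`. -/
def ArcAt (N : Net) (R : ℕ) (J : ℕ → ℕ) (e ℓ x : ℕ) : Prop :=
  N.pos (N.tail e) = 0 ∧ ∃ ℓ', N.IsPtr R J e ℓ ℓ' ∧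
    J (N.tail e * R + ℓ') = J (N.head e * R + ℓ) ∧ x = N.tail e * R + ℓ'

theorem init_iff {y d : ℕ} : N.Init R h J y d ↔
    ∃ e ℓ, e < N.m ∧ ℓ < R ∧ y = N.head e * R + ℓ ∧ LabelAt N R h J e ℓ d := by
  constructor
  · rintro (⟨e, ℓ, he, hℓ, hp, hle⟩ | ⟨e, ℓ, ℓ', he, hℓ, hp, hptr, hne⟩)
    · exact ⟨e, ℓ, he, hℓ, rfl, .inl ⟨hp, hle, rfl⟩⟩
    · exact ⟨e, ℓ, he, hℓ, rfl, .inr ⟨hp, ℓ', hptr, hne, rfl⟩⟩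
  · rintro ⟨e, ℓ, he, hℓ, rfl, ⟨hp, hle, rfl⟩ | ⟨hp, ℓ', hptr, hne, rfl⟩⟩
    · exact .source e ℓ he hℓ hp hle
    · exact .done e ℓ ℓ' he hℓ hp hptr hne

theorem arc_iff {x y w : ℕ} : N.Arc R J x y w ↔
    ∃ e ℓ, e < N.m ∧ ℓ < R ∧ y = N.head e * R + ℓ ∧ ArcAt N R J e ℓ x ∧ w = N.wt e := by
  constructor
  · rintro ⟨e, ℓ, ℓ', he, hℓ, hp, hptr, heq⟩
    exact ⟨e, ℓ, he, hℓ, rfl, ⟨hp, ℓ', hptr, heq, rfl⟩, rfl⟩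
  · rintro ⟨e, ℓ, he, hℓ, rfl, ⟨hp, ℓ', hptr, heq, rfl⟩, rfl⟩
    exact .mk e ℓ ℓ' he hℓ hp hptr heq

/-- The buckets and the arcs stored for the pairs `(e, ℓ)` before `(i, k)`. -/
structure Seeded (N : Net) (R S h : ℕ) (J : ℕ → ℕ) (i k : ℕ) (σ : State) : Prop where
  buckets : ∀ d < N.n * R, ∀ y, (∃ a < σ.arr 12 d, σ.arr 13 (d * S + a) = y) ↔
    ∃ e ℓ, (e < i ∧ ℓ < R ∨ e = i ∧ ℓ < k) ∧ y = N.head e * R + ℓ ∧ LabelAt N R h J e ℓ d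
  arcs : ∀ x < N.n * R, ∀ y w,
    (∃ a < σ.arr 9 x, σ.arr 10 (x * S + a) = y ∧ σ.arr 11 (x * S + a) = w) ↔
    ∃ e ℓ, (e < i ∧ ℓ < R ∨ e = i ∧ ℓ < k) ∧ y = N.head e * R + ℓ ∧ ArcAt N R J e ℓ x ∧ w = N.wt e
  count : ∑ d ∈ Finset.range (N.n * R), σ.arr 12 d + ∑ x ∈ Finset.range (N.n * R), σ.arr 9 x ≤
    i * R + k

theorem Seeded.congr {i k : ℕ} {σ τ : State} (H : Seeded N R S h J i k σ)
    (h9 : τ.arr 9 = σ.arr 9) (h10 : τ.arr 10 = σ.arr 10) (h11 : τ.arr 11 = σ.arr 11)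
    (h12 : τ.arr 12 = σ.arr 12) (h13 : τ.arr 13 = σ.arr 13) : Seeded N R S h J i k τ := by
  constructor
  · rw [h12, h13]; exact H.buckets
  · rw [h9, h10, h11]; exact H.arcs
  · rw [h12, h9]; exact H.count

theorem Seeded.row {i : ℕ} {σ : State} (H : Seeded N R S h J i R σ) :
    Seeded N R S h J (i + 1) 0 σ := by
  have hiff : ∀ e ℓ, (e < i + 1 ∧ ℓ < R ∨ e = i + 1 ∧ ℓ < 0) ↔ (e < i ∧ ℓ < R ∨ e = i ∧ ℓ < R) := by
    intro e ℓ; omega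
  constructor
  · simp only [hiff]; exact H.buckets
  · simp only [hiff]; exact H.arcs
  · have := H.count
    rw [add_mul]
    omega

/-- Each pair `(e, ℓ)` inserts at most one label or one arc, so at most `N.m * R` insertions occur
in total. With stride `N.m * R + 1` no bucket can run into the next one, and the cells never have to
be cleared, only the counters. -/
theorem Seeded.lt {i k d : ℕ} {σ : State} (H : Seeded N R S h J i k σ) (hi : i < N.m) (hk : k < R)
    (hS : S = N.m * R + 1) (hd : d < N.n * R) : σ.arr 12 d + 1 < S ∧ σ.arr 9 d + 1 < S := by
  have h1 := H.count
  have h2 := flat_lt hi hk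
  have h3 := Finset.single_le_sum (f := fun d => σ.arr 12 d) (fun _ _ => Nat.zero_le _)
    (Finset.mem_range.2 hd)
  have h4 := Finset.single_le_sum (f := fun d => σ.arr 9 d) (fun _ _ => Nat.zero_le _)
    (Finset.mem_range.2 hd)
  omega

/-- The pair `(i, k)` gets neither a label below the cap nor an arc. -/
theorem Seeded.skip {i k : ℕ} {σ : State} (H : Seeded N R S h J i k σ)
    (h1 : ∀ d < N.n * R, ¬ LabelAt N R h J i k d) (h2 : ∀ x < N.n * R, ¬ ArcAt N R J i k x) :
    Seeded N R S h J i (k + 1) σ := by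
  constructor
  · intro d hd y
    rw [H.buckets d hd y]
    constructor
    · rintro ⟨e, ℓ, h, h'⟩
      exact ⟨e, ℓ, by omega, h'⟩
    · rintro ⟨e, ℓ, h, h', h''⟩
      refine ⟨e, ℓ, ?_, h', h''⟩
      by_contra hc
      obtain ⟨rfl, rfl⟩ : e = i ∧ ℓ = k := by omega
      exact h1 d hd h''
  · intro x hx y w
    rw [H.arcs x hx y w]
    constructor
    · rintro ⟨e, ℓ, h, h'⟩
      exact ⟨e, ℓ, by omega, h'⟩
    · rintro ⟨e, ℓ, h, h', h'', h3⟩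
      refine ⟨e, ℓ, ?_, h', h'', h3⟩
      by_contra hc
      obtain ⟨rfl, rfl⟩ : e = i ∧ ℓ = k := by omega
      exact h2 x hx h''
  · have := H.count
    omega

/-- The pair `(i, k)` gets the label `d` and no arc. -/
theorem Seeded.push {i k d : ℕ} {σ τ : State} (H : Seeded N R S h J i k σ) (hi : i < N.m)
    (hk : k < R) (hS : S = N.m * R + 1) (h1 : ∀ d', LabelAt N R h J i k d' ↔ d' = d)
    (h2 : ∀ x < N.n * R, ¬ ArcAt N R J i k x)
    (h9 : τ.arr 9 = σ.arr 9) (h10 : τ.arr 10 = σ.arr 10) (h11 : τ.arr 11 = σ.arr 11)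
    (h12 : τ.arr 12 =
      if d < N.n * R then Function.update (σ.arr 12) d (σ.arr 12 d + 1) else σ.arr 12)
    (h13 : τ.arr 13 = if d < N.n * R then
      Function.update (σ.arr 13) (d * S + σ.arr 12 d) (N.head i * R + k) else σ.arr 13) :
    Seeded N R S h J i (k + 1) τ := by
  by_cases hd : d < N.n * R
  · rw [if_pos hd] at h12 h13
    constructor
    · intro d' hd' y
      rw [h12, h13, exists_update_push (by have := H.lt hi hk hS hd; omega)
        (by have := H.lt hi hk hS hd'; omega) (fun x => x = y), H.buckets d' hd' y]
      constructor
      · rintro (⟨e, ℓ, h, h'⟩ | ⟨rfl, rfl⟩)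
        · exact ⟨e, ℓ, by omega, h'⟩
        · exact ⟨i, k, by omega, rfl, (h1 d').2 rfl⟩
      · rintro ⟨e, ℓ, h, h', h''⟩
        by_cases hc : e = i ∧ ℓ = k
        · obtain ⟨rfl, rfl⟩ := hc
          exact .inr ⟨(h1 d').1 h'', h'.symm⟩
        · exact .inl ⟨e, ℓ, by omega, h', h''⟩
    · rw [h9, h10, h11]
      intro x hx y w
      rw [H.arcs x hx y w]
      constructor
      · rintro ⟨e, ℓ, h, h'⟩
        exact ⟨e, ℓ, by omega, h'⟩
      · rintro ⟨e, ℓ, h, h', h'', h3⟩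
        refine ⟨e, ℓ, ?_, h', h'', h3⟩
        by_contra hc
        obtain ⟨rfl, rfl⟩ : e = i ∧ ℓ = k := by omega
        exact h2 x hx h''
    · have := H.count
      have := sum_update_add (σ.arr 12) hd (σ.arr 12 d + 1)
      rw [h12, h9]
      omega
  · rw [if_neg hd] at h12 h13
    -- A label beyond the last bucket is dropped; the invariant speaks only of labels below `N.n *
    -- R`.
    refine Seeded.congr (H.skip (fun d' hd' h => ?_) h2) h9 h10 h11 h12 h13
    rw [(h1 d').1 h] at hd'
    exact hd hd'

/-- The pair `(i, k)` gets an arc and no label. -/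
theorem Seeded.arc {i k x : ℕ} {σ τ : State} (H : Seeded N R S h J i k σ) (hi : i < N.m)
    (hk : k < R) (hS : S = N.m * R + 1) (h1 : ∀ d < N.n * R, ¬ LabelAt N R h J i k d)
    (hx : x < N.n * R) (h2 : ∀ x', ArcAt N R J i k x' ↔ x' = x)
    (h9 : τ.arr 9 = Function.update (σ.arr 9) x (σ.arr 9 x + 1))
    (h10 : τ.arr 10 = Function.update (σ.arr 10) (x * S + σ.arr 9 x) (N.head i * R + k))
    (h11 : τ.arr 11 = Function.update (σ.arr 11) (x * S + σ.arr 9 x) (N.wt i))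
    (h12 : τ.arr 12 = σ.arr 12) (h13 : τ.arr 13 = σ.arr 13) :
    Seeded N R S h J i (k + 1) τ := by
  constructor
  · rw [h12, h13]
    intro d hd y
    rw [H.buckets d hd y]
    constructor
    · rintro ⟨e, ℓ, h, h'⟩
      exact ⟨e, ℓ, by omega, h'⟩
    · rintro ⟨e, ℓ, h, h', h''⟩
      refine ⟨e, ℓ, ?_, h', h''⟩
      by_contra hc
      obtain ⟨rfl, rfl⟩ : e = i ∧ ℓ = k := by omega
      exact h1 d hd h''
  · intro x' hx' y w
    have hcell : ∀ a, (τ.arr 10 a, τ.arr 11 a) = Function.update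
        (fun a => (σ.arr 10 a, σ.arr 11 a)) (x * S + σ.arr 9 x) (N.head i * R + k, N.wt i) a := by
      intro a
      rw [h10, h11]
      by_cases ha : a = x * S + σ.arr 9 x
      · subst ha; simp
      · simp [ha]
    have := exists_update_push (d := x) (d' := x') (cell := fun a => (σ.arr 10 a, σ.arr 11 a))
      (a := (N.head i * R + k, N.wt i)) (cnt := σ.arr 9) (S := S)
      (by have := H.lt hi hk hS hx; omega) (by have := H.lt hi hk hS hx'; omega)
      (fun p => p.1 = y ∧ p.2 = w)
    simp only [← hcell, ← h9] at this
    rw [this, H.arcs x' hx' y w]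
    constructor
    · rintro (⟨e, ℓ, h, h'⟩ | ⟨rfl, rfl, rfl⟩)
      · exact ⟨e, ℓ, by omega, h'⟩
      · exact ⟨i, k, by omega, rfl, (h2 x').2 rfl, rfl⟩
    · rintro ⟨e, ℓ, h, h', h'', h3⟩
      by_cases hc : e = i ∧ ℓ = k
      · obtain ⟨rfl, rfl⟩ := hc
        exact .inr ⟨(h2 x').1 h'', h'.symm, h3.symm⟩
      · exact .inl ⟨e, ℓ, by omega, h', h'', h3⟩
  · have := H.count
    have := sum_update_add (σ.arr 9) hx (σ.arr 9 x + 1)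
    rw [h12, h9]
    omega

/-- The steps are charged to the advance of the pointer through the potential `20 * (R - q)`, so
that a sequence of calls is cheap in total. -/
theorem advance_spec {σ : State} {x q v : ℕ} (hB : x + R + 1 < B) (h9 : σ.reg 9 = R)
    (h31 : σ.reg 31 = x) (h39 : σ.reg 39 = q) (h40 : σ.reg 40 = v) (hq : q ≤ R)
    (h1 : ∀ k < q, v < σ.arr 8 (x + k)) :
    Wp B advance σ fun τ T => ∃ q', τ.reg 39 = q' ∧ q ≤ q' ∧ q' ≤ R ∧
      (∀ k < q', v < σ.arr 8 (x + k)) ∧ (q' < R → σ.arr 8 (x + q') ≤ v) ∧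
      T + 20 * (R - q') ≤ 20 * (R - q) + 20 := by
  have hB1 : 1 < B := by omega
  -- The product of the two comparisons serves as their conjunction. When the pointer equals `R`,
  -- the word read lies past the row, but its comparison is multiplied by `0`.
  have hguard : ∀ τ : State, τ.reg 9 = R → τ.reg 31 = x → τ.reg 40 = v → τ.arr 8 = σ.arr 8 →
      τ.reg 39 ≤ R →
      ((Expr.lt (𝐫 39) (𝐫 9) * Expr.lt (𝐫 40) (𝐥 8 (𝐫 31 + 𝐫 39))).eval B τ ≠ 0 ↔
        τ.reg 39 < R ∧ v < σ.arr 8 (x + τ.reg 39)) := by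
    intro τ k9 k31 k40 k8 hle
    simp only [evalRules, Expr.eval_lt hB1, k9, k31, k40, k8,
      Nat.mod_eq_of_lt (show x + τ.reg 39 < B by omega)]
    split_ifs <;> simp_all [Nat.mod_eq_of_lt hB1]
  refine (wp_loop (fun τ b => ∃ q', τ.reg 39 = q' ∧ q ≤ q' ∧ q' ≤ R ∧
      (∀ k < q', v < σ.arr 8 (x + k)) ∧ b = 20 * (R - q')) (b := 20 * (R - q))
      ⟨q, h39, le_rfl, hq, h1, rfl⟩ ?_).mono ?_
  · rintro τ b hF ⟨q', k39, hqq, hqR, hlt, rfl⟩ hg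
    rw [hguard τ ((hF.reg 9 (by decide)).trans h9) ((hF.reg 31 (by decide)).trans h31)
      ((hF.reg 40 (by decide)).trans h40) (hF.arr 8 (by decide)) (by omega), k39] at hg
    refine wp_assign ?_
    simp only [evalRules, k39, Nat.mod_eq_of_lt hB1, if_true,
      Nat.mod_eq_of_lt (show q' + 1 < B by omega)]
    refine ⟨_, ⟨q' + 1, rfl, by omega, by omega, fun k hk => ?_, rfl⟩, by omega⟩
    rcases Nat.lt_succ_iff_lt_or_eq.1 hk with hk | rfl
    · exact hlt k hk
    · exact hg.2
  · rintro τ T' hF ⟨hg, b', ⟨q', k39, hqq, hqR, hlt, rfl⟩, hT⟩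
    refine ⟨q', k39, hqq, hqR, hlt, fun hlt' => ?_, ?_⟩
    · by_contra hc
      exact (hguard τ ((hF.reg 9 (by decide)).trans h9) ((hF.reg 31 (by decide)).trans h31)
        ((hF.reg 40 (by decide)).trans h40) (hF.arr 8 (by decide)) (by omega)).2
        (k39 ▸ ⟨hlt', not_le.1 hc⟩) hg
    · simp only [evalRules] at hT
      omega


theorem seedSource_spec {σ : State} {i k v : ℕ} (H : Seeded N R S h J i k σ) (hi : i < N.m)
    (hk : k < R) (hn : N.head i < N.n) (hS : S = N.m * R + 1)
    (hB : N.n * R * S + S + N.n * R + v + N.pos (N.tail i) + h + 1 < B)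
    (h8 : ∀ x < N.n * R, σ.arr 8 x = J x) (r10 : σ.reg 10 = S) (r11 : σ.reg 11 = N.n * R)
    (r22 : σ.reg 22 = h) (r34 : σ.reg 34 = N.pos (N.tail i)) (hp : N.pos (N.tail i) ≠ 0)
    (r35 : σ.reg 35 = v) (hv : v = N.dist (N.tail i) + N.wt i)
    (r36 : σ.reg 36 = N.head i * R) (r37 : σ.reg 37 = k) :
    Wp B seedSource σ fun τ T => Seeded N R S h J i (k + 1) τ ∧ T ≤ 60 := by
  have hB1 : 1 < B := by omega
  have hx := flat_lt hn hk
  have hA : ∀ x < N.n * R, ¬ ArcAt N R J i k x := fun x _ h => hp h.1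
  have hJ := h8 _ hx
  refine wp_seq (wp_assign (wp_ite (fun hg => ?_) (fun hg => ?_))) <;>
    simp only [guardRules hB1, ne_eq, evalRules, r34, r36, r37, r22, reduceIte, Nat.reduceEqDiff,
      Nat.mod_eq_of_lt (show N.head i * R + k < B by omega), hJ, not_le,
      Nat.mod_eq_of_lt (show N.pos (N.tail i) + h < B by omega)] at hg
  · refine wp_skip ⟨Seeded.congr (H.skip (fun d hd hL => ?_) hA) rfl rfl rfl rfl rfl, ?_⟩
    · rcases hL with ⟨_, h, _⟩ | ⟨h, _⟩ <;> omega
    · simp only [evalRules]; norm_num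
  · refine wp_seq (wp_assign ?_)
    refine (pushBucket_spec (N := N.n * R) (S := S) (d := v) (y := N.head i * R + k) (by omega)
      (by simp only [evalRules, reduceIte, Nat.reduceEqDiff, r10])
      (by simp only [evalRules, reduceIte, Nat.reduceEqDiff, r11])
      (by simp only [evalRules, reduceIte, Nat.reduceEqDiff, r36, r37]
          exact Nat.mod_eq_of_lt (by omega))
      (by simp only [evalRules, reduceIte, Nat.reduceEqDiff, r35])
      (fun hd => by
        have := H.lt hi hk hS hd
        simp only [evalRules]
        omega)).mono ?_
    rintro τ T hF ⟨hT, h12, h13⟩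
    refine ⟨H.push hi hk hS (d := v) (fun d' => ?_) hA ?_ ?_ ?_ h12 h13, ?_⟩
    · constructor
      · rintro (⟨_, _, h⟩ | ⟨h, _⟩)
        · rw [h, hv]
        · exact absurd h hp
      · rintro rfl
        exact .inl ⟨hp, hg, hv⟩
    · exact hF.arr 9 (by decide)
    · exact hF.arr 10 (by decide)
    · exact hF.arr 11 (by decide)
    · simp only [evalRules]; omega

/-- The least index is unique, so the pair receives exactly one arc or one label if the pointer
stays inside the row, and nothing if it runs off the end. -/
theorem seedOther_spec {σ : State} {i k q : ℕ} (H : Seeded N R S h J i k σ) (hi : i < N.m)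
    (hk : k < R) (hn : N.tail i < N.n ∧ N.head i < N.n) (hS : S = N.m * R + 1)
    (hB : N.n * R * S + S + N.n * R + R + N.wt i + 1 < B)
    (h8 : ∀ x < N.n * R, σ.arr 8 x = J x) (r0 : σ.reg 0 = N.n) (r9 : σ.reg 9 = R)
    (r10 : σ.reg 10 = S) (r11 : σ.reg 11 = N.n * R)
    (r31 : σ.reg 31 = N.tail i * R) (r33 : σ.reg 33 = N.wt i) (hp : N.pos (N.tail i) = 0)
    (r36 : σ.reg 36 = N.head i * R) (r37 : σ.reg 37 = k) (r39 : σ.reg 39 = q) (hq : q ≤ R)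
    (hlow : ∀ k' < q, J (N.head i * R + k) < J (N.tail i * R + k')) :
    Wp B seedOther σ fun τ T => Seeded N R S h J i (k + 1) τ ∧ ∃ q', τ.reg 39 = q' ∧ q' ≤ R ∧
      (∀ k' < q', J (N.head i * R + k) < J (N.tail i * R + k')) ∧
      T + 20 * (R - q') ≤ 20 * (R - q) + 120 := by
  have hB1 : 1 < B := by omega
  have hx := flat_lt hn.2 hk
  have hu : N.tail i * R + R ≤ N.n * R := by
    have := Nat.mul_le_mul_right R hn.1
    rwa [Nat.succ_mul] at this
  have hu' : ∀ k' < R, σ.arr 8 (N.tail i * R + k') = J (N.tail i * R + k') :=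
    fun k' hk' => h8 _ (by omega)
  have hJ := h8 _ hx
  refine wp_seq (wp_assign (wp_seq (wp_assign (wp_seq ((advance_spec (x := N.tail i * R) (q := q)
    (R := R) (v := J (N.head i * R + k)) (by omega) ?_ ?_ ?_ ?_ hq ?_).mono ?_)))))
  · simp only [evalRules, reduceIte, Nat.reduceEqDiff, r9]
  · simp only [evalRules, reduceIte, Nat.reduceEqDiff, r31]
  · simp only [evalRules, reduceIte, Nat.reduceEqDiff, r39]
  · simp only [evalRules, reduceIte, Nat.reduceEqDiff, r36, r37,
      Nat.mod_eq_of_lt (show N.head i * R + k < B by omega), hJ]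
  · intro k' hk'
    simp only [evalRules]
    rw [hu' k' (by omega)]
    exact hlow k' hk'
  rintro τ T hF ⟨q', t39, hqq, hqR, hlt, hle, hT⟩
  have t8 := hF.arr 8 (by decide)
  have t9 := hF.arr 9 (by decide)
  have t10 := hF.arr 10 (by decide)
  have t11 := hF.arr 11 (by decide)
  have t12 := hF.arr 12 (by decide)
  have t13 := hF.arr 13 (by decide)
  have s38 := hF.reg 38 (by decide)
  have s40 := hF.reg 40 (by decide)
  have s31 := hF.reg 31 (by decide)
  have s9 := hF.reg 9 (by decide)
  have s10 := hF.reg 10 (by decide)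
  have s11 := hF.reg 11 (by decide)
  have s0 := hF.reg 0 (by decide)
  have s33 := hF.reg 33 (by decide)
  simp only [evalRules, reduceIte, Nat.reduceEqDiff, r36, r37, r31, r9, r10, r11, r0, r33,
    Nat.mod_eq_of_lt (show N.head i * R + k < B by omega), hJ] at hlt hle t8 t9 t10 t11 t12 t13 s38 s40 s31 s9 s10 s11 s0 s33
  have H' : Seeded N R S h J i k τ := H.congr t9 t10 t11 t12 t13
  have hlt' : ∀ k' < q', J (N.head i * R + k) < J (N.tail i * R + k') := fun k' hk' => by
    rw [← hu' k' (by omega)]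
    exact hlt k' hk'
  refine wp_ite (fun hg => ?_) (fun hg => ?_) <;>
    simp only [guardRules hB1, ne_eq, evalRules, s9, t39, not_le] at hg
  · have hle' := hle hg
    rw [hu' q' hg] at hle'
    have hptr : N.IsPtr R J i k q' := ⟨hg, hle', hlt'⟩
    have huniq : ∀ ℓ', N.IsPtr R J i k ℓ' → ℓ' = q' := by
      rintro ℓ' ⟨_, p2, p3⟩
      rcases lt_trichotomy ℓ' q' with hc | hc | hc
      · have := hlt' ℓ' hc
        omega
      · exact hc
      · have := p3 q' hc
        omega
    have hxq : N.tail i * R + q' < N.n * R := by omega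
    have hcell := flat_lt hxq (show σ.arr 9 (N.tail i * R + q') < S by
      have := H.lt hi hk hS hxq
      omega)
    have hS9 := (H.lt hi hk hS hxq).2
    refine wp_seq (wp_assign (wp_ite (fun hg' => ?_) (fun hg' => ?_))) <;>
      simp only [guardRules hB1, ne_eq, evalRules, s31, t39, s40, t8, reduceIte, Nat.reduceEqDiff,
        Nat.mod_eq_of_lt (show N.tail i * R + q' < B by omega), not_not, hu' q' hg] at hg'
    · refine wp_seq (wp_assign (wp_seq (wp_store (wp_seq (wp_store (wp_store ?_))))))
      simp only [evalRules, s31, t39, s38, s33, s10, t9, t10, t11, reduceIte, Nat.reduceEqDiff,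
        Nat.mod_eq_of_lt (show N.tail i * R + q' < B by omega), Nat.mod_eq_of_lt hB1,
        Nat.mod_eq_of_lt (show (N.tail i * R + q') * S < B by omega),
        Nat.mod_eq_of_lt (show (N.tail i * R + q') * S + σ.arr 9 (N.tail i * R + q') < B by omega),
        Nat.mod_eq_of_lt (show σ.arr 9 (N.tail i * R + q') + 1 < B by omega)]
      refine ⟨H.arc hi hk hS (x := N.tail i * R + q') (fun d _ hL => ?_) hxq (fun x' => ?_)
        ?_ ?_ ?_ ?_ ?_, q', rfl, hqR, hlt', by omega⟩
      · rcases hL with ⟨h, _⟩ | ⟨_, ℓ', hptr', hne, _⟩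
        · exact h hp
        · rw [huniq ℓ' hptr'] at hne
          exact hne hg'
      · constructor
        · rintro ⟨_, ℓ', hptr', _, rfl⟩
          rw [huniq ℓ' hptr']
        · rintro rfl
          exact ⟨hp, q', hptr, hg', rfl⟩
      · simp only [evalRules, reduceIte, Nat.reduceEqDiff, t9]
      · simp only [evalRules, reduceIte, Nat.reduceEqDiff, t10]
      · simp only [evalRules, reduceIte, Nat.reduceEqDiff, t11]
      · simp only [evalRules, reduceIte, Nat.reduceEqDiff, t12]
      · simp only [evalRules, reduceIte, Nat.reduceEqDiff, t13]
    · have hqn : q' * N.n ≤ N.n * R := by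
        rw [mul_comm]
        exact Nat.mul_le_mul_left _ hqR
      have hA : ∀ x < N.n * R, ¬ ArcAt N R J i k x := by
        rintro x _ ⟨_, ℓ', hptr', heq, _⟩
        rw [huniq ℓ' hptr'] at heq
        exact hg' heq
      refine wp_seq (wp_assign ?_)
      refine (pushBucket_spec (N := N.n * R) (S := S) (d := q' * N.n + N.wt i)
        (y := N.head i * R + k) (by omega)
        (by simp only [evalRules, reduceIte, Nat.reduceEqDiff, s10])
        (by simp only [evalRules, reduceIte, Nat.reduceEqDiff, s11])
        (by simp only [evalRules, reduceIte, Nat.reduceEqDiff, s38])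
        (by simp only [evalRules, reduceIte, Nat.reduceEqDiff, t39, s0, s33]
            rw [Nat.mod_eq_of_lt (show q' * N.n < B by omega)]
            exact Nat.mod_eq_of_lt (by omega))
        (fun hd => by
          have := H.lt hi hk hS hd
          simp only [evalRules, t12]
          omega)).mono ?_
      rintro ρ T' hF' ⟨hT', h12, h13⟩
      simp only [evalRules, t12, t13] at h12 h13
      have a9 := hF'.arr 9 (by decide)
      have a10 := hF'.arr 10 (by decide)
      have a11 := hF'.arr 11 (by decide)
      have a39 := hF'.reg 39 (by decide)
      simp only [evalRules, t9, t10, t11, t39, reduceIte, Nat.reduceEqDiff] at a9 a10 a11 a39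
      refine ⟨H.push hi hk hS (d := q' * N.n + N.wt i) (fun d' => ?_) hA a9 a10 a11 h12 h13,
        q', a39, hqR, hlt', ?_⟩
      · constructor
        · rintro (⟨h, _⟩ | ⟨_, ℓ', hptr', _, h⟩)
          · exact absurd hp h
          · rw [h, huniq ℓ' hptr']
        · rintro rfl
          exact .inr ⟨hp, q', hptr, hg', rfl⟩
      · simp only [evalRules]; omega
  · refine wp_skip ⟨H'.skip (fun d hd hL => ?_) (fun x hx hL => ?_), q', t39, hqR, hlt', ?_⟩
    · rcases hL with ⟨h, _⟩ | ⟨_, ℓ', hptr', _⟩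
      · exact h hp
      · have := hlt' ℓ' (by have := hptr'.1; omega)
        have := hptr'.2.1
        omega
    · obtain ⟨_, ℓ', hptr', _⟩ := hL
      have := hlt' ℓ' (by have := hptr'.1; omega)
      have := hptr'.2.1
      omega
    · simp only [evalRules]; omega

/-- One edge costs `O(R)` rather than `O(R ^ 2)`: rows are non-increasing, so the threshold falls as
the entry number for the head grows, and entries of the tail once skipped stay skipped. The pointer
is therefore never moved back. -/
theorem seedRow_spec {σ : State} {i v : ℕ} (H : Seeded N R S h J i 0 σ) (hi : i < N.m)
    (hn : N.tail i < N.n ∧ N.head i < N.n) (hS : S = N.m * R + 1)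
    (hB : N.n * R * S + S + N.n * R + R + v + N.wt i + N.pos (N.tail i) + h + 1 < B)
    (h8 : ∀ x < N.n * R, σ.arr 8 x = J x)
    (hmono : ∀ t < N.n, ∀ ℓ ℓ', ℓ ≤ ℓ' → ℓ' < R → J (t * R + ℓ') ≤ J (t * R + ℓ))
    (r0 : σ.reg 0 = N.n) (r9 : σ.reg 9 = R) (r10 : σ.reg 10 = S) (r11 : σ.reg 11 = N.n * R)
    (r22 : σ.reg 22 = h) (r31 : σ.reg 31 = N.tail i * R) (r33 : σ.reg 33 = N.wt i)
    (r34 : σ.reg 34 = N.pos (N.tail i)) (r35 : σ.reg 35 = v)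
    (hv : v = N.dist (N.tail i) + N.wt i) (r36 : σ.reg 36 = N.head i * R) (r39 : σ.reg 39 = 0) :
    Wp B (.ite (𝐫 34) (.for 37 (𝐫 9) seedSource) (.for 37 (𝐫 9) seedOther)) σ fun τ T =>
      Seeded N R S h J (i + 1) 0 τ ∧ T ≤ R * 180 + 10 := by
  have hB1 : 1 < B := by omega
  refine wp_ite (fun hp => ?_) (fun hp => ?_) <;>
    simp only [evalRules, r34, ne_eq] at hp
  · refine (wp_for_const (fun k τ => Seeded N R S h J i k τ) R 60 (by omega) hB1 (by decide)
      ?_ ?_ ?_).mono ?_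
    · intro k τ _ hF _ _
      exact (hF.reg 9 (by decide)).trans r9
    · exact H.congr rfl rfl rfl rfl rfl
    · intro k τ hk hF hr H
      refine (seedSource_spec H hi hk hn.2 hS (v := v) (by omega) ?_
        ((hF.reg 10 (by decide)).trans r10) ((hF.reg 11 (by decide)).trans r11)
        ((hF.reg 22 (by decide)).trans r22) ((hF.reg 34 (by decide)).trans r34) hp
        ((hF.reg 35 (by decide)).trans r35) hv ((hF.reg 36 (by decide)).trans r36) hr).mono ?_
      · rw [hF.arr 8 (by decide)]; exact h8
      · rintro ρ T' _ ⟨H, hT⟩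
        exact ⟨H.congr rfl rfl rfl rfl rfl, hT⟩
    · rintro τ T' _ ⟨H, _, hT⟩
      simp only [evalRules] at hT ⊢
      exact ⟨H.row, by omega⟩
  · refine (wp_for (fun k τ b => Seeded N R S h J i k τ ∧ ∃ q, τ.reg 39 = q ∧ q ≤ R ∧
      (k < R → ∀ k' < q, J (N.head i * R + k) < J (N.tail i * R + k')) ∧ b = 20 * (R - q)) R 120
      (b := 20 * R) (by omega) hB1 (by decide) ?_ ?_ ?_).mono ?_
    · intro k τ b _ hF _ _
      exact (hF.reg 9 (by decide)).trans r9
    · refine ⟨H.congr rfl rfl rfl rfl rfl, 0, ?_, by omega, fun _ k' hk' => by omega, by omega⟩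
      simp only [evalRules, reduceIte, Nat.reduceEqDiff, r39]
    · rintro k τ b hk hF hr ⟨H, q, t39, hq, hlow, rfl⟩
      refine (seedOther_spec H hi hk hn hS (by omega) ?_ ((hF.reg 0 (by decide)).trans r0)
        ((hF.reg 9 (by decide)).trans r9) ((hF.reg 10 (by decide)).trans r10)
        ((hF.reg 11 (by decide)).trans r11) ((hF.reg 31 (by decide)).trans r31)
        ((hF.reg 33 (by decide)).trans r33) hp ((hF.reg 36 (by decide)).trans r36) hr t39 hq
        (hlow hk)).mono ?_
      · rw [hF.arr 8 (by decide)]; exact h8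
      · rintro ρ T' _ ⟨H, q', t39, hq', hlow', hT⟩
        refine ⟨_, ⟨H.congr rfl rfl rfl rfl rfl, q', ?_, hq', fun hk1 k' hk' => ?_, rfl⟩, by omega⟩
        · simp only [evalRules, reduceIte, Nat.reduceEqDiff, t39]
        · exact (hmono _ hn.2 k (k + 1) (by omega) hk1).trans_lt (hlow' k' hk')
    · rintro τ T' _ ⟨b', ⟨H, _⟩, _, hT⟩
      simp only [evalRules] at hT ⊢
      exact ⟨H.row, by omega⟩

theorem seed_spec {N₀ : Net} {σ : State} (hN : N = N₀.scale Λ g) (hC : Caps B N₀ Λ R T S M)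
    (hσ : Holds N₀ Λ R S σ) (hg : 0 < g) (hgB : g < B) (hh : h ≤ T) (r21 : σ.reg 21 = g)
    (r22 : σ.reg 22 = h) (h8 : ∀ x < N.n * R, σ.arr 8 x = J x)
    (hmono : ∀ t < N.n, ∀ ℓ ℓ', ℓ ≤ ℓ' → ℓ' < R → J (t * R + ℓ') ≤ J (t * R + ℓ))
    (h0 : ∀ x < N.n * R, σ.arr 9 x = 0 ∧ σ.arr 12 x = 0) :
    Wp B seed σ fun τ T' => Seeded N R S h J N.m 0 τ ∧ T' ≤ 500 * ((N.m + 1) * (R + 1)) := by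
  have hbig := hC.big
  have hB1 : 1 < B := by omega
  have hS : S = N.m * R + 1 := by rw [hC.stride, hN]; rfl
  have eN : N.n = N₀.n := by rw [hN]; rfl
  have eM : N.m = N₀.m := by rw [hN]; rfl
  refine (wp_for_const (fun i τ => Seeded N R S h J i 0 τ) N.m (160 + R * 180) (by omega) hB1
    (by decide) ?_ ?_ ?_).mono ?_
  · intro i τ _ hF _ _
    rw [eM]
    exact (hF.reg 1 (by decide)).trans hσ.r1
  · constructor
    · intro d hd y
      simp only [evalRules, h0 d hd]
      constructor
      · rintro ⟨a, ha, _⟩; omega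
      · rintro ⟨e, ℓ, h, _⟩; omega
    · intro d hd y w
      simp only [evalRules, h0 d hd]
      constructor
      · rintro ⟨a, ha, _⟩; omega
      · rintro ⟨e, ℓ, h, _⟩; omega
    · simp only [evalRules]
      rw [Finset.sum_eq_zero fun x hx => (h0 x (Finset.mem_range.1 hx)).2,
        Finset.sum_eq_zero fun x hx => (h0 x (Finset.mem_range.1 hx)).1]
      simp
  · intro i τ hi hF hri H
    rw [eM] at hi
    have hτ : Holds N₀ Λ R S τ := hσ.frame hF (by decide) (by decide)
    have t8 := hF.arr 8 (by decide)
    have t21 : τ.reg 21 = g := (hF.reg 21 (by decide)).trans r21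
    have t22 : τ.reg 22 = h := (hF.reg 22 (by decide)).trans r22
    obtain ⟨hu, ht⟩ := hC.edge i hi
    have hwM := hC.wt i hi
    have hdM := hC.dist _ hu
    have hpn := hC.pos _ hu
    have hw' := Nat.div_le_self (Λ * N₀.wt i) g
    have hd' := Nat.div_le_self (Λ * N₀.dist (N₀.tail i)) g
    have huR : N₀.tail i * R ≤ N₀.n * R := Nat.mul_le_mul_right _ hu.le
    have htR : N₀.head i * R ≤ N₀.n * R := Nat.mul_le_mul_right _ ht.le
    have eW : N.wt i = Λ * N₀.wt i / g + 1 := by rw [hN]; rfl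
    have eD : N.dist (N₀.tail i) = Λ * N₀.dist (N₀.tail i) / g + 1 := by rw [hN]; rfl
    have eH : N.head i = N₀.head i := by rw [hN]; rfl
    have eT : N.tail i = N₀.tail i := by rw [hN]; rfl
    have eP : N.pos (N₀.tail i) = N₀.pos (N₀.tail i) := by rw [hN]; rfl
    refine wp_seq (wp_assign_eq (v := N₀.tail i) ?_ (wp_seq
      (wp_assign_eq (v := N.wt i) ?_ (wp_seq
      (wp_assign_eq (v := N.pos (N.tail i)) ?_ (wp_seq
      (wp_assign_eq (v := N.dist (N.tail i) + N.wt i) ?_ (wp_seq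
      (wp_assign_eq (v := N.tail i * R) ?_ (wp_seq
      (wp_assign_eq (v := N.head i * R) ?_ (wp_seq (wp_assign_eq (v := 0) ?_ ?_)))))))))))))
    case' refine_8 =>
      refine (seedRow_spec (N := N) (h := h) (J := J) (i := i) (v := N.dist (N.tail i) + N.wt i)
        ?_ (by omega) (by omega) hS ?_ ?_ hmono ?_ ?_ ?_ ?_ ?_ ?_ ?_ ?_ ?_ rfl ?_ ?_).mono ?_
      · exact H.congr rfl rfl rfl rfl rfl
      · rw [eN, eT, eP, eD, eW]
        omega
      · simp only [evalRules, t8]; exact h8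
      on_goal 12 =>
        rintro ρ T' _ ⟨H, hT⟩
        refine ⟨H.congr rfl rfl rfl rfl rfl, ?_⟩
        simp only [evalRules]
        omega
    all_goals
      simp only [evalRules, reduceIte, Nat.reduceEqDiff, hri, hτ.tail i hi, hτ.wt i hi,
        hτ.head i hi, hτ.r0, hτ.r10, hτ.r11, t22, eW, eD, eH, eP, eT, eN,
        hτ.r12, t21, hτ.r9, hτ.pos _ hu, hτ.dist _ hu, Nat.zero_mod, Nat.mod_eq_of_lt hB1,
        Nat.mod_eq_of_lt (show Λ * N₀.wt i < B by omega),
        Nat.mod_eq_of_lt (show Λ * N₀.dist (N₀.tail i) < B by omega),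
        Nat.mod_eq_of_lt (show Λ * N₀.wt i / g < B by omega),
        Nat.mod_eq_of_lt (show Λ * N₀.wt i / g + 1 < B by omega),
        Nat.mod_eq_of_lt (show Λ * N₀.dist (N₀.tail i) / g < B by omega),
        Nat.mod_eq_of_lt (show Λ * N₀.dist (N₀.tail i) / g + 1 < B by omega),
        Nat.mod_eq_of_lt (show Λ * N₀.dist (N₀.tail i) / g + 1 + (Λ * N₀.wt i / g + 1) < B by omega),
        Nat.mod_eq_of_lt (show N₀.tail i * R < B by omega),
        Nat.mod_eq_of_lt (show N₀.head i * R < B by omega)]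
  · rintro τ T' _ ⟨H, _, hT⟩
    refine ⟨H, ?_⟩
    simp only [evalRules] at hT
    nlinarith

end
/-! ### The bucket sweep -/

/-- Label `d` for `y` has been taken into account, or waits in a bucket from position `i` of
bucket `p` on. -/
def Oblig (S p i : ℕ) (st cnt cell : ℕ → ℕ) (y d : ℕ) : Prop :=
  (st y ≠ 0 ∧ st y ≤ d + 1) ∨
    ∃ j < cnt d, cell (d * S + j) = y ∧ (p < d ∨ d = p ∧ i ≤ j)

/-- The invariant of the sweep at position `i` of bucket `p`: the arcs in `ex` have not been
followed yet, and `extra` insertions are still allowed for. -/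
structure Swept (Z S : ℕ) (I : ℕ → ℕ → Prop) (ca ah aw : ℕ → ℕ) (p i : ℕ)
    (ex : ℕ → ℕ → Prop) (extra : ℕ) (st cnt cell : ℕ → ℕ) : Prop where
  label : ∀ y < Z, st y ≤ p + 1
  range : ∀ d < Z, ∀ j < cnt d, cell (d * S + j) < Z
  sound : ∀ G : ℕ → ℕ → Prop, (∀ d < Z, ∀ y, I d y → G y d) →
    (∀ x < Z, ∀ k < ca x, ∀ e, G x e → G (ah (x * S + k)) (e + aw (x * S + k))) →
    (∀ d < Z, ∀ j < cnt d, G (cell (d * S + j)) d) ∧ ∀ y < Z, st y ≠ 0 → G y (st y - 1)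
  init : ∀ d < Z, ∀ y, I d y → Oblig S p i st cnt cell y d
  arcs : ∀ x < Z, ∀ k < ca x, ¬ ex x k → st x ≠ 0 → st x + aw (x * S + k) ≤ Z →
    Oblig S p i st cnt cell (ah (x * S + k)) (st x - 1 + aw (x * S + k))
  count : ∑ d ∈ Finset.range Z, cnt d +
    ∑ x ∈ Finset.range Z, (if st x = 0 then ca x else 0) + extra < S

section
variable {Z S : ℕ} {I : ℕ → ℕ → Prop} {ca ah aw : ℕ → ℕ} {p i extra : ℕ} {ex : ℕ → ℕ → Prop}
  {st cnt cell : ℕ → ℕ}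

theorem Swept.cnt_lt (H : Swept Z S I ca ah aw p i ex extra st cnt cell) {d : ℕ} (hd : d < Z) :
    cnt d + extra < S := by
  have := H.count
  have := Finset.single_le_sum (f := cnt) (fun _ _ => Nat.zero_le _) (Finset.mem_range.2 hd)
  omega

/-- Buckets are opened in increasing order, so a node that is met again already has a label that is
at least as good; the entry in the bucket is then fulfilled. -/
theorem Swept.skip (H : Swept Z S I ca ah aw p i ex extra st cnt cell) {y : ℕ} (hp : p < Z)
    (hi : i < cnt p) (hy : cell (p * S + i) = y) (h0 : st y ≠ 0) :
    Swept Z S I ca ah aw p (i + 1) ex extra st cnt cell := by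
  have hyZ : y < Z := hy ▸ H.range p hp i hi
  have key : ∀ y' d, Oblig S p i st cnt cell y' d → Oblig S p (i + 1) st cnt cell y' d := by
    rintro y' d (h | ⟨j, hj, hc, h⟩)
    · exact .inl h
    · by_cases hc' : d = p ∧ j = i
      · obtain ⟨rfl, rfl⟩ := hc'
        have := H.label y hyZ
        rw [hy] at hc
        exact .inl (hc ▸ ⟨h0, this⟩)
      · exact .inr ⟨j, hj, hc, by omega⟩
  exact ⟨H.label, H.range, H.sound, fun d hd y h => key _ _ (H.init d hd y h),
    fun x hx k hk h1 h2 h3 => key _ _ (H.arcs x hx k hk h1 h2 h3), H.count⟩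

theorem sum_unsettled (ca st : ℕ → ℕ) {y v : ℕ} (hy : y < Z) (h0 : st y = 0) (hv : v ≠ 0) :
    ∑ x ∈ Finset.range Z, (if Function.update st y v x = 0 then ca x else 0) + ca y =
      ∑ x ∈ Finset.range Z, (if st x = 0 then ca x else 0) := by
  have h := sum_update_add (fun x => if st x = 0 then ca x else 0) hy 0
  simp only [h0, if_true] at h
  rw [add_zero] at h
  rw [← h]
  congr 1
  refine Finset.sum_congr rfl fun x _ => ?_
  by_cases hx : x = y
  · subst hx; simp [hv]
  · simp [hx]

/-- The arcs of `y` become exempt until they are followed, and their number moves from the sum over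
unsettled nodes to the allowance `ca y` for insertions. The bound on the bucket sizes is preserved.
-/
theorem Swept.settle (H : Swept Z S I ca ah aw p i (fun _ _ => False) 0 st cnt cell) {y : ℕ}
    (hp : p < Z) (hi : i < cnt p) (hy : cell (p * S + i) = y) (h0 : st y = 0) :
    Swept Z S I ca ah aw p (i + 1) (fun x _ => x = y) (ca y)
      (Function.update st y (p + 1)) cnt cell := by
  have hyZ : y < Z := hy ▸ H.range p hp i hi
  have key : ∀ y' d, Oblig S p i st cnt cell y' d →
      Oblig S p (i + 1) (Function.update st y (p + 1)) cnt cell y' d := by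
    rintro y' d (h | ⟨j, hj, hc, h⟩)
    · have : y' ≠ y := by rintro rfl; exact h.1 h0
      exact .inl (by rwa [Function.update_of_ne this])
    · by_cases hc' : d = p ∧ j = i
      · obtain ⟨rfl, rfl⟩ := hc'
        rw [hy] at hc
        exact .inl (by rw [← hc, Function.update_self]; omega)
      · exact .inr ⟨j, hj, hc, by omega⟩
  constructor
  · intro y' hy'
    by_cases h : y' = y
    · rw [h, Function.update_self]
    · rw [Function.update_of_ne h]; exact H.label y' hy'
  · exact H.range
  · intro G h1 h2
    obtain ⟨h3, h4⟩ := H.sound G h1 h2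
    refine ⟨h3, fun y' hy' h => ?_⟩
    by_cases hyy : y' = y
    · subst hyy
      rw [Function.update_self]
      exact hy ▸ h3 p hp i hi
    · rw [Function.update_of_ne hyy] at h ⊢
      exact h4 y' hy' h
  · exact fun d hd y h => key _ _ (H.init d hd y h)
  · intro x hx k hk h1 h2 h3
    rw [Function.update_of_ne h1] at h2 h3 ⊢
    exact key _ _ (H.arcs x hx k hk (fun h => h) h2 h3)
  · have := H.count
    have := sum_unsettled (v := p + 1) ca st hyZ h0 (by omega)
    omega

/-- Following one arc of the vertex settled last. -/
theorem Swept.follow {y k a : ℕ}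
    (H : Swept Z S I ca ah aw p i (fun x k' => x = y ∧ k ≤ k') (a + 1) st cnt cell)
    (hy : y < Z) (hk : k < ca y) (hst : st y = p + 1) (hw : 1 ≤ aw (y * S + k))
    (hah : ah (y * S + k) < Z) {cnt' cell' : ℕ → ℕ}
    (hc : cnt' = if p + aw (y * S + k) < Z then
      Function.update cnt (p + aw (y * S + k)) (cnt (p + aw (y * S + k)) + 1) else cnt)
    (hl : cell' = if p + aw (y * S + k) < Z then Function.update cell
      ((p + aw (y * S + k)) * S + cnt (p + aw (y * S + k))) (ah (y * S + k)) else cell) :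
    Swept Z S I ca ah aw p i (fun x k' => x = y ∧ k + 1 ≤ k') a st cnt' cell' := by
  obtain ⟨w, hw'⟩ : ∃ w, w = aw (y * S + k) := ⟨_, rfl⟩
  rw [← hw'] at hw hc hl
  by_cases hd : p + w < Z
  · rw [if_pos hd] at hc hl
    have hcS := H.cnt_lt hd
    have old : ∀ d j, d < Z → j < cnt d → cell' (d * S + j) = cell (d * S + j) := by
      intro d j hdZ hj
      have := H.cnt_lt hdZ
      rw [hl, update_push cell _ (by omega) (by omega)]
      rintro rfl
      omega
    have hmono : ∀ d, cnt d ≤ cnt' d := by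
      intro d
      by_cases h : d = p + w
      · subst h; rw [hc, Function.update_self]; omega
      · rw [hc, Function.update_of_ne h]
    have new : cell' ((p + w) * S + cnt (p + w)) = ah (y * S + k) := by
      rw [hl, Function.update_self]
    have newlt : cnt (p + w) < cnt' (p + w) := by rw [hc, Function.update_self]; omega
    have split : ∀ d j, j < cnt' d → j < cnt d ∨ d = p + w ∧ j = cnt (p + w) := by
      intro d j hj
      by_cases h : d = p + w
      · subst h; rw [hc, Function.update_self] at hj; omega
      · rw [hc, Function.update_of_ne h] at hj; exact .inl hj
    have key : ∀ y' d, d < Z → Oblig S p i st cnt cell y' d → Oblig S p i st cnt' cell' y' d := by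
      rintro y' d hdZ (h | ⟨j, hj, hcj, h⟩)
      · exact .inl h
      · exact .inr ⟨j, hj.trans_le (hmono d), (old d j hdZ hj).trans hcj, h⟩
    constructor
    · exact H.label
    · intro d hdZ j hj
      rcases split d j hj with h | ⟨rfl, rfl⟩
      · rw [old d j hdZ h]; exact H.range d hdZ j h
      · rw [new]; exact hah
    · intro G h1 h2
      obtain ⟨h3, h4⟩ := H.sound G h1 h2
      refine ⟨fun d hdZ j hj => ?_, h4⟩
      rcases split d j hj with h | ⟨rfl, rfl⟩
      · rw [old d j hdZ h]; exact h3 d hdZ j h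
      · have h5 := h2 y hy k hk _ (h4 y hy (by omega))
        rw [hst, Nat.add_sub_cancel, ← hw'] at h5
        rw [new]; exact h5
    · exact fun d hdZ y h => key _ _ hdZ (H.init d hdZ y h)
    · intro x hx k' hk' h1 h2 h3
      by_cases h : x = y ∧ k' = k
      · obtain ⟨rfl, rfl⟩ := h
        rw [hst, Nat.add_sub_cancel, ← hw']
        -- The weight is positive, so the new cell lies in a later bucket and is still to be
        -- visited.
        exact .inr ⟨_, newlt, new, by omega⟩
      · exact key _ _ (by omega) (H.arcs x hx k' hk' (by omega) h2 h3)
    · have := H.count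
      have := sum_update_add cnt hd (cnt (p + w) + 1)
      rw [hc]
      omega
  -- Past the last bucket nothing is stored; the invariant makes no demand on such an arc.
  · rw [if_neg hd] at hc hl
    subst hc hl
    refine ⟨H.label, H.range, H.sound, H.init, fun x hx k' hk' h1 h2 h3 => ?_, ?_⟩
    · by_cases h : x = y ∧ k' = k
      · obtain ⟨rfl, rfl⟩ := h
        rw [← hw'] at h3
        omega
      · exact H.arcs x hx k' hk' (by omega) h2 h3
    · have := H.count
      omega

/-- After the last position of bucket `p`, everything still pending lies in later buckets, so
resetting the counter loses nothing. -/
theorem Swept.next (H : Swept Z S I ca ah aw p (cnt p) (fun _ _ => False) 0 st cnt cell) :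
    Swept Z S I ca ah aw (p + 1) 0 (fun _ _ => False) 0 st (Function.update cnt p 0) cell := by
  have key : ∀ y d, Oblig S p (cnt p) st cnt cell y d →
      Oblig S (p + 1) 0 st (Function.update cnt p 0) cell y d := by
    rintro y d (h | ⟨j, hj, hc, h⟩)
    · exact .inl h
    · have : d ≠ p := by rintro rfl; omega
      exact .inr ⟨j, by rwa [Function.update_of_ne this], hc, by omega⟩
  have hlt : ∀ d j, j < Function.update cnt p 0 d → j < cnt d := by
    intro d j hj
    by_cases h : d = p
    · subst h; rw [Function.update_self] at hj; omega
    · rwa [Function.update_of_ne h] at hj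
  constructor
  · exact fun y hy => (H.label y hy).trans (by omega)
  · exact fun d hd j hj => H.range d hd j (hlt d j hj)
  · intro G h1 h2
    obtain ⟨h3, h4⟩ := H.sound G h1 h2
    exact ⟨fun d hd j hj => h3 d hd j (hlt d j hj), h4⟩
  · exact fun d hd y h => key _ _ (H.init d hd y h)
  · exact fun x hx k hk h1 h2 h3 => key _ _ (H.arcs x hx k hk h1 h2 h3)
  · have := H.count
    have : ∑ d ∈ Finset.range Z, Function.update cnt p 0 d ≤ ∑ d ∈ Finset.range Z, cnt d := by
      refine Finset.sum_le_sum fun d _ => ?_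
      by_cases h : d = p
      · subst h; simp
      · rw [Function.update_of_ne h]
    omega

/-- Follows arc number register `45` of the node in register `44`. -/
def followArc : Cmd :=
  .assign 46 (𝐫 44 * 𝐫 10 + 𝐫 45) ;; .assign 38 (𝐥 10 (𝐫 46)) ;;
  .assign 41 (𝐫 42 + 𝐥 11 (𝐫 46)) ;; pushBucket

/-- Handles position register `43` of bucket register `42`. -/
def visit : Cmd :=
  .assign 44 (𝐥 13 (𝐫 42 * 𝐫 10 + 𝐫 43)) ;;
  .ite (𝐥 14 (𝐫 44)) .skip
    (.store 14 (𝐫 44) (𝐫 42 + 𝐜 1) ;; .for 45 (𝐥 9 (𝐫 44)) followArc)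

/-- Dial's algorithm: settles the nodes in the order of their distances. -/
def sweep : Cmd :=
  .for 42 (𝐫 11) (.for 43 (𝐥 12 (𝐫 42)) visit ;; .store 12 (𝐫 42) (𝐜 0))

/-- What the sweep may assume about the stored arcs. -/
structure ArcData (B Z S M : ℕ) (ca ah aw : ℕ → ℕ) : Prop where
  big : Z * S + S + Z + M + 2 < B
  range : ∀ x < Z, ∀ k < ca x, ah (x * S + k) < Z
  wt : ∀ x < Z, ∀ k < ca x, 1 ≤ aw (x * S + k) ∧ aw (x * S + k) ≤ M
  lt : ∀ x < Z, ca x < S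

/-- The constants and the arcs in the memory. -/
structure ArcHolds (Z S : ℕ) (ca ah aw : ℕ → ℕ) (σ : State) : Prop where
  r10 : σ.reg 10 = S
  r11 : σ.reg 11 = Z
  a9 : σ.arr 9 = ca
  a10 : σ.arr 10 = ah
  a11 : σ.arr 11 = aw

theorem ArcHolds.frame {σ τ : State} {c : Cmd} (h : ArcHolds Z S ca ah aw σ)
    (hF : Frame c σ τ) (hr : ∀ r ∈ [10, 11], r ∉ c.regs)
    (ha : ∀ a ∈ [9, 10, 11], a ∉ c.arrs) : ArcHolds Z S ca ah aw τ := by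
  constructor
  · rw [hF.reg 10 (hr 10 (by simp)), h.r10]
  · rw [hF.reg 11 (hr 11 (by simp)), h.r11]
  · rw [hF.arr 9 (ha 9 (by simp)), h.a9]
  · rw [hF.arr 10 (ha 10 (by simp)), h.a10]
  · rw [hF.arr 11 (ha 11 (by simp)), h.a11]

variable {B M : ℕ}

theorem followArc_spec {σ : State} (hA : ArcData B Z S M ca ah aw) (hσ : ArcHolds Z S ca ah aw σ)
    {y k a : ℕ} (hp : p < Z) (hy : y < Z) (hk : k < ca y)
    (H : Swept Z S I ca ah aw p i (fun x k' => x = y ∧ k ≤ k') (a + 1)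
      (σ.arr 14) (σ.arr 12) (σ.arr 13))
    (hst : σ.arr 14 y = p + 1) (r42 : σ.reg 42 = p) (r44 : σ.reg 44 = y) (r45 : σ.reg 45 = k) :
    Wp B followArc σ fun τ T => T ≤ 60 ∧
      Swept Z S I ca ah aw p i (fun x k' => x = y ∧ k + 1 ≤ k') a
        (τ.arr 14) (τ.arr 12) (τ.arr 13) ∧
      τ.arr 14 = σ.arr 14 ∧ τ.arr 12 p = σ.arr 12 p ∧
      ∑ d ∈ Finset.range Z, τ.arr 12 d ≤ ∑ d ∈ Finset.range Z, σ.arr 12 d + 1 := by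
  have hbig := hA.big
  have hB1 : 1 < B := by omega
  obtain ⟨hw1, hwM⟩ := hA.wt y hy k hk
  have hkS := hA.lt y hy
  have hcell := flat_lt hy (hk.trans hkS)
  refine wp_seq (wp_assign_eq (v := y * S + k) ?_ (wp_seq
    (wp_assign_eq (v := ah (y * S + k)) ?_ (wp_seq
    (wp_assign_eq (v := p + aw (y * S + k)) ?_ ?_)))))
  · simp only [evalRules, r44, r45, hσ.r10, Nat.mod_eq_of_lt (show y * S < B by omega)]
    exact Nat.mod_eq_of_lt (by omega)
  · simp only [evalRules, reduceIte, hσ.a10]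
  · simp only [evalRules, reduceIte, Nat.reduceEqDiff, hσ.a11, r42]
    exact Nat.mod_eq_of_lt (by omega)
  refine (pushBucket_spec (N := Z) (S := S) (d := p + aw (y * S + k)) (y := ah (y * S + k))
    (by omega) ?_ ?_ ?_ ?_ ?_).mono ?_
  · simp only [evalRules, reduceIte, Nat.reduceEqDiff, hσ.r10]
  · simp only [evalRules, reduceIte, Nat.reduceEqDiff, hσ.r11]
  · simp only [evalRules, reduceIte, Nat.reduceEqDiff]
  · simp only [evalRules, reduceIte, Nat.reduceEqDiff]
  · intro hd
    have := H.cnt_lt hd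
    simp only [evalRules]
    omega
  · rintro τ T hF ⟨hT, h12, h13⟩
    have h14 := hF.arr 14 (by decide)
    simp only [evalRules] at h12 h13 h14
    have hle : ∑ d ∈ Finset.range Z, τ.arr 12 d ≤ ∑ d ∈ Finset.range Z, σ.arr 12 d + 1 := by
      rw [h12]
      split_ifs with hd
      · have := sum_update_add (σ.arr 12) hd (σ.arr 12 (p + aw (y * S + k)) + 1)
        omega
      · omega
    refine ⟨?_, ?_, h14, ?_, hle⟩
    · simp only [evalRules]; omega
    · rw [h14]
      exact H.follow hy hk hst hw1 (hA.range y hy k hk) h12 h13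
    · rw [h12]
      split_ifs
      · rw [Function.update_of_ne (by omega)]
      · rfl

/-- Amortised cost: `200` for each label in a bucket and `300` for each arc of an unsettled node.
Settling a node releases its arcs; following one costs at most `70` steps including the loop and
deposits `200` for the label inserted. Bucket `p` does not grow meanwhile, so the scan over it has a
fixed length. -/
theorem visit_spec {σ : State} (hA : ArcData B Z S M ca ah aw) (hσ : ArcHolds Z S ca ah aw σ)
    (hp : p < Z) (hi : i < σ.arr 12 p)
    (H : Swept Z S I ca ah aw p i (fun _ _ => False) 0 (σ.arr 14) (σ.arr 12) (σ.arr 13))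
    (r42 : σ.reg 42 = p) (r43 : σ.reg 43 = i) :
    Wp B visit σ fun τ T =>
      Swept Z S I ca ah aw p (i + 1) (fun _ _ => False) 0 (τ.arr 14) (τ.arr 12) (τ.arr 13) ∧
      τ.arr 12 p = σ.arr 12 p ∧
      T + (200 * (∑ d ∈ Finset.range Z, τ.arr 12 d) +
        300 * ∑ x ∈ Finset.range Z, if τ.arr 14 x = 0 then ca x else 0) ≤
      200 * (∑ d ∈ Finset.range Z, σ.arr 12 d) +
        300 * (∑ x ∈ Finset.range Z, if σ.arr 14 x = 0 then ca x else 0) + 60 := by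
  have hbig := hA.big
  have hB1 : 1 < B := by omega
  have hpS := H.cnt_lt hp
  have hcell := flat_lt hp (show i < S by omega)
  obtain ⟨y, hy⟩ : ∃ y, σ.arr 13 (p * S + i) = y := ⟨_, rfl⟩
  have hyZ : y < Z := hy ▸ H.range p hp i hi
  refine wp_seq (wp_assign_eq (v := y) ?_ (wp_ite (fun hg => ?_) (fun hg => ?_)))
  · simp only [evalRules, r42, r43, hσ.r10, Nat.mod_eq_of_lt (show p * S < B by omega),
      Nat.mod_eq_of_lt (show p * S + i < B by omega), hy]
  all_goals simp only [evalRules, reduceIte, ne_eq] at hg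
  · refine wp_skip ⟨H.skip hp hi hy hg, rfl, ?_⟩
    simp only [evalRules]
    omega
  · have hsum := sum_unsettled (v := p + 1) ca (σ.arr 14) hyZ hg (by omega)
    have H0 := H.settle hp hi hy hg
    have hcaS := hA.lt y hyZ
    refine wp_seq (wp_store ?_)
    simp only [evalRules, reduceIte, Nat.reduceEqDiff, r42, Nat.mod_eq_of_lt hB1,
      Nat.mod_eq_of_lt (show p + 1 < B by omega)]
    refine (wp_for_const (fun k τ =>
      Swept Z S I ca ah aw p (i + 1) (fun x k' => x = y ∧ k ≤ k') (ca y - k)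
        (τ.arr 14) (τ.arr 12) (τ.arr 13) ∧
      τ.arr 14 = Function.update (σ.arr 14) y (p + 1) ∧ τ.arr 12 p = σ.arr 12 p ∧
      ∑ d ∈ Finset.range Z, τ.arr 12 d ≤ ∑ d ∈ Finset.range Z, σ.arr 12 d + k)
      (ca y) 60 (by omega) hB1 (by decide) ?_ ?_ ?_).mono ?_
    · intro k τ _ hF _ _
      have h9 := hF.arr 9 (by decide)
      have h44 := hF.reg 44 (by decide)
      simp only [evalRules, reduceIte, Nat.reduceEqDiff] at h9 h44
      simp only [evalRules, h9, h44, hσ.a9]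
    · simp only [evalRules, reduceIte, Nat.reduceEqDiff, Nat.zero_le, and_true, Nat.sub_zero]
      exact ⟨H0, trivial, trivial, by omega⟩
    · rintro k τ hk hF hr ⟨H1, h14, h12, hle⟩
      have h42 := hF.reg 42 (by decide)
      have h44 := hF.reg 44 (by decide)
      simp only [evalRules, reduceIte, Nat.reduceEqDiff] at h42 h44
      have hτ : ArcHolds Z S ca ah aw τ :=
        ArcHolds.frame (c := .for 45 (𝐥 9 (𝐫 44)) followArc)
          (σ := (σ.setReg 44 y).setArr 14 y (p + 1)) ⟨by simpa [evalRules] using hσ.r10,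
            by simpa [evalRules] using hσ.r11, by simpa [evalRules] using hσ.a9,
            by simpa [evalRules] using hσ.a10, by simpa [evalRules] using hσ.a11⟩ hF
            (by decide) (by decide)
      have e : ca y - k = (ca y - (k + 1)) + 1 := by omega
      rw [e] at H1
      refine (followArc_spec hA hτ hp hyZ hk H1 (by rw [h14, Function.update_self])
        (h42.trans r42) h44 hr).mono ?_
      rintro ρ T _ ⟨hT, H2, g14, g12, gle⟩
      exact ⟨⟨H2, g14.trans h14, g12.trans h12, by simp only [evalRules]; omega⟩, hT⟩
    · rintro τ T hF ⟨⟨H1, h14, h12, hle⟩, _, hT⟩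
      refine ⟨?_, h12, ?_⟩
      -- All arcs of `y` have been followed, so the set of exempt arcs is empty again.
      · rw [Nat.sub_self] at H1
        exact ⟨H1.label, H1.range, H1.sound, H1.init,
          fun x hx k hk _ => H1.arcs x hx k hk (by rintro ⟨rfl, h⟩; omega), H1.count⟩
      · rw [h14]
        simp only [evalRules] at hT ⊢
        omega

/-- `Z` bounds both the node numbers and the labels. Emptying a bucket gives back `200` per label,
which pays for the visits; the initial potential is at most `300 * S`. -/
theorem sweep_spec {σ : State} (hA : ArcData B Z S M ca ah aw) (hσ : ArcHolds Z S ca ah aw σ)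
    (hst : ∀ x < Z, σ.arr 14 x = 0)
    (hI : ∀ d < Z, ∀ j < σ.arr 12 d, σ.arr 13 (d * S + j) < Z)
    (hcount : ∑ d ∈ Finset.range Z, σ.arr 12 d + ∑ x ∈ Finset.range Z, ca x < S) :
    Wp B sweep σ fun τ T => ∃ cnt cell,
      Swept Z S (fun d y => ∃ j < σ.arr 12 d, σ.arr 13 (d * S + j) = y) ca ah aw Z 0
        (fun _ _ => False) 0 (τ.arr 14) cnt cell ∧ T ≤ 400 * (S + Z) := by
  have hbig := hA.big
  have hB1 : 1 < B := by omega
  have hU : ∑ x ∈ Finset.range Z, (if σ.arr 14 x = 0 then ca x else 0) =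
      ∑ x ∈ Finset.range Z, ca x :=
    Finset.sum_congr rfl fun x hx => if_pos (hst x (Finset.mem_range.1 hx))
  refine (wp_for (fun d τ b =>
      Swept Z S (fun d y => ∃ j < σ.arr 12 d, σ.arr 13 (d * S + j) = y) ca ah aw d 0
        (fun _ _ => False) 0 (τ.arr 14) (τ.arr 12) (τ.arr 13) ∧
      b = 200 * (∑ d ∈ Finset.range Z, τ.arr 12 d) +
        300 * ∑ x ∈ Finset.range Z, if τ.arr 14 x = 0 then ca x else 0) Z 20
    (b := 200 * (∑ d ∈ Finset.range Z, σ.arr 12 d) + 300 * ∑ x ∈ Finset.range Z, ca x)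
    (by omega) hB1 (by decide) ?_ ?_ ?_).mono ?_
  · intro i τ b _ hF _ _
    exact (hF.reg 11 (by decide)).trans hσ.r11
  · simp only [evalRules, hU, and_true]
    refine ⟨fun y hy => by rw [hst y hy]; omega, hI, fun G h1 _ =>
      ⟨fun d hd j hj => h1 d hd _ ⟨j, hj, rfl⟩, fun y hy h => absurd (hst y hy) h⟩, ?_,
      fun x hx k hk _ h => absurd (hst x hx) h, by rw [hU]; omega⟩
    rintro d hd y ⟨j, hj, hc⟩
    exact .inr ⟨j, hj, hc, by omega⟩
  · rintro d τ b hd hF hr ⟨H, rfl⟩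
    have hτ : ArcHolds Z S ca ah aw τ := hσ.frame hF (by decide) (by decide)
    have hcS := H.cnt_lt hd
    refine wp_seq ((wp_for (fun i ρ b =>
      Swept Z S (fun d y => ∃ j < σ.arr 12 d, σ.arr 13 (d * S + j) = y) ca ah aw d i
        (fun _ _ => False) 0 (ρ.arr 14) (ρ.arr 12) (ρ.arr 13) ∧ ρ.arr 12 d = τ.arr 12 d ∧
      b = 200 * (∑ d ∈ Finset.range Z, ρ.arr 12 d) +
        300 * ∑ x ∈ Finset.range Z, if ρ.arr 14 x = 0 then ca x else 0) (τ.arr 12 d) 60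
      (b := 200 * (∑ d ∈ Finset.range Z, τ.arr 12 d) +
        300 * ∑ x ∈ Finset.range Z, if τ.arr 14 x = 0 then ca x else 0) (by omega) hB1 (by decide) ?_ ?_ ?_).mono ?_)
    · rintro i ρ b _ hF' _ ⟨_, h12, _⟩
      have h42 := (hF'.reg 42 (by decide)).trans hr
      simp only [evalRules, h42, h12]
    · simp only [evalRules, and_true]
      exact H
    · rintro i ρ b hi hF' hr' ⟨H', h12, rfl⟩
      refine (visit_spec hA (hτ.frame hF' (by decide) (by decide)) hd (by omega) H'
        ((hF'.reg 42 (by decide)).trans hr) hr').mono ?_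
      rintro π T _ ⟨H'', g12, hT⟩
      exact ⟨_, ⟨H'', g12.trans h12, rfl⟩, by simp only [evalRules] at hT ⊢; exact hT⟩
    · rintro ρ T hF' ⟨b', ⟨H', h12, rfl⟩, _, hT⟩
      have h42 := (hF'.reg 42 (by decide)).trans hr
      refine wp_store ?_
      simp only [evalRules, h42, Nat.zero_mod, reduceIte, Nat.reduceEqDiff] at hT ⊢
      refine ⟨_, ⟨?_, rfl⟩, ?_⟩
      · rw [← h12] at H'
        exact H'.next
      · have := sum_update_add (ρ.arr 12) hd 0
        omega
  · rintro τ T hF ⟨b', ⟨H, rfl⟩, _, hT⟩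
    refine ⟨_, _, H, ?_⟩
    simp only [evalRules] at hT
    omega

end
/-! ### A refinement step -/

section
variable {B : ℕ} {N : Net} {Λ g R T S M h E : ℕ} {J : ℕ → ℕ}

/-- At the end `p` has passed every bucket, so no label can still be waiting and every demand of the
invariant has become an actual bound on a label. -/
theorem Seeded.settled {σ : State} (hN : ∀ e < N.m, N.tail e < N.n ∧ N.head e < N.n)
    (hS : Seeded N R S h J N.m 0 σ) {st cnt cell : ℕ → ℕ}
    (H : Swept (N.n * R) S (fun d y => ∃ j < σ.arr 12 d, σ.arr 13 (d * S + j) = y)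
      (σ.arr 9) (σ.arr 10) (σ.arr 11) (N.n * R) 0 (fun _ _ => False) 0 st cnt cell) :
    N.Settled R h J st := by
  have hall : ∀ e ℓ, (e < N.m ∧ ℓ < R ∨ e = N.m ∧ ℓ < 0) ↔ e < N.m ∧ ℓ < R := by
    intro e ℓ; omega
  have hb : ∀ d < N.n * R, ∀ y, (∃ a < σ.arr 12 d, σ.arr 13 (d * S + a) = y) ↔
      N.Init R h J y d := by
    intro d hd y
    rw [hS.buckets d hd y, init_iff]
    simp only [hall, and_assoc]
  have ha : ∀ x < N.n * R, ∀ y w, (∃ a < σ.arr 9 x, σ.arr 10 (x * S + a) = y ∧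
      σ.arr 11 (x * S + a) = w) ↔ N.Arc R J x y w := by
    intro x hx y w
    rw [hS.arcs x hx y w, arc_iff]
    simp only [hall, and_assoc]
  constructor
  · intro y d hi hd
    rcases H.init d hd y ((hb d hd y).2 hi) with h' | ⟨_, _, _, h'⟩
    · exact h'
    · omega
  · intro x y w hxy h0 hle
    have hx : x < N.n * R := by
      cases hxy with
      | mk e ℓ ℓ' he hℓ hp hptr heq => exact flat_lt (hN e he).1 hptr.1
    obtain ⟨k, hk, rfl, rfl⟩ := (ha x hx y w).2 hxy
    rcases H.arcs x hx k hk (fun h => h) h0 hle with ⟨h1, h2⟩ | ⟨_, _, _, h'⟩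
    · exact ⟨h1, by omega⟩
    · omega
  · intro G h1 h2 y hy h0
    refine (H.sound G (fun d hd y h' => h1 y d ((hb d hd y).1 h')) ?_).2 y hy h0
    intro x hx k hk e he
    exact h2 x _ _ e ((ha x hx _ _).1 ⟨k, hk, rfl, rfl⟩) he

/-- The `+ 1` in the scaled weights makes every arc weight positive, which the order of the sweep
depends on. -/
theorem Seeded.arcData {N₀ : Net} {σ : State} (hN : N = N₀.scale Λ g) (hC : Caps B N₀ Λ R T S M)
    (hS : Seeded N R S h J N.m 0 σ) :
    ArcData B (N.n * R) S (M + 1) (σ.arr 9) (σ.arr 10) (σ.arr 11) := by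
  have hbig := hC.big
  have hstride := hC.stride
  have eN : N.n = N₀.n := by rw [hN]; rfl
  have eM : N.m = N₀.m := by rw [hN]; rfl
  have key : ∀ x < N.n * R, ∀ k < σ.arr 9 x, ∃ e ℓ, e < N.m ∧ ℓ < R ∧
      σ.arr 10 (x * S + k) = N.head e * R + ℓ ∧ σ.arr 11 (x * S + k) = N.wt e := by
    intro x hx k hk
    obtain ⟨e, ℓ, h, h1, _, h2⟩ := (hS.arcs x hx _ _).1 ⟨k, hk, rfl, rfl⟩
    exact ⟨e, ℓ, by omega, by omega, h1, h2⟩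
  constructor
  · rw [eN]; omega
  · intro x hx k hk
    obtain ⟨e, ℓ, he, hℓ, h1, _⟩ := key x hx k hk
    rw [h1]
    have eH : N.head e = N₀.head e := by rw [hN]; rfl
    exact flat_lt (by rw [eH, eN]; exact (hC.edge e (eM ▸ he)).2) hℓ
  · intro x hx k hk
    obtain ⟨e, ℓ, he, hℓ, _, h1⟩ := key x hx k hk
    have eW : N.wt e = Λ * N₀.wt e / g + 1 := by rw [hN]; rfl
    rw [h1, eW]
    exact ⟨Nat.le_add_left _ _,
      Nat.add_le_add_right ((Nat.div_le_self _ g).trans (hC.wt e (eM ▸ he))) 1⟩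
  · intro x hx
    have h1 := hS.count
    have h3 := Finset.single_le_sum (f := fun d => σ.arr 9 d) (fun _ _ => Nat.zero_le _)
      (Finset.mem_range.2 hx)
    rw [eM] at h1
    omega

/-- Lowers the entries of the table for which the label found is small enough. -/
def applyStep : Cmd :=
  .for 30 (𝐫 0)
    (.assign 31 (𝐫 30 * 𝐫 9) ;; .assign 32 (𝐜 1) ;;
     .for 37 (𝐫 9)
      (.assign 38 (𝐫 31 + 𝐫 37) ;; .assign 33 (𝐥 14 (𝐫 38)) ;;
       .ite (𝐫 33) (.ite (Expr.lt (𝐫 32) (𝐫 33)) .skip (.store 8 (𝐫 38) (𝐥 8 (𝐫 38) - 𝐫 22)))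
        .skip ;;
       .assign 32 (𝐫 32 + 𝐫 0)))

/-- The table after a refinement step with the labels `st`. -/
def refined (n R h : ℕ) (J st : ℕ → ℕ) (t ℓ : ℕ) : ℕ :=
  if st (t * R + ℓ) ≠ 0 ∧ st (t * R + ℓ) ≤ ℓ * n + 1 then J (t * R + ℓ) - h else J (t * R + ℓ)

/-- The update can be done in place, since the new word in a cell depends only on the old word and
the label in the same cell. Register `32` runs through the thresholds `ℓ * n + 1`; the `+ 1` matches
the shift of the labels. -/
theorem applyStep_spec {σ : State} {n : ℕ} (hB : n * R + n + R + T + 1 < B)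
    (h0 : σ.reg 0 = n) (h9 : σ.reg 9 = R) (h22 : σ.reg 22 = h)
    (hT : ∀ t < n, ∀ ℓ < R, σ.arr 8 (t * R + ℓ) ≤ T) :
    Wp B applyStep σ fun τ T' => T' ≤ 100 * ((n + 1) * (R + 1)) ∧ ∀ t < n, ∀ ℓ < R,
      τ.arr 8 (t * R + ℓ) = refined n R h (σ.arr 8) (σ.arr 14) t ℓ := by
  have hB1 : 1 < B := by omega
  refine (wp_for_const (fun i τ => ∀ t < n, ∀ ℓ < R, τ.arr 8 (t * R + ℓ) =
      if t < i then refined n R h (σ.arr 8) (σ.arr 14) t ℓ else σ.arr 8 (t * R + ℓ))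
    n (20 + R * 50) (by omega) hB1 (by decide) ?_ ?_ ?_).mono ?_
  · intro i τ _ hF _ _
    exact (hF.reg 0 (by decide)).trans h0
  · simp [evalRules]
  · intro i τ hi hF hri H
    have f0 := (hF.reg 0 (by decide)).trans h0
    have f9 := (hF.reg 9 (by decide)).trans h9
    have f22 := (hF.reg 22 (by decide)).trans h22
    have f14 := hF.arr 14 (by decide)
    have hiR : i * R ≤ n * R := Nat.mul_le_mul_right _ hi.le
    refine wp_seq (wp_assign_eq (v := i * R) ?_ (wp_seq (wp_assign_eq (v := 1) ?_ ?_)))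
    · simp only [evalRules, hri, f9, Nat.mod_eq_of_lt (show i * R < B by omega)]
    · simp only [evalRules, Nat.mod_eq_of_lt hB1]
    refine (wp_for_const (fun k ρ => ρ.reg 32 = k * n + 1 ∧
        ∀ t < n, ∀ ℓ < R, ρ.arr 8 (t * R + ℓ) =
        if t < i ∨ t = i ∧ ℓ < k then refined n R h (σ.arr 8) (σ.arr 14) t ℓ
        else σ.arr 8 (t * R + ℓ))
      R 35 (by omega) hB1 (by decide) ?_ ?_ ?_).mono ?_
    · intro k ρ _ hF' _ _
      have := hF'.reg 9 (by decide)
      simp only [evalRules, Nat.reduceEqDiff, reduceIte] at this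
      exact this.trans f9
    · simp only [evalRules, Nat.reduceEqDiff, reduceIte]
      refine ⟨by omega, fun t ht ℓ hℓ => ?_⟩
      rw [H t ht ℓ hℓ]
      simp
    · rintro k ρ hk hF' hrk ⟨h32, H'⟩
      have g0 := hF'.reg 0 (by decide)
      have g22 := hF'.reg 22 (by decide)
      have g31 := hF'.reg 31 (by decide)
      have g14 := hF'.arr 14 (by decide)
      simp only [evalRules, Nat.reduceEqDiff, reduceIte, f0, f22, f14] at g0 g22 g31 g14
      have hx := flat_lt hi hk
      have hxB : i * R + k < B := by omega
      have hJ := hT i hi k hk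
      have hk1 : (k + 1) * n ≤ n * R := by
        rw [mul_comm]; exact Nat.mul_le_mul_left _ hk
      rw [Nat.add_mul, one_mul] at hk1
      have e8 := H' i hi k hk
      rw [if_neg (by omega)] at e8
      refine wp_seq (wp_assign_eq (v := i * R + k) ?_ (wp_seq
        (wp_assign_eq (v := σ.arr 14 (i * R + k)) ?_ (wp_seq (Wp.mono (Q := fun π T' => T' ≤ 20 ∧
          ∀ t < n, ∀ ℓ < R, π.arr 8 (t * R + ℓ) =
            if t < i ∨ t = i ∧ ℓ < k + 1 then refined n R h (σ.arr 8) (σ.arr 14) t ℓ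
            else σ.arr 8 (t * R + ℓ)) ?_ ?_)))))
      · simp only [evalRules, hrk, g31, Nat.mod_eq_of_lt hxB]
      · simp only [evalRules, reduceIte, g14]
      · have keep : refined n R h (σ.arr 8) (σ.arr 14) i k = σ.arr 8 (i * R + k) →
            ∀ t < n, ∀ ℓ < R, ρ.arr 8 (t * R + ℓ) =
            if t < i ∨ t = i ∧ ℓ < k + 1 then refined n R h (σ.arr 8) (σ.arr 14) t ℓ
            else σ.arr 8 (t * R + ℓ) := by
          intro hr t ht ℓ hℓ
          by_cases hc : t = i ∧ ℓ = k
          · obtain ⟨rfl, rfl⟩ := hc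
            rw [if_pos (by omega), hr, e8]
          · rw [H' t ht ℓ hℓ]
            exact if_congr (by omega) rfl rfl
        refine wp_ite (fun hg => wp_ite (fun hg' => ?_) (fun hg' => ?_)) (fun hg => ?_) <;>
          simp only [ne_eq, evalRules, Nat.reduceEqDiff, reduceIte] at hg
        · simp only [guardRules hB1, ne_eq, evalRules, Nat.reduceEqDiff, reduceIte, h32,
            not_le] at hg'
          refine wp_skip ⟨by simp only [evalRules]; omega, ?_⟩
          simp only [evalRules]
          refine keep ?_
          unfold refined
          rw [if_neg (by omega)]
        · simp only [guardRules hB1, evalRules, Nat.reduceEqDiff, reduceIte, h32] at hg'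
          refine wp_store ⟨by simp only [evalRules]; omega, fun t ht ℓ hℓ => ?_⟩
          simp only [evalRules, Nat.reduceEqDiff, reduceIte, g22, e8,
            Nat.mod_eq_of_lt (show σ.arr 8 (i * R + k) - h < B by omega)]
          by_cases hc : t = i ∧ ℓ = k
          · obtain ⟨rfl, rfl⟩ := hc
            rw [Function.update_self, if_pos (by omega)]
            unfold refined
            rw [if_pos ⟨hg, hg'⟩]
          · rw [Function.update_of_ne (fun h => hc (flat_inj hℓ hk h)), H' t ht ℓ hℓ]
            exact if_congr (by omega) rfl rfl
        · refine wp_skip ⟨by simp only [evalRules]; omega, ?_⟩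
          simp only [evalRules]
          refine keep ?_
          unfold refined
          rw [if_neg (by tauto)]
      · rintro π T' hF'' ⟨hT', H''⟩
        have k0 := hF''.reg 0 (by decide)
        have k32 := hF''.reg 32 (by decide)
        simp only [evalRules, Nat.reduceEqDiff, reduceIte, g0, h32] at k0 k32
        refine wp_assign ?_
        simp only [evalRules, Nat.reduceEqDiff, reduceIte, k0, k32,
          Nat.mod_eq_of_lt (show k * n + 1 + n < B by omega)]
        exact ⟨⟨by rw [Nat.add_mul]; omega, H''⟩, by omega⟩
    · rintro ρ T' _ ⟨⟨_, H'⟩, _, hT'⟩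
      simp only [evalRules] at hT' ⊢
      refine ⟨fun t ht ℓ hℓ => ?_, by omega⟩
      rw [H' t ht ℓ hℓ]
      exact if_congr (by omega) rfl rfl
  · rintro τ T' _ ⟨H, _, hT'⟩
    refine ⟨?_, fun t ht ℓ hℓ => ?_⟩
    · simp only [evalRules] at hT'
      nlinarith
    · rw [H t ht ℓ hℓ, if_pos ht]

/-- Halves the step of the time grid. -/
def refineStep : Cmd := resetStep ;; seed ;; sweep ;; applyStep

theorem refineStep_spec {N₀ : Net} {σ : State} (hN : N = N₀.scale Λ g)
    (hC : Caps B N₀ Λ R T S M) (hσ : Holds N₀ Λ R S σ) (hg : 0 < g) (hgB : g < B) (hh : h ≤ T)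
    (hT : 0 < T) (r21 : σ.reg 21 = g) (r22 : σ.reg 22 = h)
    (hJ : N.Table R T (2 * h) E (σ.arr 8)) :
    Wp B refineStep σ fun τ T' => N.Table R T h (E + N.n) (τ.arr 8) ∧
      T' ≤ 3000 * ((N.m + N.n + 1) * (R + 1)) := by
  have hbig := hC.big
  have hB1 : 1 < B := by omega
  have hstride := hC.stride
  have eN : N.n = N₀.n := by rw [hN]; rfl
  have eM : N.m = N₀.m := by rw [hN]; rfl
  have hE : ∀ e < N.m, N.tail e < N.n ∧ N.head e < N.n := by
    rw [hN]; exact hC.edge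
  refine wp_seq ((resetStep_spec (N := N.n * R) (by rw [eN]; omega)
    (by rw [hσ.r11, eN])).mono ?_)
  rintro τ₁ T₁ hF₁ ⟨hT₁, hz⟩
  refine wp_seq ((seed_spec (J := σ.arr 8) hN hC (hσ.frame hF₁ (by decide) (by decide)) hg hgB hh
    ((hF₁.reg 21 (by decide)).trans r21) ((hF₁.reg 22 (by decide)).trans r22)
    (fun x _ => by rw [hF₁.arr 8 (by decide)]) hJ.mono (fun x hx => (hz x hx).2)).mono ?_)
  rintro τ₂ T₂ hF₂ ⟨hS, hT₂⟩
  have hA := hS.arcData hN hC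
  have h14 := hF₂.arr 14 (by decide)
  refine wp_seq ((sweep_spec hA ⟨?_, ?_, rfl, rfl, rfl⟩ ?_ ?_ ?_).mono ?_)
  · exact ((hF₂.reg 10 (by decide)).trans (hF₁.reg 10 (by decide))).trans hσ.r10
  · rw [eN]
    exact ((hF₂.reg 11 (by decide)).trans (hF₁.reg 11 (by decide))).trans hσ.r11
  · intro x hx
    rw [h14]
    exact (hz x hx).1
  · intro d hd j hj
    obtain ⟨e, ℓ, h', hy, _⟩ := (hS.buckets d hd _).1 ⟨j, hj, rfl⟩
    rw [hy]
    exact flat_lt (hE e (by omega)).2 (by omega)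
  · have := hS.count
    rw [hstride, ← eM]
    omega
  rintro τ₃ T₃ hF₃ ⟨cnt, cell, H, hT₃⟩
  have hst := hS.settled hE H
  have h8 : τ₃.arr 8 = σ.arr 8 :=
    ((hF₃.arr 8 (by decide)).trans (hF₂.arr 8 (by decide))).trans (hF₁.arr 8 (by decide))
  have hr : ∀ r ∈ [0, 9, 22], τ₃.reg r = σ.reg r := by
    intro r hr
    rw [hF₃.reg r (by revert r; decide), hF₂.reg r (by revert r; decide),
      hF₁.reg r (by revert r; decide)]
  refine (applyStep_spec (n := N.n) (R := R) (h := h) (T := T) (by rw [eN]; omega)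
    ((hr 0 (by simp)).trans (hσ.r0.trans eN.symm)) ((hr 9 (by simp)).trans hσ.r9)
    ((hr 22 (by simp)).trans r22) (by rw [h8]; exact hJ.le)).mono ?_
  rintro τ₄ T₄ _ ⟨hT₄, h8'⟩
  rw [h8] at h8'
  refine ⟨hJ.step hE hT hst h8', ?_⟩
  rw [hstride, ← eM] at hT₃
  nlinarith

end
/-! ### All scales -/

/-- A loop that fills a segment of an array. -/
theorem wp_fill {B : ℕ} {σ : State} {r a : ℕ} {N base e : Expr} (b k : ℕ) (v : ℕ → ℕ) (hk : k < B)
    (hB : 1 < B) (hbk : b + k ≤ B)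
    (h : ∀ i τ, i ≤ k → Frame (.for r N (.store a (base + 𝐫 r) e)) σ τ → τ.reg r = i →
      N.eval B τ = k ∧ (i < k → base.eval B τ = b ∧ e.eval B τ = v i)) :
    Wp B (.for r N (.store a (base + 𝐫 r) e)) σ fun τ T =>
      (∀ x, τ.arr a x = if b ≤ x ∧ x < b + k then v (x - b) else σ.arr a x) ∧
      T ≤ (k + 1) * (N.cost + base.cost + e.cost + 16) := by
  refine (wp_for_const (fun i τ =>
      ∀ x, τ.arr a x = if b ≤ x ∧ x < b + i then v (x - b) else σ.arr a x) k
    (base.cost + e.cost + 3) hk hB (by simp [Cmd.regs]) (fun i τ hi hF hr _ => (h i τ hi hF hr).1)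
    ?_ ?_).mono ?_
  · intro x
    rw [if_neg (by omega)]
    rfl
  · intro i τ hi hF hr H
    obtain ⟨hb, hv⟩ := (h i τ hi.le hF hr).2 hi
    refine wp_store ⟨fun x => ?_, ?_⟩
    · simp only [evalRules, hb, hv, hr, reduceIte, Nat.mod_eq_of_lt (show b + i < B by omega)]
      by_cases hx : x = b + i
      · rw [hx, Function.update_self, if_pos (by omega), Nat.add_sub_cancel_left]
      · rw [Function.update_of_ne hx, H x]
        exact if_congr (by omega) rfl rfl
    · simp only [evalRules]
      omega
  · rintro τ T _ ⟨H, _, hT⟩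
    refine ⟨H, ?_⟩
    nlinarith

section
variable {B : ℕ} {N : Net} {Λ g R T S M D : ℕ}

theorem Holds.setReg {σ : State} (h : Holds N Λ R S σ) {r : ℕ} (v : ℕ)
    (hr : r ∉ [0, 1, 9, 10, 11, 12]) : Holds N Λ R S (σ.setReg r v) := by
  have key : ∀ i ∈ [0, 1, 9, 10, 11, 12], (σ.setReg r v).reg i = σ.reg i := fun i hi => by
    rw [State.reg_setReg, if_neg (by rintro rfl; exact hr hi)]
  exact ⟨(key 0 (by simp)).trans h.r0, (key 1 (by simp)).trans h.r1, (key 9 (by simp)).trans h.r9,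
    (key 10 (by simp)).trans h.r10, (key 11 (by simp)).trans h.r11,
    (key 12 (by simp)).trans h.r12, h.head, h.wt, h.tail, h.pos, h.dist⟩

/-- Computes the table of one scale. -/
def refineAll : Cmd :=
  .assign 22 (𝐫 4) ;; .for 30 (𝐫 11) (.store 8 (𝐜 0 + 𝐫 30) (𝐫 4)) ;;
  .for 24 (𝐫 5) (.assign 22 (𝐫 22 / 𝐜 2) ;; refineStep)

/-- Starting from the trivial table of width `T = 2 ^ D`, `D` halvings lead to width `1`, where
every time is a grid point, at the price of an error of `N.n` each. -/
theorem refineAll_spec {σ : State} (hC : Caps B N Λ R T S M) (hσ : Holds N Λ R S σ)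
    (hg : 0 < g) (hgB : g < B) (hT : T = 2 ^ D) (r4 : σ.reg 4 = T) (r5 : σ.reg 5 = D)
    (r21 : σ.reg 21 = g) :
    Wp B refineAll σ fun τ T' => (N.scale Λ g).Table R T 1 (D * N.n) (τ.arr 8) ∧
      T' ≤ 4000 * ((D + 1) * ((N.m + N.n + 1) * (R + 1))) := by
  have hbig := hC.big
  have hB1 : 1 < B := by omega
  have hDT : D < T := hT ▸ Nat.lt_two_pow_self
  refine wp_seq (wp_assign_eq (v := T) r4 (wp_seq ((wp_fill 0 (N.n * R) (fun _ => T) (by omega) hB1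
    (by omega) ?_).mono ?_)))
  · intro i τ _ hF hr
    have f11 := hF.reg 11 (by decide)
    have f4 := hF.reg 4 (by decide)
    simp only [evalRules, reduceIte, Nat.reduceEqDiff] at f11 f4 ⊢
    exact ⟨f11.trans hσ.r11, fun _ => ⟨Nat.zero_mod _, f4.trans r4⟩⟩
  rintro τ T₁ hF ⟨h8, hT₁⟩
  have h8' : ∀ x < N.n * R, τ.arr 8 x = T := fun x hx => by rw [h8, if_pos (by omega)]
  have hτ : Holds N Λ R S τ := (hσ.setReg (r := 22) T (by decide)).frame hF (by decide) (by decide)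
  have t22 := hF.reg 22 (by decide)
  have t5 := hF.reg 5 (by decide)
  have t21 := hF.reg 21 (by decide)
  simp only [evalRules, reduceIte, Nat.reduceEqDiff] at t22 t5 t21 hT₁
  refine (wp_for_const (fun k ρ => ρ.reg 22 = 2 ^ (D - k) ∧
      (N.scale Λ g).Table R T (2 ^ (D - k)) (k * N.n) (ρ.arr 8)) D
    (4 + 3000 * ((N.m + N.n + 1) * (R + 1))) (by omega) hB1 (by decide) ?_ ?_ ?_).mono ?_
  · intro k ρ _ hF' _ _
    exact ((hF'.reg 5 (by decide)).trans t5).trans r5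
  · simp only [evalRules, reduceIte, Nat.reduceEqDiff, Nat.sub_zero, ← hT, zero_mul]
    exact ⟨t22, (N.scale Λ g).table_init R T _ h8'⟩
  · rintro k ρ hk hF' _ ⟨h22, hJ⟩
    obtain ⟨j, hj⟩ : ∃ j, D - k = j + 1 := ⟨D - k - 1, by omega⟩
    have hj' : D - (k + 1) = j := by omega
    have hpow : 2 ^ j ≤ T := hT ▸ Nat.pow_le_pow_right (by omega) (by omega)
    rw [hj] at h22 hJ
    rw [pow_succ, mul_comm] at hJ
    rw [hj']
    have hρ : Holds N Λ R S ρ := hτ.frame hF' (by decide) (by decide)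
    have u21 := hF'.reg 21 (by decide)
    refine wp_seq (wp_assign_eq (v := 2 ^ j) ?_
      ((refineStep_spec (N := N.scale Λ g) (g := g) (h := 2 ^ j) rfl hC
        (hρ.setReg (r := 22) _ (by decide)) hg hgB hpow (by omega) ?_ ?_ hJ).mono ?_))
    · simp only [evalRules, h22, Nat.mod_eq_of_lt (show 2 < B by omega)]
      rw [pow_succ, Nat.mul_div_cancel _ (by omega)]
      exact Nat.mod_eq_of_lt (by omega)
    · simp only [evalRules, reduceIte, Nat.reduceEqDiff]
      rw [u21, t21, r21]
    · simp only [evalRules, reduceIte]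
    · rintro π T' hF'' ⟨hJ', hT'⟩
      have v22 := hF''.reg 22 (by decide)
      simp only [evalRules, reduceIte, Nat.reduceEqDiff] at v22 ⊢
      refine ⟨⟨v22, ?_⟩, ?_⟩
      · rw [Nat.add_mul, one_mul]; exact hJ'
      · have e1 : (N.scale Λ g).m = N.m := rfl
        have e2 : (N.scale Λ g).n = N.n := rfl
        rw [e1, e2] at hT'
        omega
  · rintro ρ T' _ ⟨⟨_, hJ⟩, _, hT'⟩
    rw [Nat.sub_self, pow_zero] at hJ
    refine ⟨hJ, ?_⟩
    simp only [evalRules] at hT' ⊢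
    have hX : (N.n * R + 1) + 1 ≤ 2 * ((N.m + N.n + 1) * (R + 1)) := by nlinarith
    obtain ⟨X, hX'⟩ : ∃ X, X = (N.m + N.n + 1) * (R + 1) := ⟨_, rfl⟩
    rw [← hX'] at hT' hX ⊢
    clear * - hT' hT₁ hX
    nlinarith

/-- Writes the table and the values of one scale to the output. -/
def emit : Cmd :=
  .assign 23 (𝐫 20 * 𝐫 8) ;;
  .for 30 (𝐫 0)
    (.assign 31 (𝐫 30 * 𝐫 9 + 𝐫 8) ;; .assign 32 (𝐫 14 + (𝐫 30 * 𝐫 13 + 𝐫 23)) ;;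
     .for 37 (𝐫 8) (.store 0 (𝐫 32 + 𝐫 37) (𝐥 8 (𝐫 31 + 𝐫 37)))) ;;
  .assign 32 (𝐫 15 + 𝐫 23) ;;
  .for 37 (𝐫 8) (.store 0 (𝐫 32 + 𝐫 37) (𝐫 21 * (𝐫 8 + 𝐫 37) / 𝐫 8))

/-- Only the upper half of each row, the entries from `L` on, is kept: smaller lengths are handled
by lower scales at better relative accuracy. The blocks of one vertex for successive scales are
adjacent, so that a query searches one contiguous segment. -/
theorem emit_spec {σ : State} {n L Y I i b₁ b₂ : ℕ} (hB : b₂ + Y + n * (2 * L) + g * (2 * L) < B)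
    (hL : 0 < L) (hn : 0 < n) (hi : i < I) (hY : Y = I * L) (hb : b₁ + n * Y ≤ b₂)
    (r0 : σ.reg 0 = n) (r8 : σ.reg 8 = L) (r9 : σ.reg 9 = 2 * L) (r13 : σ.reg 13 = Y)
    (r14 : σ.reg 14 = b₁) (r15 : σ.reg 15 = b₂) (r20 : σ.reg 20 = i) (r21 : σ.reg 21 = g) :
    Wp B emit σ fun τ T' => T' ≤ 150 * ((n + 1) * (L + 1)) ∧
      (∀ t < n, ∀ r < L,
        τ.arr 0 (b₁ + (t * Y + (i * L + r))) = σ.arr 8 (t * (2 * L) + (L + r))) ∧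
      (∀ r < L, τ.arr 0 (b₂ + (i * L + r)) = g * (L + r) / L) ∧
      ∀ x, (∀ t < n, ∀ r < L, x ≠ b₁ + (t * Y + (i * L + r))) →
        (∀ r < L, x ≠ b₂ + (i * L + r)) → τ.arr 0 x = σ.arr 0 x := by
  have hiL : ∀ r < L, i * L + r < Y := fun r hr => hY ▸ flat_lt hi hr
  have hiL' : i * L + L ≤ Y := by have := hiL (L - 1) (by omega); omega
  have hn2 : 1 * (2 * L) ≤ n * (2 * L) := Nat.mul_le_mul_right _ hn
  have hnL : n ≤ n * (2 * L) := Nat.le_mul_of_pos_right _ (by omega)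
  have hB1 : 1 < B := by omega
  refine wp_seq (wp_assign_eq (v := i * L) ?_ (wp_seq ((wp_for_const (fun k τ =>
      (∀ t < k, ∀ r < L,
        τ.arr 0 (b₁ + (t * Y + (i * L + r))) = σ.arr 8 (t * (2 * L) + (L + r))) ∧
      ∀ x, (∀ t < n, ∀ r < L, x ≠ b₁ + (t * Y + (i * L + r))) → τ.arr 0 x = σ.arr 0 x)
      n (40 + 30 * (L + 1)) (by omega) hB1 (by decide) ?_ ?_ ?_).mono ?_)))
  · simp only [evalRules, r20, r8]
    exact Nat.mod_eq_of_lt (by omega)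
  · intro k τ _ hF _ _
    have := hF.reg 0 (by decide)
    simp only [evalRules, reduceIte, Nat.reduceEqDiff] at this ⊢
    exact this.trans r0
  · exact ⟨fun t ht => absurd ht (by omega), fun _ _ => rfl⟩
  · rintro t τ ht hF hrt ⟨H1, H2⟩
    have f8 := hF.reg 8 (by decide)
    have f9 := hF.reg 9 (by decide)
    have f13 := hF.reg 13 (by decide)
    have f14 := hF.reg 14 (by decide)
    have f23 := hF.reg 23 (by decide)
    have a8 := hF.arr 8 (by decide)
    simp only [evalRules, reduceIte, Nat.reduceEqDiff, r8, r9, r13, r14] at f8 f9 f13 f14 f23 a8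
    have h1 : (t + 1) * (2 * L) ≤ n * (2 * L) := Nat.mul_le_mul_right _ ht
    have h2 : (t + 1) * Y ≤ n * Y := Nat.mul_le_mul_right _ ht
    rw [Nat.add_mul, one_mul] at h1 h2
    refine wp_seq (wp_assign_eq (v := t * (2 * L) + L) ?_ (wp_seq
      (wp_assign_eq (v := b₁ + (t * Y + i * L)) ?_
      ((wp_fill (b₁ + (t * Y + i * L)) L (fun r => σ.arr 8 (t * (2 * L) + (L + r)))
        (by omega) hB1 (by omega) ?_).mono ?_))))
    · simp only [evalRules, hrt, f8, f9, Nat.mod_eq_of_lt (show t * (2 * L) < B by omega)]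
      exact Nat.mod_eq_of_lt (by omega)
    · simp only [evalRules, reduceIte, Nat.reduceEqDiff, hrt, f13, f14, f23,
        Nat.mod_eq_of_lt (show t * Y < B by omega),
        Nat.mod_eq_of_lt (show t * Y + i * L < B by omega)]
      exact Nat.mod_eq_of_lt (by omega)
    · intro r ρ hr hF' hρ
      have g8 := hF'.reg 8 (by decide)
      have g31 := hF'.reg 31 (by decide)
      have g32 := hF'.reg 32 (by decide)
      have g8' := hF'.arr 8 (by decide)
      simp only [evalRules, reduceIte, Nat.reduceEqDiff, f8, a8] at g8 g31 g32 g8' ⊢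
      refine ⟨g8, fun hr' => ⟨g32, ?_⟩⟩
      rw [g31, hρ, g8', Nat.mod_eq_of_lt (by omega), Nat.add_assoc]
    · rintro ρ T' _ ⟨H, hT'⟩
      simp only [evalRules] at H hT' ⊢
      refine ⟨⟨fun t' ht' r hr => ?_, fun x hx => ?_⟩, by omega⟩
      · rw [H]
        by_cases h : t' = t
        · subst h
          rw [if_pos (by omega)]
          congr 3
          omega
        · have h3 : (t' + 1) * Y ≤ t * Y := Nat.mul_le_mul_right _ (by omega)
          rw [Nat.add_mul, one_mul] at h3
          have := hiL r hr
          rw [if_neg (by omega)]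
          exact H1 t' (by omega) r hr
      · rw [H, if_neg ?_]
        · exact H2 x hx
        · rintro ⟨h3, h4⟩
          exact hx t ht (x - (b₁ + (t * Y + i * L))) (by omega) (by omega)
  · rintro τ T₁ hF ⟨⟨H1, H2⟩, _, hT₁⟩
    have f8 := hF.reg 8 (by decide)
    have f15 := hF.reg 15 (by decide)
    have f21 := hF.reg 21 (by decide)
    have f23 := hF.reg 23 (by decide)
    simp only [evalRules, reduceIte, Nat.reduceEqDiff, r8, r15, r21] at f8 f15 f21 f23 hT₁
    refine wp_seq (wp_assign_eq (v := b₂ + i * L) ?_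
      ((wp_fill (b₂ + i * L) L (fun r => g * (L + r) / L) (by omega) hB1 (by omega) ?_).mono ?_))
    · simp only [evalRules, f15, f23]
      exact Nat.mod_eq_of_lt (by omega)
    · intro r ρ hr hF' hρ
      have g8 := hF'.reg 8 (by decide)
      have g21 := hF'.reg 21 (by decide)
      have g32 := hF'.reg 32 (by decide)
      simp only [evalRules, reduceIte, Nat.reduceEqDiff, f8, f21] at g8 g21 g32 ⊢
      refine ⟨g8, fun hr' => ⟨g32, ?_⟩⟩
      have h1 : g * (L + r) ≤ g * (2 * L) := Nat.mul_le_mul_left _ (by omega)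
      have h2 := Nat.div_le_self (g * (L + r)) L
      rw [g8, g21, hρ, Nat.mod_eq_of_lt (show L + r < B by omega),
        Nat.mod_eq_of_lt (show g * (L + r) < B by omega)]
      exact Nat.mod_eq_of_lt (by omega)
    · rintro ρ T' _ ⟨H, hT'⟩
      simp only [evalRules] at H hT' ⊢
      refine ⟨by nlinarith, fun t ht r hr => ?_, fun r hr => ?_, fun x hx hx' => ?_⟩
      · have h2 : (t + 1) * Y ≤ n * Y := Nat.mul_le_mul_right _ ht
        rw [Nat.add_mul, one_mul] at h2
        have := hiL r hr
        rw [H, if_neg (by omega)]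
        exact H1 t ht r hr
      · rw [H, if_pos (by omega)]
        congr 3
        omega
      · rw [H, if_neg ?_]
        · exact H2 x hx
        · rintro ⟨h3, h4⟩
          exact hx' (x - (b₂ + i * L)) (by omega) (by omega)

/-- The output of the first `i` scales. -/
structure Scaled (N : Net) (Λ L T D Y b₁ b₂ i : ℕ) (Js : ℕ → ℕ → ℕ) (A : ℕ → ℕ) : Prop where
  table : ∀ i' < i, (N.scale Λ (2 ^ i')).Table (2 * L) T 1 (D * N.n) (Js i')
  entry : ∀ i' < i, ∀ t < N.n, ∀ r < L,
    A (b₁ + (t * Y + (i' * L + r))) = Js i' (t * (2 * L) + (L + r))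
  value : ∀ i' < i, ∀ r < L, A (b₂ + (i' * L + r)) = 2 ^ i' * (L + r) / L

/-- Computes and writes the tables of all scales. -/
def scales : Cmd :=
  .assign 21 (𝐜 1) ;; .for 20 (𝐫 7) (refineAll ;; emit ;; .assign 21 (𝐫 21 + 𝐫 21))

theorem scales_spec {σ : State} {L Y I b₁ b₂ : ℕ} (hC : Caps B N Λ R T S M)
    (hσ : Holds N Λ R S σ) (hR : R = 2 * L) (hT : T = 2 ^ D)
    (hB : b₂ + Y + N.n * (2 * L) + 2 ^ I * (2 * L) + I + 1 < B) (hL : 0 < L) (hn : 0 < N.n)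
    (hY : Y = I * L) (hb : b₁ + N.n * Y ≤ b₂) (r4 : σ.reg 4 = T) (r5 : σ.reg 5 = D)
    (r7 : σ.reg 7 = I) (r8 : σ.reg 8 = L) (r13 : σ.reg 13 = Y)
    (r14 : σ.reg 14 = b₁) (r15 : σ.reg 15 = b₂) :
    Wp B scales σ fun τ T' => (∃ Js, Scaled N Λ L T D Y b₁ b₂ I Js (τ.arr 0)) ∧
      (∀ x < b₁, τ.arr 0 x = σ.arr 0 x) ∧
      T' ≤ 5000 * ((I + 1) * ((D + 1) * ((N.m + N.n + 1) * (R + 1)))) := by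
  have hB1 : 1 < B := by omega
  have hstep : ∀ i < I, 2 * 2 ^ i ≤ 2 ^ I := fun i hi => by
    rw [mul_comm, ← pow_succ]; exact Nat.pow_le_pow_right (by omega) hi
  have hL2 : ∀ a, a ≤ a * (2 * L) := fun a => Nat.le_mul_of_pos_right _ (by omega)
  refine wp_seq (wp_assign_eq (v := 1) (Nat.mod_eq_of_lt hB1) ((wp_for_const (fun i τ =>
      τ.reg 21 = 2 ^ i ∧ (∃ Js, Scaled N Λ L T D Y b₁ b₂ i Js (τ.arr 0)) ∧
      ∀ x < b₁, τ.arr 0 x = σ.arr 0 x) I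
    (4500 * ((D + 1) * ((N.m + N.n + 1) * (R + 1)))) (by omega) hB1 (by decide) ?_ ?_ ?_).mono ?_))
  · intro i τ _ hF _ _
    have := hF.reg 7 (by decide)
    simp only [evalRules, reduceIte, Nat.reduceEqDiff] at this ⊢
    exact this.trans r7
  · simp only [evalRules, reduceIte, Nat.reduceEqDiff]
    exact ⟨by simp, ⟨fun _ _ => 0, fun i hi => absurd hi (by omega),
      fun i hi => absurd hi (by omega), fun i hi => absurd hi (by omega)⟩, fun _ _ => trivial⟩
  · rintro i τ hi hF hri ⟨h21, ⟨Js, hJs⟩, hlow⟩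
    have hgI := hstep i hi
    have hIB := hL2 (2 ^ I)
    have hreg : ∀ r ∈ [0, 1, 4, 5, 8, 9, 10, 11, 12, 13, 14, 15], τ.reg r = σ.reg r := by
      intro r hr
      have h1 : r ≠ 21 := by rintro rfl; revert hr; decide
      have := hF.reg r (by revert r; decide)
      rwa [State.reg_setReg, if_neg h1] at this
    have hτ : Holds N Λ R S τ := 
      (hσ.setReg (r := 21) 1 (by decide)).frame hF (by decide) (by decide)
    refine wp_seq ((refineAll_spec (g := 2 ^ i) hC hτ (by positivity) (by omega) hT
      ((hreg 4 (by simp)).trans r4) ((hreg 5 (by simp)).trans r5) h21).mono ?_)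
    rintro ρ T₁ hFρ ⟨hJ, hT₁⟩
    have hreg' : ∀ r ∈ [0, 8, 9, 13, 14, 15], ρ.reg r = σ.reg r := by
      intro r hr
      rw [hFρ.reg r (by revert r; decide)]
      exact hreg r (by revert r; decide)
    have h0 : ρ.arr 0 = τ.arr 0 := hFρ.arr 0 (by decide)
    have hgL : 2 ^ i * (2 * L) ≤ 2 ^ I * (2 * L) := Nat.mul_le_mul_right _ (by omega)
    refine wp_seq ((emit_spec (g := 2 ^ i) (n := N.n) (L := L) (Y := Y) (I := I) (i := i)
      (b₁ := b₁) (b₂ := b₂) (by omega) hL hn hi hY hb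
      ((hreg' 0 (by simp)).trans hσ.r0) ((hreg' 8 (by simp)).trans r8)
      ((hreg' 9 (by simp)).trans (hσ.r9.trans hR)) ((hreg' 13 (by simp)).trans r13)
      ((hreg' 14 (by simp)).trans r14) ((hreg' 15 (by simp)).trans r15)
      ((hFρ.reg 20 (by decide)).trans hri) ((hFρ.reg 21 (by decide)).trans h21)).mono ?_)
    rintro π T₂ hFπ ⟨hT₂, hE, hV, hK⟩
    have p21 : π.reg 21 = 2 ^ i :=
      ((hFπ.reg 21 (by decide)).trans (hFρ.reg 21 (by decide))).trans h21
    refine wp_assign ?_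
    simp only [evalRules, reduceIte, Nat.reduceEqDiff, p21]
    rw [h0] at hK
    have hlt : ∀ j < I, ∀ r < L, j * L + r < Y := fun j hj r hr => hY ▸ flat_lt hj hr
    have hltn : ∀ t < N.n, ∀ j < I, ∀ r < L, t * Y + (j * L + r) < N.n * Y :=
      fun t ht j hj r hr => flat_lt ht (hlt j hj r hr)
    -- The working table is overwritten in the next round; its present content is recorded as the
    -- table of scale `i`.
    refine ⟨⟨?_, ⟨Function.update Js i (ρ.arr 8), ?_, ?_, ?_⟩, fun x hx => ?_⟩, ?_⟩
    · rw [pow_succ, Nat.mod_eq_of_lt (by omega)]; omega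
    · intro i' hi'
      by_cases h : i' = i
      · subst h
        rw [Function.update_self, ← hR]
        exact hJ
      · rw [Function.update_of_ne h]
        exact hJs.table i' (by omega)
    · intro i' hi' t ht r hr
      by_cases h : i' = i
      · subst h
        rw [Function.update_self]
        exact hE t ht r hr
      · rw [Function.update_of_ne h, ← hJs.entry i' (by omega) t ht r hr]
        refine hK _ (fun t' ht' r' hr' heq => ?_) (fun r' hr' heq => ?_)
        · obtain ⟨-, h2⟩ := flat_inj (hlt i' (by omega) r hr) (hlt i hi r' hr')
            (Nat.add_left_cancel heq)
          exact h (flat_inj hr hr' h2).1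
        · have := hltn t ht i' (by omega) r hr
          omega
    · intro i' hi' r hr
      by_cases h : i' = i
      · subst h
        exact hV r hr
      · rw [← hJs.value i' (by omega) r hr]
        refine hK _ (fun t' ht' r' hr' heq => ?_) (fun r' hr' heq => ?_)
        · have := hltn t' ht' i hi r' hr'
          omega
        · exact h (flat_inj hr hr' (Nat.add_left_cancel heq)).1
    · rw [← hlow x hx]
      refine hK x (fun t' ht' r' hr' heq => ?_) (fun r' hr' heq => ?_) <;> omega
    · have h1 : (N.n + 1) * (L + 1) ≤ 2 * ((N.m + N.n + 1) * (R + 1)) := by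
        rw [hR]; nlinarith
      obtain ⟨X, hX⟩ : ∃ X, X = (N.m + N.n + 1) * (R + 1) := ⟨_, rfl⟩
      rw [← hX] at h1 hT₁ ⊢
      have hX1 : 1 ≤ X := by rw [hX]; exact Nat.mul_pos (by omega) (by omega)
      have hX2 : X ≤ (D + 1) * X := Nat.le_mul_of_pos_left _ (by omega)
      clear * - h1 hT₁ hT₂ hX1 hX2
      omega
  · rintro τ T' _ ⟨⟨_, h1, h2⟩, _, hT'⟩
    refine ⟨h1, h2, ?_⟩
    simp only [evalRules] at hT' ⊢
    obtain ⟨X, hX⟩ : ∃ X, X = (D + 1) * ((N.m + N.n + 1) * (R + 1)) := ⟨_, rfl⟩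
    rw [← hX] at hT' ⊢
    have hX1 : 1 ≤ X := by rw [hX]; exact Nat.mul_pos (by omega) (Nat.mul_pos (by omega) (by omega))
    clear * - hT' hX1
    nlinarith

end
/-! ### Preparations -/

/-- Copies the tails to array `4` and puts the largest weight into register `6`. -/
def copyTails : Cmd :=
  .for 30 (𝐫 1)
    (.store 4 (𝐫 30) (𝐥 0 (𝐫 30)) ;;
      .ite (Expr.lt (𝐫 6) (𝐥 2 (𝐫 30))) (.assign 6 (𝐥 2 (𝐫 30))) .skip)

/-- Array `0` is needed for the output, so the tails are moved away. The bound `W` is not part of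
the input; the largest weight that occurs takes its place. -/
theorem copyTails_spec {B : ℕ} {σ : State} {m W : ℕ} (hB : 1 < B) (hm : m < B)
    (h1 : σ.reg 1 = m) (h6 : σ.reg 6 = 0) (hW : ∀ e < m, σ.arr 2 e ≤ W) :
    Wp B copyTails σ fun τ T => (∀ e < m, τ.arr 4 e = σ.arr 0 e) ∧
      (∀ e < m, σ.arr 2 e ≤ τ.reg 6) ∧ τ.reg 6 ≤ W ∧ T ≤ 50 * (m + 1) := by
  refine (wp_for_const (fun i τ => (∀ e < i, τ.arr 4 e = σ.arr 0 e) ∧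
      (∀ e < i, σ.arr 2 e ≤ τ.reg 6) ∧ τ.reg 6 ≤ W) m 20 hm hB (by decide) ?_ ?_ ?_).mono ?_
  · intro i τ _ hF _ _
    exact (hF.reg 1 (by decide)).trans h1
  · simp [evalRules, h6]
  · rintro i τ hi hF hr ⟨ha, hb, hc⟩
    have f0 := hF.arr 0 (by decide)
    have f2 := hF.arr 2 (by decide)
    have ha' : ∀ e < i + 1, Function.update (τ.arr 4) i (σ.arr 0 i) e = σ.arr 0 e := by
      intro e he
      by_cases h : e = i
      · simp [h]
      · simp [Function.update_of_ne h, ha e (by omega)]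
    refine wp_seq (wp_store (wp_ite (fun hg => ?_) (fun hg => ?_)))
    · refine wp_assign ?_
      simp only [guardRules hB, ne_eq, evalRules, hr, f0, f2, Nat.reduceEqDiff, reduceIte] at hg ⊢
      refine ⟨⟨ha', fun e he => ?_, hW i hi⟩, by norm_num⟩
      rcases Nat.lt_succ_iff_lt_or_eq.1 he with h | rfl
      · have := hb e h; omega
      · rfl
    · refine wp_skip ?_
      simp only [guardRules hB, evalRules, hr, f0, f2, Nat.reduceEqDiff, reduceIte] at hg ⊢
      refine ⟨⟨ha', fun e he => ?_, hc⟩, by norm_num⟩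
      rcases Nat.lt_succ_iff_lt_or_eq.1 he with h | rfl
      · exact hb e h
      · exact hg
  · rintro τ T _ ⟨⟨ha, hb, hc⟩, _, hT⟩
    exact ⟨ha, hb, hc, by simp only [evalRules] at hT; omega⟩

/-- Computes the least power of two that is at least register `rt`, and adds its exponent to
register `rb`. -/
def powLoop (ra rb rt : ℕ) : Cmd :=
  .assign ra (𝐜 1) ;;
  .loop (Expr.lt (𝐫 ra) (𝐫 rt)) (.assign ra (𝐫 ra + 𝐫 ra) ;; .assign rb (𝐫 rb + 𝐜 1))

theorem powLoop_spec {B : ℕ} {σ : State} {ra rb rt k t : ℕ} (hab : ra ≠ rb) (hat : rt ≠ ra)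
    (hbt : rt ≠ rb) (hB : 2 * t + k + 2 < B) (ht : σ.reg rt = t) (hk : σ.reg rb = k) :
    Wp B (powLoop ra rb rt) σ fun τ T => τ.reg ra = 2 ^ Nat.clog 2 t ∧
      τ.reg rb = k + Nat.clog 2 t ∧ T ≤ 20 * (Nat.clog 2 t + 1) := by
  have hB1 : 1 < B := by omega
  refine wp_seq (wp_assign_eq (v := 1) (Nat.mod_eq_of_lt hB1)
    ((wp_loop (fun τ b => ∃ i ≤ Nat.clog 2 t, τ.reg ra = 2 ^ i ∧ τ.reg rb = k + i ∧
      τ.reg rt = t ∧ b = 20 * (Nat.clog 2 t - i)) (b := 20 * Nat.clog 2 t) ?_ ?_).mono ?_))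
  · refine ⟨0, Nat.zero_le _, ?_⟩
    simp only [evalRules, reduceIte, hab.symm, hat, ht, hk]
    simp
  · rintro τ b hF ⟨i, hi, ha, hb, hc, rfl⟩ hg
    simp only [guardRules hB1, ne_eq, evalRules, ha, hc, not_le] at hg
    have hlt : i < Nat.clog 2 t := (Nat.lt_clog_iff_pow_lt (by omega)).2 hg
    have hi2 : i < 2 ^ i := Nat.lt_two_pow_self
    refine wp_seq (wp_assign_eq (v := 2 ^ (i + 1)) ?_ (wp_assign_eq (v := k + (i + 1)) ?_ ?_))
    · simp only [evalRules, ha]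
      rw [Nat.mod_eq_of_lt (by omega), pow_succ]
      omega
    · simp only [evalRules, hb, hab.symm, if_false, Nat.mod_eq_of_lt hB1]
      exact Nat.mod_eq_of_lt (by omega)
    · refine ⟨_, ⟨i + 1, hlt, ?_, ?_, ?_, rfl⟩, ?_⟩
      · simp [evalRules, hab]
      · simp [evalRules]
      · simp [evalRules, hat, hbt, hc]
      · simp only [evalRules]; omega
  · rintro τ T _ ⟨hg, b, ⟨i, hi, ha, hb, hc, rfl⟩, hT⟩
    simp only [guardRules hB1, evalRules, ha, hc] at hg
    have : i = Nat.clog 2 t := le_antisymm hi (Nat.clog_le_of_le_pow hg)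
    subst this
    simp only [evalRules] at hT ⊢
    exact ⟨ha, hb, by omega⟩

/-- The path `l 0, …, l (p - 1)` of a network, with its distances `d` and arc weights `ω`. -/
structure Route (N : Net) (p : ℕ) (l d ω : ℕ → ℕ) : Prop where
  pos : ∀ j < p, N.pos (l j) = j + 1
  pos_zero : ∀ v < N.n, (∀ j < p, l j ≠ v) → N.pos v = 0
  dist : ∀ j < p, N.dist (l j) = d j
  dist_zero : ∀ v < N.n, (∀ j < p, l j ≠ v) → N.dist v = 0
  zero : d 0 = 0
  succ : ∀ j, j + 1 < p → d (j + 1) = d j + ω j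
  arc : ∀ j, j + 1 < p → ∃ e < N.m, N.tail e = l j ∧ N.head e = l (j + 1)
  wt : ∀ j, j + 1 < p → ∀ e < N.m, N.tail e = l j → N.head e = l (j + 1) → N.wt e = ω j

section
variable {B : ℕ} {N : Net} {p : ℕ} {l d ω : ℕ → ℕ}

theorem Route.inj (h : Route N p l d ω) {i j : ℕ} (hi : i < p) (hj : j < p) (hij : l i = l j) :
    i = j := by
  have h1 := h.pos i hi
  rw [hij, h.pos j hj] at h1
  omega

theorem Route.eq_of_pos (h : Route N p l d ω) {v j : ℕ} (hv : v < N.n) (hj : j < p)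
    (hp : N.pos v = j + 1) : v = l j := by
  by_contra hc
  by_cases h' : ∃ i < p, l i = v
  · obtain ⟨i, hi, rfl⟩ := h'
    rw [h.pos i hi] at hp
    obtain rfl : i = j := by omega
    exact hc rfl
  · push Not at h'
    rw [h.pos_zero v hv h'] at hp
    omega

theorem Route.pos_lt (h : Route N p l d ω) {v : ℕ} (hv : v < N.n) : N.pos v ≤ p := by
  by_cases h' : ∃ i < p, l i = v
  · obtain ⟨i, hi, rfl⟩ := h'
    rw [h.pos i hi]
    omega
  · push Not at h'
    rw [h.pos_zero v hv h']
    omega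

/-- Puts the positions on the path into array `5`. -/
def markPath : Cmd := .for 30 (𝐫 2) (.store 5 (𝐥 3 (𝐫 30)) (𝐫 30 + 𝐜 1))

theorem markPath_spec {σ : State} (h : Route N p l d ω) (hB : p + 1 < B) (h2 : σ.reg 2 = p)
    (h3 : ∀ j < p, σ.arr 3 j = l j) (h5 : ∀ v, σ.arr 5 v = 0) :
    Wp B markPath σ fun τ T => (∀ v < N.n, τ.arr 5 v = N.pos v) ∧ T ≤ 30 * (p + 1) := by
  have hB1 : 1 < B := by omega
  refine (wp_for_const (fun i τ => (∀ j < i, τ.arr 5 (l j) = j + 1) ∧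
      ∀ v, (∀ j < i, l j ≠ v) → τ.arr 5 v = 0) p 10 (by omega) hB1 (by decide) ?_ ?_ ?_).mono ?_
  · intro i τ _ hF _ _
    exact (hF.reg 2 (by decide)).trans h2
  · exact ⟨fun j hj => absurd hj (by omega), fun v _ => h5 v⟩
  · rintro i τ hi hF hr ⟨ha, hb⟩
    have f3 := hF.arr 3 (by decide)
    refine wp_store ?_
    simp only [evalRules, reduceIte, hr, f3, h3 i hi, Nat.mod_eq_of_lt hB1,
      Nat.mod_eq_of_lt (show i + 1 < B by omega)]
    refine ⟨⟨fun j hj => ?_, fun v hv => ?_⟩, by norm_num⟩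
    · by_cases hij : j = i
      · rw [hij, Function.update_self]
      · rw [Function.update_of_ne (fun hc => hij (h.inj (by omega) hi hc))]
        exact ha j (by omega)
    · rw [Function.update_of_ne (fun hc => hv i (by omega) hc.symm)]
      exact hb v fun j hj => hv j (by omega)
  · rintro τ T _ ⟨⟨ha, hb⟩, _, hT⟩
    refine ⟨fun v hv => ?_, by simp only [evalRules] at hT; omega⟩
    by_cases h' : ∃ i < p, l i = v
    · obtain ⟨i, hi, rfl⟩ := h'
      rw [h.pos i hi, ha i hi]
    · push Not at h'
      rw [h.pos_zero v hv h', hb v h']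

/-- Puts the weights of the arcs of the path into array `6`. -/
def pathArcs : Cmd :=
  .for 30 (𝐫 1)
    (.assign 31 (𝐥 5 (𝐥 4 (𝐫 30))) ;; .assign 32 (𝐥 1 (𝐫 30)) ;;
     .ite (𝐫 31) (.ite (Expr.eq (𝐥 5 (𝐫 32)) (𝐫 31 + 𝐜 1)) (.store 6 (𝐫 32) (𝐥 2 (𝐫 30))) .skip)
      .skip)

/-- The edges of the path are recognised by consecutive positions. The separate test that the
position of the tail is not `0` excludes edges from vertices off the path to the first vertex. -/
theorem pathArcs_spec {σ : State} (h : Route N p l d ω) (hB : N.m + p + 1 < B)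
    (hN : ∀ e < N.m, N.tail e < N.n ∧ N.head e < N.n) (h1 : σ.reg 1 = N.m)
    (a1 : ∀ e < N.m, σ.arr 1 e = N.head e) (a2 : ∀ e < N.m, σ.arr 2 e = N.wt e)
    (a4 : ∀ e < N.m, σ.arr 4 e = N.tail e) (a5 : ∀ v < N.n, σ.arr 5 v = N.pos v) :
    Wp B pathArcs σ fun τ T => (∀ j, j + 1 < p → τ.arr 6 (l (j + 1)) = ω j) ∧
      T ≤ 60 * (N.m + 1) := by
  have hB1 : 1 < B := by omega
  refine (wp_for_const (fun i τ => ∀ j, j + 1 < p →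
      (∃ e < i, N.pos (N.tail e) = j + 1 ∧ N.pos (N.head e) = j + 2) → τ.arr 6 (l (j + 1)) = ω j)
    N.m 40 (by omega) hB1 (by decide) ?_ ?_ ?_).mono ?_
  · intro i τ _ hF _ _
    exact (hF.reg 1 (by decide)).trans h1
  · rintro j _ ⟨e, he, _⟩
    omega
  · intro i τ hi hF hr ha
    have f1 := hF.arr 1 (by decide)
    have f2 := hF.arr 2 (by decide)
    have f4 := hF.arr 4 (by decide)
    have f5 := hF.arr 5 (by decide)
    obtain ⟨hu, ht⟩ := hN i hi
    have hp := h.pos_lt hu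
    have hskip : (N.pos (N.tail i) = 0 ∨ N.pos (N.head i) ≠ N.pos (N.tail i) + 1) →
        ∀ j, j + 1 < p → (∃ e < i + 1, N.pos (N.tail e) = j + 1 ∧ N.pos (N.head e) = j + 2) →
        τ.arr 6 (l (j + 1)) = ω j := by
      rintro hc j hj ⟨e, he, h1, h2⟩
      rcases Nat.lt_succ_iff_lt_or_eq.1 he with h' | rfl
      · exact ha j hj ⟨e, h', h1, h2⟩
      · omega
    refine wp_seq (wp_assign_eq (v := N.pos (N.tail i)) ?_ (wp_seq
      (wp_assign_eq (v := N.head i) ?_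
      (wp_ite (fun hg => wp_ite (fun hg' => ?_) (fun hg' => ?_)) (fun hg => ?_)))))
    · simp only [evalRules, hr, f4, f5, a4 i hi, a5 _ hu]
    · simp only [evalRules, reduceIte, Nat.reduceEqDiff, hr, f1, a1 i hi]
    all_goals simp only [ne_eq, evalRules, Nat.reduceEqDiff, reduceIte] at hg
    · simp only [guardRules hB1, ne_eq, evalRules, Nat.reduceEqDiff, reduceIte, f5, a5 _ ht,
        Nat.mod_eq_of_lt hB1, Nat.mod_eq_of_lt (show N.pos (N.tail i) + 1 < B by omega),
        not_not] at hg'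
      refine wp_store ?_
      simp only [evalRules, Nat.reduceEqDiff, reduceIte, hr, f2, a2 i hi]
      refine ⟨fun j hj he => ?_, by norm_num⟩
      by_cases hc : l (j + 1) = N.head i
      · rw [hc, Function.update_self]
        have h2 := h.pos (j + 1) hj
        rw [hc] at h2
        exact h.wt j hj i hi (h.eq_of_pos hu (by omega) (by omega)) hc.symm
      · rw [Function.update_of_ne hc]
        obtain ⟨e, he, h3, h4⟩ := he
        rcases Nat.lt_succ_iff_lt_or_eq.1 he with h' | rfl
        · exact ha j hj ⟨e, h', h3, h4⟩
        · exact absurd (h.eq_of_pos ht hj h4).symm hc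
    · simp only [guardRules hB1, ne_eq, evalRules, Nat.reduceEqDiff, reduceIte, f5, a5 _ ht,
        Nat.mod_eq_of_lt hB1, Nat.mod_eq_of_lt (show N.pos (N.tail i) + 1 < B by omega)] at hg'
      refine wp_skip ⟨hskip (.inr hg'), by simp only [evalRules]; norm_num⟩
    · refine wp_skip ⟨hskip (.inl (by omega)), by simp only [evalRules]; norm_num⟩
  · rintro τ T _ ⟨ha, _, hT⟩
    refine ⟨fun j hj => ha j hj ?_, by simp only [evalRules] at hT; omega⟩
    obtain ⟨e, he, h1, h2⟩ := h.arc j hj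
    exact ⟨e, he, by rw [h1, h.pos j (by omega)], by rw [h2, h.pos (j + 1) hj]⟩

/-- Puts the distances of the vertices of the path into array `7`. -/
def pathDists : Cmd :=
  .for 30 (𝐫 2 - 𝐜 1)
    (.assign 31 (𝐥 3 (𝐫 30)) ;; .assign 32 (𝐥 3 (𝐫 30 + 𝐜 1)) ;;
     .store 7 (𝐫 32) (𝐥 7 (𝐫 31) + 𝐥 6 (𝐫 32)))

theorem pathDists_spec {σ : State} (h : Route N p l d ω) (hp : 0 < p) (hB : p + 1 < B)
    (hd : ∀ j < p, d j < B) (h2 : σ.reg 2 = p)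
    (a3 : ∀ j < p, σ.arr 3 j = l j) (a6 : ∀ j, j + 1 < p → σ.arr 6 (l (j + 1)) = ω j)
    (a7 : ∀ v, σ.arr 7 v = 0) :
    Wp B pathDists σ fun τ T => (∀ v < N.n, τ.arr 7 v = N.dist v) ∧ T ≤ 50 * (p + 1) := by
  have hB1 : 1 < B := by omega
  -- Before the first round only the distance of the first vertex is claimed; it is `0`, as the
  -- array is initially.
  refine (wp_for_const (fun i τ => (∀ j ≤ i, j < p → τ.arr 7 (l j) = d j) ∧
      ∀ v, (∀ j < p, l j ≠ v) → τ.arr 7 v = 0) (p - 1) 30 (by omega) hB1 (by decide)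
      ?_ ?_ ?_).mono ?_
  · intro i τ _ hF _ _
    simp only [evalRules, (hF.reg 2 (by decide)).trans h2, Nat.mod_eq_of_lt hB1]
    exact Nat.mod_eq_of_lt (by omega)
  · refine ⟨fun j hj _ => ?_, fun v _ => a7 v⟩
    obtain rfl : j = 0 := by omega
    rw [h.zero]
    exact a7 _
  · rintro i τ hi hF hr ⟨ha, hb⟩
    have f3 := hF.arr 3 (by decide)
    have f6 := hF.arr 6 (by decide)
    have hi' : i + 1 < p := by omega
    have hs := h.succ i hi'
    have hdB := hd (i + 1) hi'
    refine wp_seq (wp_assign_eq (v := l i) ?_ (wp_seq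
      (wp_assign_eq (v := l (i + 1)) ?_ (wp_store ?_))))
    · simp only [evalRules, hr, f3, a3 i (by omega)]
    · simp only [evalRules, reduceIte, Nat.reduceEqDiff, hr, f3, Nat.mod_eq_of_lt hB1,
        Nat.mod_eq_of_lt (show i + 1 < B by omega), a3 _ hi']
    · simp only [evalRules, reduceIte, Nat.reduceEqDiff, f6, a6 i hi', ha i le_rfl (by omega),
        ← hs, Nat.mod_eq_of_lt hdB]
      refine ⟨⟨fun j hj hjp => ?_, fun v hv => ?_⟩, by norm_num⟩
      · by_cases hij : j = i + 1
        · rw [hij, Function.update_self]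
        · rw [Function.update_of_ne (fun hc => hij (h.inj hjp hi' hc))]
          exact ha j (by omega) hjp
      · rw [Function.update_of_ne (fun hc => hv _ hi' hc.symm)]
        exact hb v hv
  · rintro τ T _ ⟨⟨ha, hb⟩, _, hT⟩
    refine ⟨fun v hv => ?_, by simp only [evalRules] at hT; omega⟩
    by_cases h' : ∃ i < p, l i = v
    · obtain ⟨i, hi, rfl⟩ := h'
      rw [h.dist i hi, ha i (by omega) hi]
    · push Not at h'
      rw [h.dist_zero v hv h', hb v h']

end
/-! ### The construction program -/

/-- Computes the sizes of the tables. -/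
def sizes : Cmd :=
  .assign 8 ((𝐫 3 + 𝐫 3) * (𝐫 5 + 𝐜 2)) ;; .assign 9 (𝐫 8 + 𝐫 8) ;;
  .assign 10 (𝐫 1 * 𝐫 9 + 𝐜 1) ;; .assign 11 (𝐫 0 * 𝐫 9) ;; .assign 12 (𝐫 0 * 𝐫 8) ;;
  .assign 13 (𝐫 7 * 𝐫 8) ;; .assign 14 (𝐫 0 + 𝐫 0 + 𝐜 2) ;; .assign 15 (𝐫 14 + 𝐫 0 * 𝐫 13)

section
variable {B : ℕ}

theorem sizes_spec {σ : State} {n m K D I L R Y : ℕ} (hL : L = 2 * K * (D + 2)) (hR : R = 2 * L)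
    (hY : Y = I * L) (hB : 2 * K + D + R + m * R + n * R + Y + 2 * n + n * Y + 3 < B)
    (r0 : σ.reg 0 = n) (r1 : σ.reg 1 = m) (r3 : σ.reg 3 = K) (r5 : σ.reg 5 = D)
    (r7 : σ.reg 7 = I) :
    Wp B sizes σ fun τ T => (τ.reg 8 = L ∧ τ.reg 9 = R ∧ τ.reg 10 = m * R + 1 ∧
      τ.reg 11 = n * R ∧ τ.reg 12 = n * L ∧ τ.reg 13 = Y ∧ τ.reg 14 = 2 * n + 2 ∧
      τ.reg 15 = 2 * n + 2 + n * Y) ∧ T ≤ 60 := by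
  have hnL : n * L ≤ n * R := Nat.mul_le_mul_left _ (by omega)
  have e1 : (K + K) * (D + 2) = L := by rw [hL]; ring
  have e2 : L + L = R := by omega
  have e3 : n + n + 2 = 2 * n + 2 := by omega
  refine wp_seq (wp_assign_eq (v := L) ?_ (wp_seq (wp_assign_eq (v := R) ?_ (wp_seq
    (wp_assign_eq (v := m * R + 1) ?_ (wp_seq (wp_assign_eq (v := n * R) ?_ (wp_seq
    (wp_assign_eq (v := n * L) ?_ (wp_seq (wp_assign_eq (v := Y) ?_ (wp_seq
    (wp_assign_eq (v := 2 * n + 2) ?_ (wp_assign_eq (v := 2 * n + 2 + n * Y) ?_ ?_))))))))))))))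
  case refine_9 => simp [evalRules]
  all_goals
    simp only [evalRules, reduceIte, Nat.reduceEqDiff, r0, r1, r3, r5, r7,
      Nat.mod_eq_of_lt (show 1 < B by omega), Nat.mod_eq_of_lt (show 2 < B by omega),
      Nat.mod_eq_of_lt (show K + K < B by omega), Nat.mod_eq_of_lt (show D + 2 < B by omega),
      Nat.mod_eq_of_lt (show m * R < B by omega), Nat.mod_eq_of_lt (show m * R + 1 < B by omega),
      Nat.mod_eq_of_lt (show n * R < B by omega), Nat.mod_eq_of_lt (show n * L < B by omega),
      Nat.mod_eq_of_lt (show n + n < B by omega), Nat.mod_eq_of_lt (show n * Y < B by omega),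
      e1, e2, ← hY, e3, Nat.mod_eq_of_lt (show L < B by omega),
      Nat.mod_eq_of_lt (show R < B by omega), Nat.mod_eq_of_lt (show Y < B by omega),
      Nat.mod_eq_of_lt (show 2 * n + 2 < B by omega),
      Nat.mod_eq_of_lt (show 2 * n + 2 + n * Y < B by omega)]

/-- Writes the numbers of vertices and of entries per vertex, the positions and the distances. -/
def header : Cmd :=
  .store 0 (𝐜 0) (𝐫 0) ;; .store 0 (𝐜 1) (𝐫 13) ;;
  .for 30 (𝐫 0) (.store 0 (𝐜 2 + 𝐫 30) (𝐥 5 (𝐫 30))) ;;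
  .for 30 (𝐫 0) (.store 0 ((𝐫 0 + 𝐜 2) + 𝐫 30) (𝐥 7 (𝐫 30)))

theorem header_spec {σ : State} {n Y : ℕ} (hB : 2 * n + 3 < B) (r0 : σ.reg 0 = n)
    (r13 : σ.reg 13 = Y) :
    Wp B header σ fun τ T => (τ.arr 0 0 = n ∧ τ.arr 0 1 = Y ∧
      (∀ v < n, τ.arr 0 (2 + v) = σ.arr 5 v) ∧ ∀ v < n, τ.arr 0 (n + 2 + v) = σ.arr 7 v) ∧
      T ≤ 60 * (n + 1) := by
  have hB1 : 1 < B := by omega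
  refine wp_seq (wp_store (wp_seq (wp_store (wp_seq
    ((wp_fill 2 n (fun v => σ.arr 5 v) (by omega) hB1 (by omega) ?_).mono ?_)))))
  · intro i τ _ hF hr
    have f0 := hF.reg 0 (by decide)
    have f5 := hF.arr 5 (by decide)
    simp only [evalRules, reduceIte, Nat.reduceEqDiff, r0] at f0 f5 ⊢
    exact ⟨f0, fun _ => ⟨Nat.mod_eq_of_lt (by omega), by rw [f5, hr]⟩⟩
  rintro τ T₁ hF ⟨ha, hT₁⟩
  have f0 := hF.reg 0 (by decide)
  have f7 := hF.arr 7 (by decide)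
  simp only [evalRules, reduceIte, Nat.reduceEqDiff, r0, r13, Nat.zero_mod,
    Nat.mod_eq_of_lt hB1] at f0 f7 ha hT₁
  refine (wp_fill (n + 2) n (fun v => σ.arr 7 v) (by omega) hB1 (by omega) ?_).mono ?_
  · intro i ρ _ hF' hr
    have g0 := hF'.reg 0 (by decide)
    have g7 := hF'.arr 7 (by decide)
    simp only [evalRules, g0, f0, g7, f7, hr, Nat.mod_eq_of_lt (show 2 < B by omega)]
    exact ⟨trivial, fun _ => ⟨Nat.mod_eq_of_lt (by omega), trivial⟩⟩
  · rintro ρ T₂ _ ⟨hb, hT₂⟩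
    simp only [evalRules] at hT₂ ⊢
    refine ⟨⟨?_, ?_, fun v hv => ?_, fun v hv => ?_⟩, by omega⟩
    · rw [hb, if_neg (by omega), ha, if_neg (by omega), Function.update_of_ne (by omega),
        Function.update_self]
    · rw [hb, if_neg (by omega), ha, if_neg (by omega), Function.update_self]
    · rw [hb, if_neg (by omega), ha, if_pos (by omega), Nat.add_sub_cancel_left]
    · rw [hb, if_pos (by omega), Nat.add_sub_cancel_left]

/-- Reads the weights and the path, and computes all constants. -/
def prepare : Cmd :=
  copyTails ;; powLoop 4 5 0 ;; .assign 30 (𝐫 0 * 𝐫 6) ;; .assign 7 (𝐜 1) ;; powLoop 21 7 30 ;;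
  sizes ;; markPath ;; pathArcs ;; pathDists

/-- The construction program. -/
def build : Cmd := prepare ;; header ;; scales ;; .assign 0 (𝐫 15 + 𝐫 13)

/-- The input of the construction in the memory. -/
structure Input (N : Net) (p K : ℕ) (l : ℕ → ℕ) (σ : State) : Prop where
  r0 : σ.reg 0 = N.n
  r1 : σ.reg 1 = N.m
  r2 : σ.reg 2 = p
  r3 : σ.reg 3 = K
  r5 : σ.reg 5 = 0
  r6 : σ.reg 6 = 0
  a0 : ∀ e < N.m, σ.arr 0 e = N.tail e
  a1 : ∀ e < N.m, σ.arr 1 e = N.head e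
  a2 : ∀ e < N.m, σ.arr 2 e = N.wt e
  a3 : ∀ j < p, σ.arr 3 j = l j
  a5 : ∀ v, σ.arr 5 v = 0
  a7 : ∀ v, σ.arr 7 v = 0

variable {N : Net} {p K W D L : ℕ} {l d ω : ℕ → ℕ}

/-- The number of scales is computed from the measured maximum `w` instead of `W`. Its register
starts at `1`, hence ends at `I + 1`: the scales are `0, …, I`. -/
theorem prepare_spec {σ : State} (h : Route N p l d ω) (hσ : Input N p K l σ) (hp : 0 < p)
    (hpn : p ≤ N.n) (hN : ∀ e < N.m, N.tail e < N.n ∧ N.head e < N.n) (hW : ∀ e < N.m, N.wt e ≤ W)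
    (hd : ∀ j < p, d j ≤ N.n * W) (hD : D = Nat.clog 2 N.n) (hL : L = 2 * K * (D + 2))
    (hB : 2 * K + 4 * N.n + 2 * (N.n * W) + N.m + D + 2 * L + N.m * (2 * L) + N.n * (2 * L) +
      (Nat.clog 2 (N.n * W) + 1) * L + N.n * ((Nat.clog 2 (N.n * W) + 1) * L) + 10 < B) :
    Wp B prepare σ fun τ T => ∃ w I, (∀ e < N.m, N.wt e ≤ w) ∧ w ≤ W ∧
      I = Nat.clog 2 (N.n * w) ∧ Holds N (N.n * L) (2 * L) (N.m * (2 * L) + 1) τ ∧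
      τ.reg 4 = 2 ^ D ∧ τ.reg 5 = D ∧ τ.reg 7 = I + 1 ∧ τ.reg 8 = L ∧ τ.reg 13 = (I + 1) * L ∧
      τ.reg 14 = 2 * N.n + 2 ∧ τ.reg 15 = 2 * N.n + 2 + N.n * ((I + 1) * L) ∧
      T ≤ 500 * (N.m + N.n + D + I + 1) := by
  have hB1 : 1 < B := by omega
  refine wp_seq ((copyTails_spec (m := N.m) (W := W) hB1 (by omega) hσ.r1 hσ.r6
    (fun e he => by rw [hσ.a2 e he]; exact hW e he)).mono ?_)
  rintro τ₁ T₁ F₁ ⟨h4, hw, hwW, hT₁⟩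
  obtain ⟨w, hw'⟩ : ∃ w, τ₁.reg 6 = w := ⟨_, rfl⟩
  rw [hw'] at hw hwW
  have hnw : N.n * w ≤ N.n * W := Nat.mul_le_mul_left _ hwW
  obtain ⟨I, hI⟩ : ∃ I, I = Nat.clog 2 (N.n * w) := ⟨_, rfl⟩
  have hIW : I ≤ Nat.clog 2 (N.n * W) := hI ▸ Nat.clog_mono_right 2 hnw
  have hY : (I + 1) * L ≤ (Nat.clog 2 (N.n * W) + 1) * L := Nat.mul_le_mul_right _ (by omega)
  have hnY : N.n * ((I + 1) * L) ≤ N.n * ((Nat.clog 2 (N.n * W) + 1) * L) :=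
    Nat.mul_le_mul_left _ hY
  have s0 : τ₁.reg 0 = N.n := (F₁.reg 0 (by decide)).trans hσ.r0
  refine wp_seq ((powLoop_spec (ra := 4) (rb := 5) (rt := 0) (k := 0) (t := N.n) (by decide)
    (by decide) (by decide) (by omega) s0 ((F₁.reg 5 (by decide)).trans hσ.r5)).mono ?_)
  rintro τ₂ T₂ F₂ ⟨h24, h25, hT₂⟩
  rw [← hD] at h24 h25 hT₂
  have s6 : τ₂.reg 6 = w := (F₂.reg 6 (by decide)).trans hw'
  have t0 : τ₂.reg 0 = N.n := (F₂.reg 0 (by decide)).trans s0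
  refine wp_seq (wp_assign_eq (v := N.n * w) ?_ (wp_seq (wp_assign_eq (v := 1) ?_ (wp_seq
    ((powLoop_spec (ra := 21) (rb := 7) (rt := 30) (k := 1) (t := N.n * w) (by decide)
    (by decide) (by decide) (by omega) ?_ ?_).mono ?_)))))
  · simp only [evalRules, t0, s6]
    exact Nat.mod_eq_of_lt (by omega)
  · exact Nat.mod_eq_of_lt hB1
  · simp [evalRules]
  · simp [evalRules]
  rintro τ₃ T₃ F₃ ⟨-, h37, hT₃⟩
  rw [← hI] at h37 hT₃
  have g3 : ∀ r ∉ [30, 7, 21, 4, 5, 6], τ₃.reg r = σ.reg r := by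
    intro r hr
    simp only [List.mem_cons, List.not_mem_nil, or_false, not_or] at hr
    rw [F₃.reg r (by simp [powLoop, Cmd.regs, hr])]
    simp only [evalRules, hr, if_false]
    rw [F₂.reg r (by simp [powLoop, Cmd.regs, hr]),
      F₁.reg r (by simp [copyTails, Cmd.for, Cmd.regs, hr])]
  have g4 := F₃.reg 4 (by decide)
  have g5 := F₃.reg 5 (by decide)
  simp only [evalRules, reduceIte, Nat.reduceEqDiff, h24, h25, Nat.zero_add] at g4 g5
  have b3 : ∀ a, a ≠ 4 → τ₃.arr a = σ.arr a := by
    intro a ha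
    rw [F₃.arr a (by simp [powLoop, Cmd.arrs])]
    simp only [evalRules]
    rw [F₂.arr a (by simp [powLoop, Cmd.arrs]),
      F₁.arr a (by simp [copyTails, Cmd.for, Cmd.arrs, ha])]
  have b34 : τ₃.arr 4 = τ₁.arr 4 := by
    rw [F₃.arr 4 (by decide)]
    simp only [evalRules]
    rw [F₂.arr 4 (by decide)]
  refine wp_seq ((sizes_spec (n := N.n) (m := N.m) (K := K) (D := D) (I := I + 1) (L := L)
    (R := 2 * L) hL rfl rfl (by omega) ((g3 0 (by decide)).trans hσ.r0)
    ((g3 1 (by decide)).trans hσ.r1) ((g3 3 (by decide)).trans hσ.r3) g5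
    (h37.trans (Nat.add_comm _ _))).mono ?_)
  rintro τ₄ T₄ F₄ ⟨⟨k8, k9, k10, k11, k12, k13, k14, k15⟩, hT₄⟩
  have b4 : ∀ a, τ₄.arr a = τ₃.arr a := fun a => F₄.arr a (by simp [sizes, Cmd.arrs])
  refine wp_seq ((markPath_spec h (by omega) ?_ ?_ ?_).mono ?_)
  · exact (F₄.reg 2 (by decide)).trans ((g3 2 (by decide)).trans hσ.r2)
  · rw [b4, b3 3 (by decide)]; exact hσ.a3
  · rw [b4, b3 5 (by decide)]; exact hσ.a5
  rintro τ₅ T₅ F₅ ⟨h55, hT₅⟩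
  have b5 : ∀ a, a ≠ 4 → a ≠ 5 → τ₅.arr a = σ.arr a := fun a h4 h5 => by
    rw [F₅.arr a (by simp [markPath, Cmd.for, Cmd.arrs, h5]), b4, b3 a h4]
  have c1 : ∀ e < N.m, τ₅.arr 1 e = N.head e := by rw [b5 1 (by decide) (by decide)]; exact hσ.a1
  have c2 : ∀ e < N.m, τ₅.arr 2 e = N.wt e := by rw [b5 2 (by decide) (by decide)]; exact hσ.a2
  have c4 : ∀ e < N.m, τ₅.arr 4 e = N.tail e := fun e he => by
    rw [F₅.arr 4 (by decide), b4, b34, h4 e he, hσ.a0 e he]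
  have g5' : ∀ r ∉ [30, 8, 9, 10, 11, 12, 13, 14, 15], τ₅.reg r = τ₃.reg r := by
    intro r hr
    simp only [List.mem_cons, List.not_mem_nil, or_false, not_or] at hr
    rw [F₅.reg r (by simp [markPath, Cmd.for, Cmd.regs, hr]),
      F₄.reg r (by simp [sizes, Cmd.regs, hr])]
  refine wp_seq ((pathArcs_spec h (by omega) hN ?_ c1 c2 c4 h55).mono ?_)
  · exact (g5' 1 (by decide)).trans ((g3 1 (by decide)).trans hσ.r1)
  rintro τ₆ T₆ F₆ ⟨h66, hT₆⟩
  have b6 : ∀ a, a ≠ 6 → τ₆.arr a = τ₅.arr a := fun a ha =>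
    F₆.arr a (by simp [pathArcs, Cmd.for, Cmd.arrs, ha])
  have g6 : ∀ r ∉ [30, 31, 32], τ₆.reg r = τ₅.reg r := by
    intro r hr
    simp only [List.mem_cons, List.not_mem_nil, or_false, not_or] at hr
    rw [F₆.reg r (by simp [pathArcs, Cmd.for, Cmd.regs, hr])]
  refine (pathDists_spec h hp (by omega) (fun j hj => by have := hd j hj; omega) ?_ ?_ h66
    ?_).mono ?_
  · exact (g6 2 (by decide)).trans ((g5' 2 (by decide)).trans ((g3 2 (by decide)).trans hσ.r2))
  · rw [b6 3 (by decide), b5 3 (by decide) (by decide)]; exact hσ.a3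
  · rw [b6 7 (by decide), b5 7 (by decide) (by decide)]; exact hσ.a7
  rintro τ₇ T₇ F₇ ⟨h77, hT₇⟩
  have b7 : ∀ a, a ≠ 7 → τ₇.arr a = τ₆.arr a := fun a ha =>
    F₇.arr a (by simp [pathDists, Cmd.for, Cmd.arrs, ha])
  have g7 : ∀ r ∉ [30, 31, 32], τ₇.reg r = τ₅.reg r := by
    intro r hr
    rw [← g6 r hr]
    simp only [List.mem_cons, List.not_mem_nil, or_false, not_or] at hr
    rw [F₇.reg r (by simp [pathDists, Cmd.for, Cmd.regs, hr])]
  have g7' : ∀ r ∉ [30, 31, 32], τ₇.reg r = τ₄.reg r := by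
    intro r hr
    rw [g7 r hr]
    simp only [List.mem_cons, List.not_mem_nil, or_false, not_or] at hr
    rw [F₅.reg r (by simp [markPath, Cmd.for, Cmd.regs, hr])]
  have g7s : ∀ r ∈ [4, 5, 7], τ₇.reg r = τ₃.reg r := fun r hr => by
    rw [g7 r (by revert r; decide), g5' r (by revert r; decide)]
  refine ⟨w, I, fun e he => by rw [← hσ.a2 e he]; exact hw e he, hwW, hI, ⟨?_, ?_, ?_, ?_, ?_, ?_,
    ?_, ?_, ?_, ?_, h77⟩, (g7s 4 (by decide)).trans g4, (g7s 5 (by decide)).trans g5,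
    (g7s 7 (by decide)).trans (h37.trans (Nat.add_comm _ _)), (g7' 8 (by decide)).trans k8,
    (g7' 13 (by decide)).trans k13, (g7' 14 (by decide)).trans k14,
    (g7' 15 (by decide)).trans k15, ?_⟩
  · exact (g7 0 (by decide)).trans ((g5' 0 (by decide)).trans ((g3 0 (by decide)).trans hσ.r0))
  · exact (g7 1 (by decide)).trans ((g5' 1 (by decide)).trans ((g3 1 (by decide)).trans hσ.r1))
  · exact (g7' 9 (by decide)).trans k9
  · exact (g7' 10 (by decide)).trans k10
  · exact (g7' 11 (by decide)).trans k11
  · exact (g7' 12 (by decide)).trans k12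
  · rw [b7 1 (by decide), b6 1 (by decide)]; exact c1
  · rw [b7 2 (by decide), b6 2 (by decide)]; exact c2
  · rw [b7 4 (by decide), b6 4 (by decide)]; exact c4
  · rw [b7 5 (by decide), b6 5 (by decide)]; exact h55
  · simp only [evalRules]
    omega

/-- The output of the construction, with `Y` entries per vertex. -/
structure Built (N : Net) (L D I Y : ℕ) (Js : ℕ → ℕ → ℕ) (A : ℕ → ℕ) : Prop where
  n : A 0 = N.n
  y : A 1 = Y
  pos : ∀ v < N.n, A (2 + v) = N.pos v
  dist : ∀ v < N.n, A (N.n + 2 + v) = N.dist v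
  scaled : Scaled N (N.n * L) L (2 ^ D) D Y (2 * N.n + 2) (2 * N.n + 2 + N.n * Y) I Js A

theorem build_spec {σ : State} (h : Route N p l d ω) (hσ : Input N p K l σ) (hp : 0 < p)
    (hpn : p ≤ N.n) (hN : ∀ e < N.m, N.tail e < N.n ∧ N.head e < N.n) (hW : ∀ e < N.m, N.wt e ≤ W)
    (hd : ∀ j < p, d j ≤ N.n * W) (hD : D = Nat.clog 2 N.n) (hK : 0 < K)
    (hL : L = 2 * K * (D + 2))
    (hB : 2 * K + 10 * N.n + 2 * (N.n * W) + 3 * N.m + D + 2 * L +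
      N.n * (2 * L) * (N.m * (2 * L) + 1) + 2 * (N.m * (2 * L)) + 4 * ((N.n * L) * (N.n * W)) +
      3 * (N.n * (2 * L)) + Nat.clog 2 (N.n * W) + 2 ^ (Nat.clog 2 (N.n * W) + 1) * (2 * L) +
      (Nat.clog 2 (N.n * W) + 1) * L + N.n * ((Nat.clog 2 (N.n * W) + 1) * L) + 20 < B) :
    Wp B build σ fun τ T => ∃ w I Js, (∀ e < N.m, N.wt e ≤ w) ∧ w ≤ W ∧
      I = Nat.clog 2 (N.n * w) ∧ Built N L D (I + 1) ((I + 1) * L) Js (τ.arr 0) ∧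
      τ.reg 0 = 2 * N.n + 2 + N.n * ((I + 1) * L) + (I + 1) * L ∧
      T ≤ 7000 * ((I + 2) * ((D + 1) * ((N.m + N.n + 1) * (2 * L + 1)))) := by
  have hB1 : 1 < B := by omega
  have hL0 : 0 < L := by rw [hL]; positivity
  refine wp_seq ((prepare_spec h hσ hp hpn hN hW hd hD hL (by omega)).mono ?_)
  rintro τ₁ T₁ F₁ ⟨w, I, hw, hwW, hI, hH, h4, h5, h7, h8, h13, h14, h15, hT₁⟩
  have hnw : N.n * w ≤ N.n * W := Nat.mul_le_mul_left _ hwW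
  have hIW : I ≤ Nat.clog 2 (N.n * W) := hI ▸ Nat.clog_mono_right 2 hnw
  have hY : (I + 1) * L ≤ (Nat.clog 2 (N.n * W) + 1) * L := Nat.mul_le_mul_right _ (by omega)
  have hnY : N.n * ((I + 1) * L) ≤ N.n * ((Nat.clog 2 (N.n * W) + 1) * L) :=
    Nat.mul_le_mul_left _ hY
  have h2I : 2 ^ (I + 1) * (2 * L) ≤ 2 ^ (Nat.clog 2 (N.n * W) + 1) * (2 * L) :=
    Nat.mul_le_mul_right _ (Nat.pow_le_pow_right (by omega) (by omega))
  obtain ⟨Y, hYe⟩ : ∃ Y, Y = (I + 1) * L := ⟨_, rfl⟩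
  rw [← hYe] at h13 h15 hY hnY
  refine wp_seq ((header_spec (n := N.n) (Y := Y) (by omega) hH.r0 h13).mono ?_)
  rintro τ₂ T₂ F₂ ⟨⟨a0, a1, a2, a3⟩, hT₂⟩
  have hT : 2 ^ D ≤ 2 * N.n + 1 := by
    rcases Nat.eq_zero_or_pos D with h0 | h0
    · rw [h0]; omega
    · have h1 : 2 ^ (D - 1) < N.n := Nat.pow_lt_of_lt_clog (by omega)
      have h2 : 2 ^ D = 2 ^ (D - 1) * 2 := by rw [← pow_succ]; congr 1; omega
      omega
  have hC : Caps B N (N.n * L) (2 * L) (2 ^ D) (N.m * (2 * L) + 1) (N.n * L * (N.n * W)) := by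
    refine ⟨hN, fun e he => Nat.mul_le_mul_left _ ((hW e he).trans
      (Nat.le_mul_of_pos_left _ (by omega))), fun v hv => Nat.mul_le_mul_left _ ?_,
      fun v hv => (h.pos_lt hv).trans hpn, rfl, by omega⟩
    by_cases h' : ∃ i < p, l i = v
    · obtain ⟨i, hi, rfl⟩ := h'
      rw [h.dist i hi]
      exact hd i hi
    · push Not at h'
      rw [h.dist_zero v hv h']
      exact Nat.zero_le _
  have hr : ∀ r, r ≠ 30 → τ₂.reg r = τ₁.reg r := fun r hr =>
    F₂.reg r (by simp [header, Cmd.for, Cmd.regs, hr])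
  refine wp_seq ((scales_spec (D := D) (L := L) (Y := Y) (I := I + 1) (b₁ := 2 * N.n + 2)
    (b₂ := 2 * N.n + 2 + N.n * Y) hC (hH.frame F₂ (by decide) (by decide)) rfl rfl (by omega) hL0
    (by omega) hYe le_rfl ((hr 4 (by decide)).trans h4) ((hr 5 (by decide)).trans h5)
    ((hr 7 (by decide)).trans h7) ((hr 8 (by decide)).trans h8) ((hr 13 (by decide)).trans h13)
    ((hr 14 (by decide)).trans h14) ((hr 15 (by decide)).trans h15)).mono ?_)
  rintro τ₃ T₃ F₃ ⟨⟨Js, hJs⟩, hlow, hT₃⟩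
  have k13 := (F₃.reg 13 (by decide)).trans ((hr 13 (by decide)).trans h13)
  have k15 := (F₃.reg 15 (by decide)).trans ((hr 15 (by decide)).trans h15)
  refine wp_assign_eq (v := 2 * N.n + 2 + N.n * Y + Y) ?_ ?_
  · simp only [evalRules, k13, k15]
    exact Nat.mod_eq_of_lt (by omega)
  refine ⟨w, I, Js, hw, hwW, hI, ?_⟩
  rw [← hYe]
  refine ⟨⟨?_, ?_, fun v hv => ?_, fun v hv => ?_, ?_⟩, ?_, ?_⟩
  · exact (hlow 0 (by omega)).trans a0
  · exact (hlow 1 (by omega)).trans a1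
  · exact (hlow (2 + v) (by omega)).trans ((a2 v hv).trans (hH.pos v hv))
  · exact (hlow (N.n + 2 + v) (by omega)).trans ((a3 v hv).trans (hH.dist v hv))
  · exact hJs
  · simp [evalRules]
  · simp only [evalRules]
    obtain ⟨X, hX⟩ : ∃ X, X = (N.m + N.n + 1) * (2 * L + 1) := ⟨_, rfl⟩
    have hX1 : N.m + N.n + 1 ≤ X := by rw [hX]; exact Nat.le_mul_of_pos_right _ (by omega)
    have hX2 : (D + 1) * X = D * X + X := by ring
    have hX3 : D ≤ D * X := Nat.le_mul_of_pos_right _ (by omega)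
    obtain ⟨Z, hZ⟩ : ∃ Z, Z = (D + 1) * X := ⟨_, rfl⟩
    have hZ3 : I ≤ I * Z := Nat.le_mul_of_pos_right _ (by omega)
    have hZ2 : (I + 1 + 1) * Z = I * Z + 2 * Z := by ring
    have hZ4 : (I + 2) * Z = I * Z + 2 * Z := by ring
    rw [← hX, ← hZ, hZ2] at hT₃
    rw [← hX, ← hZ, hZ4]
    omega

end
/-! ### The query program -/

/-- Binary search in the segment of array `0` that starts at register `6` and has register `3`
entries: register `9` gets a number `i + 1` such that entry `i` is below register `4` and entry
`i - 1` is not. -/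
def search : Cmd :=
  .assign 8 (𝐜 0) ;; .assign 9 (𝐫 3 + 𝐜 1) ;;
  .loop (Expr.lt (𝐫 8 + 𝐜 1) (𝐫 9))
    (.assign 10 ((𝐫 8 + 𝐫 9) / 𝐜 2) ;;
     .ite (Expr.lt (𝐥 0 (𝐫 6 + (𝐫 10 - 𝐜 1))) (𝐫 4)) (.assign 9 (𝐫 10)) (.assign 8 (𝐫 10)))

section
variable {B : ℕ} {σ : State}

/-- No monotonicity of `o` is assumed, and none is available across scales, whose tables are rounded
independently. Bisection keeps a high entry just below the window and a low one at its top, with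
both ends of the segment as virtual sentinels, and so finds some neighbouring pair that crosses
`px`; any such pair yields an admissible answer. The bounds are shifted by one so that the lower
sentinel is `0`. -/
theorem search_spec {Y b px : ℕ} {o : ℕ → ℕ} (hB : b + 2 * Y + 4 < B) (r3 : σ.reg 3 = Y)
    (r4 : σ.reg 4 = px) (r6 : σ.reg 6 = b) (ho : ∀ y < Y, σ.arr 0 (b + y) = o y) :
    Wp B search σ fun τ T => ∃ y ≤ Y, τ.reg 9 = y + 1 ∧ (y = Y ∨ o y < px) ∧
      (y ≠ 0 → px ≤ o (y - 1)) ∧ T ≤ 40 * (Nat.clog 2 (Y + 1) + 1) := by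
  have hB1 : 1 < B := by omega
  refine wp_seq (wp_assign_eq (v := 0) (Nat.zero_mod _) (wp_seq (wp_assign_eq (v := Y + 1) ?_
    ((wp_loop (fun τ b' => ∃ lo hi k, τ.reg 8 = lo ∧ τ.reg 9 = hi ∧ lo < hi ∧ hi ≤ Y + 1 ∧
      hi ≤ lo + 2 ^ k ∧ (hi = Y + 1 ∨ o (hi - 1) < px) ∧ (lo ≠ 0 → px ≤ o (lo - 1)) ∧ b' = 30 * k)
      (b := 30 * Nat.clog 2 (Y + 1)) ?_ ?_).mono ?_))))
  · simp only [evalRules, Nat.reduceEqDiff, reduceIte, r3, Nat.mod_eq_of_lt hB1]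
    exact Nat.mod_eq_of_lt (by omega)
  · refine ⟨0, Y + 1, Nat.clog 2 (Y + 1), ?_, ?_, by omega, le_rfl, ?_, .inl rfl,
      fun h => absurd rfl h, rfl⟩
    · simp [evalRules]
    · simp [evalRules]
    · rw [Nat.zero_add]; exact Nat.le_pow_clog (by omega) _
  · rintro τ _ hF ⟨lo, hi, k, h8, h9, hlt, hle, hk, ho1, ho2, rfl⟩ hg
    have f4 := hF.reg 4 (by decide)
    have f6 := hF.reg 6 (by decide)
    have f0 := hF.arr 0 (by decide)
    simp only [evalRules, Nat.reduceEqDiff, reduceIte, r4, r6] at f4 f6 f0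
    simp only [guardRules hB1, ne_eq, evalRules, h8, h9, Nat.mod_eq_of_lt hB1,
      Nat.mod_eq_of_lt (show lo + 1 < B by omega), not_le] at hg
    obtain ⟨k, rfl⟩ : ∃ k', k = k' + 1 := by
      refine ⟨k - 1, ?_⟩
      rcases Nat.eq_zero_or_pos k with h0 | h0
      · rw [h0, pow_zero] at hk; omega
      · omega
    rw [pow_succ] at hk
    refine wp_seq (wp_assign_eq (v := (lo + hi) / 2) ?_
      (wp_ite (fun hg' => ?_) (fun hg' => ?_)))
    · simp only [evalRules, h8, h9, Nat.mod_eq_of_lt (show lo + hi < B by omega),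
        Nat.mod_eq_of_lt (show 2 < B by omega)]
      exact Nat.mod_eq_of_lt (by omega)
    all_goals
      simp only [guardRules hB1, ne_eq, evalRules, Nat.reduceEqDiff, reduceIte, f4, f6, f0,
        Nat.mod_eq_of_lt hB1, Nat.mod_eq_of_lt (show (lo + hi) / 2 - 1 < B by omega),
        Nat.mod_eq_of_lt (show b + ((lo + hi) / 2 - 1) < B by omega),
        ho ((lo + hi) / 2 - 1) (by omega), not_le] at hg'
      refine wp_assign ?_
      simp only [evalRules, Nat.reduceEqDiff, reduceIte]
    · exact ⟨_, ⟨lo, (lo + hi) / 2, k, h8, rfl, by omega, by omega, by omega, .inr hg', ho2, rfl⟩,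
        by omega⟩
    · exact ⟨_, ⟨(lo + hi) / 2, hi, k, rfl, h9, by omega, hle, by omega, ho1, fun _ => hg', rfl⟩,
        by omega⟩
  · rintro τ T _ ⟨hg, _, ⟨lo, hi, k, h8, h9, hlt, hle, hk, ho1, ho2, rfl⟩, hT⟩
    simp only [guardRules hB1, evalRules, h8, h9, Nat.mod_eq_of_lt hB1,
      Nat.mod_eq_of_lt (show lo + 1 < B by omega)] at hg
    obtain rfl : hi = lo + 1 := by omega
    refine ⟨lo, by omega, h9, ?_, ho2, ?_⟩
    · rcases ho1 with h | h
      · exact .inl (by omega)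
      · exact .inr h
    · simp only [evalRules] at hT ⊢
      omega

/-- The query program. -/
def query : Cmd :=
  .assign 2 (𝐥 0 (𝐜 0)) ;; .assign 3 (𝐥 0 (𝐜 1)) ;; .assign 4 (𝐥 0 (𝐜 2 + 𝐫 0)) ;;
  .assign 5 (𝐥 0 (𝐜 2 + 𝐫 1)) ;; .assign 12 (𝐥 0 (𝐫 2 + 𝐜 2 + 𝐫 1)) ;;
  .assign 6 (𝐫 2 + 𝐫 2 + 𝐜 2 + 𝐫 1 * 𝐫 3) ;; .assign 7 (𝐫 2 + 𝐫 2 + 𝐜 2 + 𝐫 2 * 𝐫 3) ;;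
  search ;;
  .ite (Expr.eq (𝐫 9) (𝐫 3 + 𝐜 1)) (.assign 0 (𝐜 0))
    (.assign 0 (𝐜 1) ;; .assign 1 (𝐥 0 (𝐫 7 + (𝐫 9 - 𝐜 1)))) ;;
  .ite (𝐫 5)
    (.ite (Expr.lt (𝐫 5) (𝐫 4)) (.assign 0 (𝐜 1) ;; .assign 1 (𝐫 12))
      (.ite (Expr.eq (𝐫 5) (𝐫 4)) (.assign 0 (𝐜 0)) .skip))
    .skip

/-- What the query program answers from the words `A`, for the position `px` of `x` and the
position `pt` of `t`. -/
def Answered (A : ℕ → ℕ) (n Y t px pt : ℕ) (q : ℕ∞) : Prop :=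
  (pt ≠ 0 ∧ pt < px ∧ q = A (n + 2 + t)) ∨ (pt ≠ 0 ∧ pt = px ∧ q = ⊤) ∨
  (pt = 0 ∨ px < pt) ∧ ∃ y ≤ Y, (y ≠ 0 → px ≤ A (2 * n + 2 + t * Y + (y - 1))) ∧
    (y < Y ∧ A (2 * n + 2 + t * Y + y) < px ∧ q = A (2 * n + 2 + n * Y + y) ∨ y = Y ∧ q = ⊤)

theorem query_spec {A : ℕ → ℕ} {n Y x t : ℕ} (hB : 2 * n + n * Y + 2 * Y + 6 < B) (hx : x < n)
    (ht : t < n) (r0 : σ.reg 0 = x) (r1 : σ.reg 1 = t) (hn : A 0 = n) (hY : A 1 = Y)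
    (hA : ∀ i < 2 * n + 2 + n * Y + Y, σ.arr 0 i = A i) :
    Wp B query σ fun τ T => Answered A n Y t (A (2 + x)) (A (2 + t)) (queryAnswer τ) ∧
      T ≤ 150 * (Nat.clog 2 (Y + 1) + 1) := by
  have hB1 : 1 < B := by omega
  have htY : (t + 1) * Y ≤ n * Y := Nat.mul_le_mul_right _ ht
  rw [Nat.add_mul, one_mul] at htY
  have e : n + n + 2 = 2 * n + 2 := by omega
  refine wp_seq (wp_assign_eq (v := n) ?_ (wp_seq (wp_assign_eq (v := Y) ?_ (wp_seq
    (wp_assign_eq (v := A (2 + x)) ?_ (wp_seq (wp_assign_eq (v := A (2 + t)) ?_ (wp_seq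
    (wp_assign_eq (v := A (n + 2 + t)) ?_ (wp_seq (wp_assign_eq (v := 2 * n + 2 + t * Y) ?_ (wp_seq
    (wp_assign_eq (v := 2 * n + 2 + n * Y) ?_ (wp_seq ((search_spec (Y := Y)
    (b := 2 * n + 2 + t * Y) (px := A (2 + x)) (o := fun y => A (2 * n + 2 + t * Y + y)) (by omega)
    ?_ ?_ ?_ ?_).mono ?_)))))))))))))))
  case refine_11 =>
    intro y hy
    simp only [evalRules]
    exact hA _ (by omega)
  any_goals
    simp only [evalRules, Nat.reduceEqDiff, reduceIte, r0, r1, Nat.zero_mod, Nat.mod_eq_of_lt hB1,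
      Nat.mod_eq_of_lt (show 2 < B by omega), Nat.mod_eq_of_lt (show 2 + x < B by omega),
      Nat.mod_eq_of_lt (show 2 + t < B by omega), Nat.mod_eq_of_lt (show n + 2 < B by omega),
      Nat.mod_eq_of_lt (show n + 2 + t < B by omega), Nat.mod_eq_of_lt (show n + n < B by omega),
      e, Nat.mod_eq_of_lt (show 2 * n + 2 < B by omega),
      Nat.mod_eq_of_lt (show t * Y < B by omega), Nat.mod_eq_of_lt (show n * Y < B by omega),
      Nat.mod_eq_of_lt (show 2 * n + 2 + t * Y < B by omega),
      Nat.mod_eq_of_lt (show 2 * n + 2 + n * Y < B by omega),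
      hA 0 (by omega), hA 1 (by omega), hA (2 + x) (by omega), hA (2 + t) (by omega),
      hA (n + 2 + t) (by omega), hn, hY]
  rintro τ T hF ⟨y, hy, h9, hy1, hy2, hT⟩
  have f3 := hF.reg 3 (by decide)
  have f4 := hF.reg 4 (by decide)
  have f5 := hF.reg 5 (by decide)
  have f7 := hF.reg 7 (by decide)
  have f12 := hF.reg 12 (by decide)
  have f0 := hF.arr 0 (by decide)
  simp only [evalRules, Nat.reduceEqDiff, reduceIte] at f3 f4 f5 f7 f12 f0
  refine wp_seq (Wp.mono (Q := fun ρ T' => T' ≤ 20 ∧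
    (y < Y ∧ queryAnswer ρ = A (2 * n + 2 + n * Y + y) ∨ y = Y ∧ queryAnswer ρ = ⊤)) ?_ ?_)
  · refine wp_ite (fun hg => ?_) (fun hg => ?_) <;>
      simp only [guardRules hB1, ne_eq, evalRules, h9, f3, Nat.mod_eq_of_lt hB1,
        Nat.mod_eq_of_lt (show Y + 1 < B by omega), not_not] at hg
    · refine wp_assign ?_
      simp only [evalRules, queryAnswer, Nat.zero_mod, reduceIte, and_true]
      exact ⟨by omega, .inr (by omega)⟩
    · refine wp_seq (wp_assign (wp_assign ?_))
      simp only [evalRules, queryAnswer, Nat.reduceEqDiff, reduceIte, h9, f7, f0,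
        Nat.mod_eq_of_lt hB1, Nat.add_sub_cancel, Nat.mod_eq_of_lt (show y < B by omega),
        Nat.mod_eq_of_lt (show 2 * n + 2 + n * Y + y < B by omega)]
      rw [hA _ (by omega)]
      exact ⟨by omega, .inl ⟨by omega, rfl⟩⟩
  · rintro ρ T' hF' ⟨hT', hq⟩
    have g4 := (hF'.reg 4 (by decide)).trans f4
    have g5 := (hF'.reg 5 (by decide)).trans f5
    have g12 := (hF'.reg 12 (by decide)).trans f12
    have hs : (A (2 + t) = 0 ∨ A (2 + x) < A (2 + t)) →
        Answered A n Y t (A (2 + x)) (A (2 + t)) (queryAnswer ρ) := by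
      intro hc
      refine .inr (.inr ⟨hc, y, hy, hy2, ?_⟩)
      rcases hq with ⟨h1, h2⟩ | h
      · exact .inl ⟨h1, hy1.resolve_left (by omega), h2⟩
      · exact .inr h
    refine wp_ite (fun hg => wp_ite (fun hg' => ?_) (fun hg' => wp_ite (fun hg'' => ?_)
      (fun hg'' => ?_))) (fun hg => ?_) <;>
      simp only [evalRules, g5] at hg
    · simp only [guardRules hB1, ne_eq, evalRules, g4, g5, not_le] at hg'
      refine wp_seq (wp_assign (wp_assign ⟨.inl ⟨hg, hg', ?_⟩, ?_⟩))
      · simp [queryAnswer, evalRules, g12, Nat.mod_eq_of_lt hB1]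
      · simp only [evalRules]; omega
    · simp only [guardRules hB1, ne_eq, evalRules, g4, g5, not_not] at hg''
      refine wp_assign ⟨.inr (.inl ⟨hg, hg'', ?_⟩), ?_⟩
      · simp [queryAnswer, evalRules]
      · simp only [evalRules]; omega
    · simp only [guardRules hB1, ne_eq, evalRules, g4, g5] at hg' hg''
      exact wp_skip ⟨hs (.inr (by omega)), by simp only [evalRules]; omega⟩
    · exact wp_skip ⟨hs (.inl hg), by simp only [evalRules]; omega⟩

end
end WordRAM

namespace DepartingPath
open WordRAM

/-! ### Correctness of the two programs -/

section
variable {n : ℕ} {G : Digraph (Fin n)} {wt : Fin n → Fin n → ℕ} {E : List (Fin n × Fin n)}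
  {P : List (Fin n)} {s z : Fin n} {K W : ℕ}

theorem route_netOf (hE : ∀ u v : Fin n, (u, v) ∈ E ↔ G.Adj u v) (hP : IsPath G P s z) :
    ∃ ω, Route (netOf wt E P) P.length (fun j => (P.map Fin.val).getD j 0)
      (fun j => pathWeight wt (P.take (j + 1))) ω := by
  have hl : ∀ j (hj : j < P.length), (P.map Fin.val).getD j 0 = P[j] := fun j hj => by simp [hj]
  have hnd := hP.2.2.2
  have hoff : ∀ v < (netOf wt E P).n, (∀ j < P.length, (P.map Fin.val).getD j 0 ≠ v) →
      (netOf wt E P).pos v = 0 := by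
    intro v hv h
    refine netOf_pos_eq_zero (v := ⟨v, hv⟩) |>.2 fun hc => ?_
    obtain ⟨j, hj, hjv⟩ := List.getElem_of_mem hc
    exact h j hj ((hl j hj).trans (congrArg Fin.val hjv))
  refine ⟨fun j => if h : j + 1 < P.length then wt P[j] P[j + 1] else 0, ?_, hoff, ?_, ?_, ?_, ?_,
    ?_, ?_⟩
  · intro j hj
    rw [hl j hj, netOf_pos_getElem hnd hj]
  · intro j hj
    rw [hl j hj, netOf_dist_getElem hnd hj]
  · intro v hv h
    have h0 := hoff v hv h
    have h1 : (netOf wt E P).dist v = pathWeight wt (P.take ((netOf wt E P).pos v)) := rfl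
    rw [h1, h0]
    simp [pathWeight]
  · cases P <;> simp [pathWeight]
  · intro j hj
    simp only [hj, dite_true]
    exact pathWeight_take_succ wt hj
  · intro j hj
    obtain ⟨e, he, h1, h2, _⟩ := exists_edge (wt := wt) (P := P) hE (hP.adj_getElem hj)
    exact ⟨e, he, by rw [h1, hl j (by omega)], by rw [h2, hl (j + 1) hj]⟩
  · intro j hj e he h1 h2
    obtain ⟨h3, h4, h5⟩ := netOf_edge (wt := wt) (P := P) he
    rw [hl j (by omega), h3, Fin.val_inj] at h1
    rw [hl (j + 1) hj, h4, Fin.val_inj] at h2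
    simp only [hj, dite_true]
    rw [h5, h1, h2]

theorem input_buildInput :
    Input (netOf wt E P) P.length K (fun j => (P.map Fin.val).getD j 0)
      (buildInput wt E P K) := by
  constructor
  case a3 =>
    intro j hj
    simp [buildInput, ← List.map_eq_flatMap, hj]
  all_goals simp [buildInput, netOf]

/-- The words that the query program reads. -/
theorem getD_builtOracle {σ : State} {i : ℕ} (hi : i < σ.reg 0) :
    (builtOracle σ).getD i 0 = σ.arr 0 i := by
  simp [builtOracle, hi]

/-- The answers computed from the output of the construction are admissible. -/
theorem isAnswer_of_built (hE : ∀ u v : Fin n, (u, v) ∈ E ↔ G.Adj u v)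
    (hw1 : ∀ u v, G.Adj u v → 1 ≤ wt u v) (hP : IsShortestPath G wt P s z) {ε : ℝ} (hK : 0 < K)
    (hKε : (K : ℝ)⁻¹ ≤ ε) {L D I w : ℕ} (hL : L = 2 * K * (D + 2)) (hD : n ≤ 2 ^ D)
    (hw : ∀ e < (netOf wt E P).m, (netOf wt E P).wt e ≤ w) (hI : n * w ≤ 2 ^ I)
    {Js : ℕ → ℕ → ℕ} {A : ℕ → ℕ} (hA : Built (netOf wt E P) L D (I + 1) ((I + 1) * L) Js A)
    {f : ℕ} {hf : f < P.length} {t : Fin n} {q : ℕ∞}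
    (hq : Answered A n ((I + 1) * L) t (A (2 + P[f])) (A (2 + t)) q) :
    IsAnswer G wt P f hf s t ε q := by
  have hε : 0 < ε := lt_of_lt_of_le (by positivity) hKε
  have hL0 : 0 < L := by rw [hL]; positivity
  have hnd := hP.1.2.2.2
  have hpn : P.length ≤ n := by simpa using hnd.length_le_card
  have hp : A (2 + P[f]) = f + 1 := by
    rw [hA.pos _ P[f].is_lt, netOf_pos_getElem hnd hf]
  have ht := hA.pos t t.is_lt
  rw [hp] at hq
  have hT : Tables wt E P D L (I + 1) (2 ^ D) Js := hA.scaled.table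
  have ho : ∀ i < I + 1, ∀ r < L,
      A (2 * n + 2 + t * ((I + 1) * L) + (i * L + r)) = Js i (t * (2 * L) + (L + r)) := by
    intro i hi r hr
    rw [← hA.scaled.entry i hi t t.is_lt r hr, Nat.add_assoc]
    rfl
  -- The first `f + 1` vertices of `P` have positions `1` to `f + 1`, and position `0` means off the
  -- path.
  have hnotin : A (2 + t) = 0 ∨ f + 1 < A (2 + t) → t ∉ P.take (f + 1) := by
    intro hc hm
    obtain ⟨j, hj, hjt⟩ := List.getElem_of_mem hm
    rw [List.length_take] at hj
    rw [List.getElem_take] at hjt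
    rw [ht, ← hjt, netOf_pos_getElem hnd (by omega)] at hc
    omega
  rcases hq with ⟨h0, h1, rfl⟩ | ⟨h0, h1, rfl⟩ | ⟨h0, y, hy, hprev, h⟩
  · rw [ht] at h0 h1
    obtain ⟨i, hi, hti, hpi⟩ := netOf_pos_ne_zero h0 hnd
    have hd := hA.dist t t.is_lt
    have e : ddist G wt P f hf s t = (A (n + 2 + t) : ℕ) := by
      have hd' : A (n + 2 + t) = (netOf wt E P).dist t := hd
      rw [hd', hti, netOf_dist_getElem hnd hi, ddist_of_lt hP (by omega)]
    rw [← e]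
    exact .of_eq hε
  · rw [ht] at h0 h1
    obtain ⟨i, hi, hti, hpi⟩ := netOf_pos_ne_zero h0 hnd
    have : i = f := by omega
    subst this
    rw [← ddist_self (G := G) (wt := wt) (hf := hf) (s := s) t hti]
    exact .of_eq hε
  · rcases h with ⟨hyY, hy1, rfl⟩ | ⟨rfl, rfl⟩
    · exact Tables.isAnswer hE hw1 hP hK hKε hL hT (by omega) (hnotin h0)
        (o := fun y => A (2 * n + 2 + t * ((I + 1) * L) + y))
        (V := fun y => A (2 * n + 2 + n * ((I + 1) * L) + y)) ho
        (fun i hi r hr => hA.scaled.value i hi r hr) hyY (by simpa using Nat.lt_succ_iff.1 hy1)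
        (fun h => hprev h)
    · have hY : (I + 1) * L - 1 = I * L + (L - 1) := by rw [Nat.add_mul, one_mul]; omega
      have h1 := hprev (by positivity)
      rw [hY, ho I (by omega) (L - 1) (by omega)] at h1
      rw [← Tables.ddist_eq_top (hf := hf) hE (W := w) ?_ hP hK hL hT (hnotin h0) hI h1]
      · exact .of_eq hε
      -- Every edge of the graph occurs in the list, so the measured maximum bounds all edge
      -- weights.
      · intro u v huv
        obtain ⟨e, he, -, -, h5⟩ := exists_edge (wt := wt) (P := P) hE huv
        rw [← h5]
        exact hw e he

/-- The construction and the queries, with bounds in terms of the parameters of the tables. -/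
theorem exists_oracle (hE : ∀ u v : Fin n, (u, v) ∈ E ↔ G.Adj u v)
    (hw : ∀ u v, G.Adj u v → 1 ≤ wt u v ∧ wt u v ≤ W) (hP : IsShortestPath G wt P s z) {ε : ℝ}
    (hK : 0 < K) (hKε : (K : ℝ)⁻¹ ≤ ε) {B D L I m : ℕ} (hm : m = E.length) (hD : D = Nat.clog 2 n)
    (hI : I = Nat.clog 2 (n * W) + 1) (hL : L = 2 * K * (D + 2))
    (hB : 2 * K + 10 * n + 2 * (n * W) + 3 * m + D + 2 * L +
      n * (2 * L) * (m * (2 * L) + 1) + 2 * (m * (2 * L)) + 4 * ((n * L) * (n * W)) +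
      3 * (n * (2 * L)) + I + 2 ^ I * (2 * L) + 3 * (I * L) + n * (I * L) + 20 < B) :
    ∃ (σ : State) (T : ℕ) (q : Fin n → Fin n → ℕ∞), Exec B build (buildInput wt E P K) σ T ∧
      T ≤ 7000 * ((I + 1) * ((D + 1) * ((m + n + 1) * (2 * L + 1)))) ∧
      (builtOracle σ).length ≤ 2 * n + 2 + n * (I * L) + I * L ∧
      IsDPO G wt s P ε q ∧
      ∀ x ∈ P, ∀ t : Fin n, ∃ (τ : State) (T' : ℕ),
        Exec B query (queryInput (builtOracle σ) x t) τ T' ∧ queryAnswer τ = q x t ∧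
          T' ≤ 150 * (Nat.clog 2 (I * L + 1) + 1) := by
  have hnd := hP.1.2.2.2
  have hp0 : 0 < P.length := by
    rcases P with _ | ⟨a, P⟩
    · simp [IsShortestPath, IsPath] at hP
    · simp
  have hpn : P.length ≤ n := by simpa using hnd.length_le_card
  obtain ⟨ω, hR⟩ := route_netOf (wt := wt) hE hP.1
  have hWe : ∀ e < (netOf wt E P).m, (netOf wt E P).wt e ≤ W := by
    intro e he
    obtain ⟨-, -, h5⟩ := netOf_edge (wt := wt) (P := P) he
    rw [h5]
    exact (hw _ _ ((hE _ _).1 (List.getElem_mem he))).2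
  have hd : ∀ j < P.length, pathWeight wt (P.take (j + 1)) ≤ n * W := fun j hj =>
    (hP.1.take hj).pathWeight_le fun u v h => (hw u v h).2
  have e1 : (netOf wt E P).n = n := rfl
  have e2 : (netOf wt E P).m = m := hm.symm
  obtain ⟨σ, T, hex, w, I', Js, hww, hwW, hI', hbuilt, hreg, hT⟩ :=
    build_spec (B := B) (D := D) (L := L) hR input_buildInput hp0 hpn (fun e he => netOf_lt he)
      hWe hd hD hK hL (by rw [e1, e2, ← hI]; omega)
  rw [e1] at hI'
  rw [e1] at hreg
  rw [e1, e2] at hT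
  -- The program uses the measured maximum weight, so it builds at most as many scales as the bound
  -- in terms of `W` allows.
  have hII : I' + 1 ≤ I := by
    rw [hI, hI']
    exact Nat.succ_le_succ (Nat.clog_mono_right 2 (Nat.mul_le_mul_left _ hwW))
  have hY : (I' + 1) * L ≤ I * L := Nat.mul_le_mul_right _ hII
  have hnY : n * ((I' + 1) * L) ≤ n * (I * L) := Nat.mul_le_mul_left _ hY
  have hquery : ∀ x t : Fin n, ∃ (τ : State) (T' : ℕ),
      Exec B query (queryInput (builtOracle σ) x t) τ T' ∧
      Answered (σ.arr 0) n ((I' + 1) * L) t (σ.arr 0 (2 + x)) (σ.arr 0 (2 + t)) (queryAnswer τ) ∧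
      T' ≤ 150 * (Nat.clog 2 ((I' + 1) * L + 1) + 1) := by
    intro x t
    refine query_spec (A := σ.arr 0) (x := x) (by omega) x.is_lt t.is_lt ?_ ?_ hbuilt.n hbuilt.y ?_
    · simp [queryInput]
    · simp [queryInput]
    · intro i hi
      simp only [queryInput, if_true]
      exact getD_builtOracle (by omega)
  choose τ T' h1 h2 h3 using hquery
  refine ⟨σ, T, fun x t => queryAnswer (τ x t), hex, hT.trans ?_, ?_, fun f hf t => ?_,
    fun x _ t => ⟨τ x t, T' x t, h1 x t, rfl, (h3 x t).trans ?_⟩⟩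
  · exact Nat.mul_le_mul_left _ (Nat.mul_le_mul_right _ (by omega))
  · simp only [builtOracle, List.length_map, List.length_range]
    omega
  · exact isAnswer_of_built hE (fun u v h => (hw u v h).1) hP hK hKε hL
      (hD ▸ Nat.le_pow_clog (by omega) n) hww (hI' ▸ Nat.le_pow_clog (by omega) _) hbuilt
      (h2 P[f] t)
  · gcongr

end
/-! ### Sizes -/

theorem mul_le_pow {X a b i j : ℕ} (ha : a ≤ X ^ i) (hb : b ≤ X ^ j) : a * b ≤ X ^ (i + j) := by
  rw [pow_add]
  exact Nat.mul_le_mul ha hb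

theorem le_pow_of_le {X a i j : ℕ} (hX : 2 ≤ X) (ha : a ≤ X ^ i) (hij : i ≤ j) : a ≤ X ^ j :=
  ha.trans (Nat.pow_le_pow_right (by omega) hij)

theorem two_pow_clog_le {t : ℕ} (ht : 0 < t) : 2 ^ Nat.clog 2 t ≤ 2 * t := by
  rcases Nat.eq_zero_or_pos (Nat.clog 2 t) with h0 | h0
  · rw [h0]; omega
  · have h1 : 2 ^ (Nat.clog 2 t - 1) < t := Nat.pow_lt_of_lt_clog (by omega)
    have h2 : 2 ^ Nat.clog 2 t = 2 ^ (Nat.clog 2 t - 1) * 2 := by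
      rw [← pow_succ]; congr 1; omega
    omega

/-- Nothing overflows when words are long enough. -/
theorem word_size {n W K m D I L : ℕ} (hn : 0 < n) (hW : 0 < W) (hK : 0 < K) (hm : m ≤ n * n)
    (hD : D = Nat.clog 2 n) (hI : I = Nat.clog 2 (n * W) + 1) (hL : L = 2 * K * (D + 2)) :
    2 * K + 10 * n + 2 * (n * W) + 3 * m + D + 2 * L +
      n * (2 * L) * (m * (2 * L) + 1) + 2 * (m * (2 * L)) + 4 * ((n * L) * (n * W)) +
      3 * (n * (2 * L)) + I + 2 ^ I * (2 * L) + 3 * (I * L) + n * (I * L) + 20 <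
    (n * W * K + 1) ^ 18 := by
  obtain ⟨X, hX⟩ : ∃ X, X = n * W * K + 1 := ⟨_, rfl⟩
  rw [← hX]
  have hnW : 0 < n * W := Nat.mul_pos hn hW
  have h1 : n * W ≤ n * W * K := Nat.le_mul_of_pos_right _ hK
  have h2 : n ≤ n * W := Nat.le_mul_of_pos_right _ hW
  have h3 : K ≤ n * W * K := Nat.le_mul_of_pos_left _ hnW
  have hX2 : 2 ≤ X := by omega
  have c2 : 2 ≤ X ^ 1 := by rw [pow_one]; exact hX2
  have cc : ∀ i a, a ≤ 2 ^ i → a ≤ X ^ i := fun i a h => h.trans (Nat.pow_le_pow_left hX2 i)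
  have bK : K ≤ X ^ 1 := by rw [pow_one]; omega
  have bn : n ≤ X ^ 1 := by rw [pow_one]; omega
  have bN : n * W ≤ X ^ 1 := by rw [pow_one]; omega
  have bm : m ≤ X ^ 2 := hm.trans (mul_le_pow bn bn)
  have hDn : D ≤ n := hD ▸ Nat.clog_le_of_le_pow Nat.lt_two_pow_self.le
  have bD : D ≤ X ^ 1 := hDn.trans bn
  have bD2 : D + 2 ≤ X ^ 2 := by
    have : X * 2 ≤ X * X := Nat.mul_le_mul_left _ hX2
    rw [sq]; omega
  have bL : L ≤ X ^ 4 := hL ▸ mul_le_pow (mul_le_pow c2 bK) bD2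
  have bL2 : 2 * L ≤ X ^ 5 := mul_le_pow c2 bL
  have bI : I ≤ X ^ 1 := by
    have : Nat.clog 2 (n * W) ≤ n * W := Nat.clog_le_of_le_pow Nat.lt_two_pow_self.le
    rw [pow_one]; omega
  have bI2 : 2 ^ I ≤ X ^ 3 := by
    have := two_pow_clog_le hnW
    rw [hI, pow_succ, mul_comm]
    exact mul_le_pow c2 (this.trans (mul_le_pow c2 bN))
  have bm1 : m * (2 * L) + 1 ≤ X ^ 8 := by
    have h4 : m * (2 * L) ≤ X ^ 7 := mul_le_pow bm bL2
    have h5 : 1 ≤ X ^ 7 := Nat.one_le_pow _ _ (by omega)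
    have h6 : X ^ 8 = X ^ 7 * X := pow_succ _ _
    have h7 : X ^ 7 * 2 ≤ X ^ 7 * X := Nat.mul_le_mul_left _ hX2
    omega
  -- Each of the fifteen summands is at most `X ^ 14`, and `16 * X ^ 14 ≤ X ^ 18` because `X ≥ 2`;
  -- this is the origin of the exponent `18`.
  have t1 := le_pow_of_le (j := 14) hX2 (mul_le_pow c2 bK) (by norm_num)
  have t2 := le_pow_of_le (j := 14) hX2 (mul_le_pow (cc 4 10 (by norm_num)) bn) (by norm_num)
  have t3 := le_pow_of_le (j := 14) hX2 (mul_le_pow c2 bN) (by norm_num)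
  have t4 := le_pow_of_le (j := 14) hX2 (mul_le_pow (cc 2 3 (by norm_num)) bm) (by norm_num)
  have t5 := le_pow_of_le (j := 14) hX2 bD (by norm_num)
  have t6 := le_pow_of_le (j := 14) hX2 bL2 (by norm_num)
  have t7 := le_pow_of_le (j := 14) hX2 (mul_le_pow (mul_le_pow bn bL2) bm1) (by norm_num)
  have t8 := le_pow_of_le (j := 14) hX2 (mul_le_pow c2 (mul_le_pow bm bL2)) (by norm_num)
  have t9 := le_pow_of_le (j := 14) hX2 (mul_le_pow (cc 2 4 (by norm_num))
    (mul_le_pow (mul_le_pow bn bL) bN)) (by norm_num)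
  have t10 := le_pow_of_le (j := 14) hX2 (mul_le_pow (cc 2 3 (by norm_num))
    (mul_le_pow bn bL2)) (by norm_num)
  have t11 := le_pow_of_le (j := 14) hX2 bI (by norm_num)
  have t12 := le_pow_of_le (j := 14) hX2 (mul_le_pow bI2 bL2) (by norm_num)
  have t13 := le_pow_of_le (j := 14) hX2 (mul_le_pow (cc 2 3 (by norm_num))
    (mul_le_pow bI bL)) (by norm_num)
  have t14 := le_pow_of_le (j := 14) hX2 (mul_le_pow bn (mul_le_pow bI bL)) (by norm_num)
  have t15 := le_pow_of_le (j := 14) hX2 (cc 5 20 (by norm_num)) (by norm_num)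
  have t16 : 16 * X ^ 14 ≤ X ^ 18 := mul_le_pow (i := 4) (cc 4 16 (by norm_num)) le_rfl
  have t17 : 0 < X ^ 14 := by positivity
  omega

/-! ### The bounds in terms of logarithms -/

/-- Take logarithms in `2 ^ Nat.clog 2 x ≤ 2 * x` and use `Real.log 2 > 1 / 2`. -/
theorem clog_le_log {x : ℕ} (hx : 0 < x) : (Nat.clog 2 x : ℝ) ≤ 2 * Real.log x + 1 := by
  have h1 := two_pow_clog_le hx
  have h2 : ((2 : ℝ) ^ Nat.clog 2 x) ≤ 2 * x := by exact_mod_cast h1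
  have hx' : (0 : ℝ) < x := by exact_mod_cast hx
  have h3 := Real.log_le_log (by positivity) h2
  rw [Real.log_pow, Real.log_mul (by norm_num) hx'.ne'] at h3
  have h4 := Real.log_two_gt_d9
  have h5 : 0 ≤ Real.log x := Real.log_natCast_nonneg x
  by_contra hc
  push Not at hc
  have h6 : (2 * Real.log x + 1) * Real.log 2 < Nat.clog 2 x * Real.log 2 :=
    mul_lt_mul_of_pos_right hc (by linarith)
  nlinarith

theorem one_lt_log_three : 1 < Real.log 3 := by
  rw [Real.lt_log_iff_exp_lt (by norm_num)]
  exact Real.exp_one_lt_d9.trans (by norm_num)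

section
variable {n W K m D I L : ℕ} {ε : ℝ}

/-- The parameters of the tables for `n ≥ 3`. -/
theorem params_le (hn : 3 ≤ n) (hW : 1 ≤ W) (hε : 0 < ε) (hε1 : ε ≤ 1) (hK : K = ⌈ε⁻¹⌉₊)
    (hD : D = Nat.clog 2 n) (hI : I = Nat.clog 2 (n * W) + 1) (hL : L = 2 * K * (D + 2)) :
    1 ≤ ε⁻¹ ∧ 1 ≤ Real.log n ∧ Real.log 3 ≤ Real.log (n * W) ∧ (D : ℝ) ≤ 3 * Real.log n ∧
      (I : ℝ) ≤ 4 * Real.log (n * W) ∧ (L : ℝ) ≤ 20 * (ε⁻¹ * Real.log n) := by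
  have h3 := one_lt_log_three
  have hnr : (3 : ℝ) ≤ n := by exact_mod_cast hn
  have hWr : (1 : ℝ) ≤ W := by exact_mod_cast hW
  have e1 : 1 ≤ ε⁻¹ := (one_le_inv₀ hε).2 hε1
  have e2 : Real.log 3 ≤ Real.log n := Real.log_le_log (by norm_num) hnr
  have e3 : Real.log n ≤ Real.log (n * W) := Real.log_le_log (by linarith) (by nlinarith)
  have hKr : (K : ℝ) ≤ 2 * ε⁻¹ := by
    have := Nat.ceil_lt_add_one (zero_le_one.trans e1)
    rw [hK]
    linarith
  have hDr : (D : ℝ) ≤ 2 * Real.log n + 1 := hD ▸ clog_le_log (by omega)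
  have hIr : (I : ℝ) ≤ 2 * Real.log (n * W) + 1 + 1 := by
    have := clog_le_log (Nat.mul_pos (by omega : 0 < n) hW)
    rw [hI]
    push_cast at this ⊢
    linarith
  refine ⟨e1, by linarith, by linarith, by linarith, by linarith, ?_⟩
  rw [hL]
  push_cast
  calc (2 * K * (D + 2) : ℝ) ≤ 2 * (2 * ε⁻¹) * (5 * Real.log n) := by
        gcongr
        linarith
    _ = _ := by ring

theorem time_le {T : ℕ} (hn : 3 ≤ n) (hW : 1 ≤ W) (hε : 0 < ε) (hε1 : ε ≤ 1) (hK : K = ⌈ε⁻¹⌉₊)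
    (hD : D = Nat.clog 2 n) (hI : I = Nat.clog 2 (n * W) + 1) (hL : L = 2 * K * (D + 2))
    (hT : T ≤ 7000 * ((I + 1) * ((D + 1) * ((m + n + 1) * (2 * L + 1))))) :
    (T : ℝ) ≤ 20000000 * (ε⁻¹ * Real.log n ^ 2 * Real.log (n * W) * (m + n * Real.log n)) := by
  obtain ⟨h1, h2, h3, h4, h5, h6⟩ := params_le hn hW hε hε1 hK hD hI hL
  have h7 := one_lt_log_three
  have hnr : (3 : ℝ) ≤ n := by exact_mod_cast hn
  have hTr : (T : ℝ) ≤ 7000 * ((I + 1) * ((D + 1) * ((m + n + 1) * (2 * L + 1)))) := by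
    exact_mod_cast hT
  have h8 : 1 ≤ ε⁻¹ * Real.log n := one_le_mul_of_one_le_of_one_le h1 h2
  have hm : (0 : ℝ) ≤ m := Nat.cast_nonneg m
  calc (T : ℝ) ≤ 7000 * ((I + 1) * ((D + 1) * ((m + n + 1) * (2 * L + 1)))) := hTr
    -- For `n ≥ 3` all logarithms and `ε⁻¹` are at least `1`, so every additive constant is absorbed
    -- by its factor.
    _ ≤ 7000 * ((5 * Real.log (n * W)) * ((4 * Real.log n) * ((2 * (m + n * Real.log n)) *
        (41 * (ε⁻¹ * Real.log n))))) := by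
        gcongr <;> nlinarith
    _ = 11480000 * (ε⁻¹ * Real.log n ^ 2 * Real.log (n * W) * (m + n * Real.log n)) := by ring
    _ ≤ _ := by
        have : 0 ≤ Real.log (n * W) := by linarith
        gcongr
        norm_num

theorem size_le {S : ℕ} (hn : 3 ≤ n) (hW : 1 ≤ W) (hε : 0 < ε) (hε1 : ε ≤ 1) (hK : K = ⌈ε⁻¹⌉₊)
    (hD : D = Nat.clog 2 n) (hI : I = Nat.clog 2 (n * W) + 1) (hL : L = 2 * K * (D + 2))
    (hS : S ≤ 2 * n + 2 + n * (I * L) + I * L) :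
    (S : ℝ) ≤ 20000000 * (ε⁻¹ * n * Real.log n ^ 2 * Real.log (n * W)) := by
  obtain ⟨h1, h2, h3, h4, h5, h6⟩ := params_le hn hW hε hε1 hK hD hI hL
  have h7 := one_lt_log_three
  have hnr : (3 : ℝ) ≤ n := by exact_mod_cast hn
  have hSr : (S : ℝ) ≤ 2 * n + 2 + n * (I * L) + I * L := by exact_mod_cast hS
  have hpos : 0 ≤ 4 * Real.log (n * W) := by linarith
  have hIL : (I * L : ℝ) ≤ 80 * (ε⁻¹ * Real.log n * Real.log (n * W)) :=
    calc (I * L : ℝ) ≤ (4 * Real.log (n * W)) * (20 * (ε⁻¹ * Real.log n)) := by gcongr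
      _ = _ := by ring
  have h8 : 1 ≤ ε⁻¹ * Real.log n * Real.log (n * W) :=
    one_le_mul_of_one_le_of_one_le (one_le_mul_of_one_le_of_one_le h1 h2) (by linarith)
  obtain ⟨y, hy⟩ : ∃ y, y = ε⁻¹ * Real.log n * Real.log (n * W) := ⟨_, rfl⟩
  rw [← hy] at hIL h8
  have e : ε⁻¹ * n * Real.log n ^ 2 * Real.log (n * W) = n * y * Real.log n := by rw [hy]; ring
  rw [e]
  have h9 : (n : ℝ) * y ≤ n * y * Real.log n := le_mul_of_one_le_right (by positivity) h2
  have h10 : (n : ℝ) * (I * L) ≤ n * (80 * y) := by gcongr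
  nlinarith

/-- The search takes `O(1 + log log n + log (ε⁻¹ log (n W)))` steps. To turn the sum into the stated
product, the factor `log (ε⁻¹ log (n W))` is bounded below by the positive constant `log (log 3)`,
whose inverse therefore enters the constant. -/
theorem query_le {T : ℕ} (hn : 3 ≤ n) (hW : 1 ≤ W) (hε : 0 < ε) (hε1 : ε ≤ 1) (hK : K = ⌈ε⁻¹⌉₊)
    (hD : D = Nat.clog 2 n) (hI : I = Nat.clog 2 (n * W) + 1) (hL : L = 2 * K * (D + 2))
    (hT : T ≤ 150 * (Nat.clog 2 (I * L + 1) + 1)) :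
    (T : ℝ) ≤ (300 + 25000 * (Real.log (Real.log 3))⁻¹) *
      (Real.log n * Real.log (ε⁻¹ * Real.log (n * W))) := by
  obtain ⟨h1, h2, h3, h4, h5, h6⟩ := params_le hn hW hε hε1 hK hD hI hL
  have h7 := one_lt_log_three
  have hTr : (T : ℝ) ≤ 150 * (Nat.clog 2 (I * L + 1) + 1) := by exact_mod_cast hT
  have hc := clog_le_log (Nat.succ_pos (I * L))
  have hε' : 0 < ε⁻¹ := by linarith
  have hpos : 0 < Real.log (n * W) := by linarith
  have hIL : ((I * L + 1 : ℕ) : ℝ) ≤ 81 * (Real.log n * (ε⁻¹ * Real.log (n * W))) := by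
    push_cast
    have h8 : 1 ≤ Real.log n * (ε⁻¹ * Real.log (n * W)) :=
      one_le_mul_of_one_le_of_one_le h2 (one_le_mul_of_one_le_of_one_le h1 (by linarith))
    calc (I * L + 1 : ℝ) ≤ (4 * Real.log (n * W)) * (20 * (ε⁻¹ * Real.log n)) + 1 := by gcongr
      _ = 80 * (Real.log n * (ε⁻¹ * Real.log (n * W))) + 1 := by ring
      _ ≤ _ := by linarith
  have hlog := Real.log_le_log (by positivity) hIL
  rw [Real.log_mul (by norm_num) (by positivity), Real.log_mul (by linarith) (by positivity)] at hlog
  have h9 : Real.log 81 ≤ 81 - 1 := Real.log_le_sub_one_of_pos (by norm_num)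
  have h10 : Real.log (Real.log n) ≤ Real.log n - 1 := Real.log_le_sub_one_of_pos (by linarith)
  have hu0 : 0 < Real.log (Real.log 3) := Real.log_pos h7
  have hu : Real.log (Real.log 3) ≤ Real.log (ε⁻¹ * Real.log (n * W)) :=
    Real.log_le_log (by linarith) (h3.trans (le_mul_of_one_le_left hpos.le h1))
  obtain ⟨u, hu'⟩ : ∃ u, u = Real.log (ε⁻¹ * Real.log (n * W)) := ⟨_, rfl⟩
  obtain ⟨l, hl'⟩ : ∃ l, l = Real.log n := ⟨_, rfl⟩
  obtain ⟨v, hv'⟩ : ∃ v, v = (Real.log (Real.log 3))⁻¹ := ⟨_, rfl⟩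
  have hv : 1 ≤ v * u := by
    rw [hv', inv_mul_eq_div, one_le_div hu0, hu']
    exact hu
  rw [← hu'] at hlog hu ⊢
  rw [← hl'] at hlog h10 h2 ⊢
  rw [← hv']
  have hu1 : 0 ≤ u := hu0.le.trans hu
  have h11 : u ≤ l * u := le_mul_of_one_le_left hu1 h2
  have h12 : l ≤ l * (v * u) := le_mul_of_one_le_right (by linarith) hv
  have h13 : (300 + 25000 * v) * (l * u) = 300 * (l * u) + 25000 * (l * (v * u)) := by ring
  rw [h13]
  have h14 : (Nat.clog 2 (I * L + 1) : ℝ) ≤ 2 * (80 + l + u) + 1 := by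
    push_cast at hc hlog ⊢
    linarith
  linarith

end
end DepartingPath
theorem mainTheorem8 :
    ∃ (build query : WordRAM.Cmd) (C : ℝ) (c : ℕ),
      ∀ (n W : ℕ) (G : Digraph (Fin n)) (wt : Fin n → Fin n → ℕ) (E : List (Fin n × Fin n))
        (s z : Fin n) (P : List (Fin n)) (ε : ℝ) (wordLen : ℕ),
        1 ≤ W →
        (∀ u v : Fin n, G.Adj u v → 1 ≤ wt u v ∧ wt u v ≤ W) →
        E.Nodup → (∀ u v : Fin n, (u, v) ∈ E ↔ G.Adj u v) →
        DepartingPath.IsShortestPath G wt P s z →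
        0 < ε → ε ≤ 1 →
        (n * W * ⌈ε⁻¹⌉₊ + 1) ^ c ≤ 2 ^ wordLen →
        ∃ (σ : WordRAM.State) (T : ℕ) (q : Fin n → Fin n → ℕ∞),
          WordRAM.Exec (2 ^ wordLen) build (DepartingPath.buildInput wt E P ⌈ε⁻¹⌉₊) σ T ∧
          (3 ≤ n →
            (T : ℝ) ≤ C * (ε⁻¹ * Real.log n ^ 2 * Real.log (n * W) *
              (E.length + n * Real.log n)) ∧
            ((DepartingPath.builtOracle σ).length : ℝ) ≤
              C * (ε⁻¹ * n * Real.log n ^ 2 * Real.log (n * W))) ∧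
          DepartingPath.IsDPO G wt s P ε q ∧
          ∀ x ∈ P, ∀ t : Fin n, ∃ (τ : WordRAM.State) (T' : ℕ),
            WordRAM.Exec (2 ^ wordLen) query
              (DepartingPath.queryInput (DepartingPath.builtOracle σ) x t) τ T' ∧
            DepartingPath.queryAnswer τ = q x t ∧
            (3 ≤ n →
              (T' : ℝ) ≤ C * (Real.log n * Real.log (ε⁻¹ * Real.log (n * W)))) := by
  -- One constant serves all three bounds; its second term is needed only for the query time. The
  -- exponent is that of `word_size`.
  refine ⟨WordRAM.build, WordRAM.query, 20000000 + 25000 * (Real.log (Real.log 3))⁻¹, 18, ?_⟩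
  intro n W G wt E s z P ε wordLen hW hw hnd hE hP hε hε1 hB
  have hn : 0 < n := s.pos
  have hε' : 0 < ε⁻¹ := inv_pos.2 hε
  have hK : 0 < ⌈ε⁻¹⌉₊ := Nat.ceil_pos.2 hε'
  have hKε : ((⌈ε⁻¹⌉₊ : ℕ) : ℝ)⁻¹ ≤ ε := inv_le_of_inv_le₀ hε (Nat.le_ceil _)
  -- Without repetitions the list has at most `n * n` edges, so word lengths polynomial in `n` also
  -- cover `m`.
  have hm : E.length ≤ n * n := by
    simpa using hnd.length_le_card
  have hv : 0 < (Real.log (Real.log 3))⁻¹ :=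
    inv_pos.2 (Real.log_pos DepartingPath.one_lt_log_three)
  obtain ⟨σ, T, q, h1, h2, h3, h4, h5⟩ := DepartingPath.exists_oracle hE hw hP hK hKε
    (B := 2 ^ wordLen) rfl rfl rfl rfl
    ((DepartingPath.word_size hn hW hK hm rfl rfl rfl).trans_le hB)
  have hlog : ∀ x : ℕ, 0 ≤ Real.log x := Real.log_natCast_nonneg
  have hlogW : 0 ≤ Real.log (n * W) := by exact_mod_cast hlog (n * W)
  refine ⟨σ, T, q, h1, fun hn3 => ⟨?_, ?_⟩, h4, fun x hx t => ?_⟩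
  · refine (DepartingPath.time_le hn3 hW hε hε1 rfl rfl rfl rfl h2).trans ?_
    have := hlog n
    gcongr
    linarith
  · refine (DepartingPath.size_le hn3 hW hε hε1 rfl rfl rfl rfl h3).trans ?_
    gcongr
    linarith
  · obtain ⟨τ, T', h6, h7, h8⟩ := h5 x hx t
    refine ⟨τ, T', h6, h7, fun hn3 => ?_⟩
    refine (DepartingPath.query_le hn3 hW hε hε1 rfl rfl rfl rfl h8).trans ?_
    obtain ⟨e1, e2, e3, -⟩ := DepartingPath.params_le hn3 hW hε hε1 rfl rfl rfl rfl
    have := DepartingPath.one_lt_log_three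
    have : 0 ≤ Real.log (ε⁻¹ * Real.log (n * W)) :=
      Real.log_nonneg (one_le_mul_of_one_le_of_one_le e1 (by linarith))
    gcongr
    norm_num
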